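/- Let $\mathcal{X}$ be a locally noetherian formal scheme, let $\mathcal{I}$ be its largest ideal of definition, and let $\mathcal{X}_{\mathrm{red}}=(\mathcal{X},\mathcal{O}_{\mathcal{X}}/\mathcal{I})$, a locally noetherian reduced scheme with the same underlying space. For an open $V\subset\mathcal{X}_{\mathrm{red}}$ put $A_V=\Gamma(V,\mathcal{O}_{\mathcal{X}})$. Assume that $\mathcal{X}$ is excellent, i.e. that $A_V$ is an excellent ring for every affine open subscheme $V$ of $\mathcal{X}_{\mathrm{red}}$. If $U$ is a (possibly infinite) disjoint union of affine open subschemes of $\mathcal{X}_{\mathrm{red}}$ with connected components $U_i$ ($i\in I$), each regarded as an open subset of $\mathcal{X}$, put $\widehat{X}_{/U}=\coprod_{i\in I}\operatorname{Spec}A_{U_i}$. Let $U$ and $U'$ be two such disjoint unions and let $f\colon U'\to U$ be a morphism over $\mathcal{X}_{\mathrm{red}}$. For each component $U'_j$ of $U'$ there is a unique component $U_{i}$ of $U$ with $f(U'_j)\subset U_{i}$; then $U'_j\subset U_i$ as open subsets of $\mathcal{X}$, and the restriction maps $A_{U_{i}}\to A_{U'_j}$ induce a morphism of schemes $\widehat{X}_{/U'}\to\widehat{X}_{/U}$.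 Then $\widehat{X}_{/U'}\to\widehat{X}_{/U}$ is regular, i.e. it is flat and for every $y\in\widehat{X}_{/U}$ the fibre over $y$ is geometrically regular over the residue field $\kappa(y)$: its base change to any finite extension of $\kappa(y)$ is a regular (locally noetherian) scheme. -/

import Mathlib

open CategoryTheory CategoryTheory.Limits TopologicalSpace Opposite AlgebraicGeometry

open scoped TensorProduct

universe u

noncomputable section

/-! ### Excellent rings -/

/-- An `A`-algebra `B` is regular if `B` is flat over `A` and every fibre `κ(p) ⊗[A] B` is
geometrically regular over `κ(p)`, that is, it stays a (noetherian) regular ring after every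
finite extension `K` of `κ(p)`. -/
def IsRegularAlgebra (A B : Type u) [CommRing A] [CommRing B] [Algebra A B] : Prop :=
  Module.Flat A B ∧
    ∀ (p : Ideal A) [p.IsPrime] (K : Type u) [Field K] [Algebra p.ResidueField K]
      [FiniteDimensional p.ResidueField K],
      IsRegularRing (K ⊗[p.ResidueField] p.Fiber B)

/-- A noetherian ring is a G-ring if all its formal fibres are geometrically regular: for each
prime `p` the completion homomorphism of the local ring `A_p` is regular. -/
def IsGRing (A : Type u) [CommRing A] : Prop :=
  ∀ (p : Ideal A) [p.IsPrime],
    IsRegularAlgebra (Localization.AtPrime p)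
      (AdicCompletion (IsLocalRing.maximalIdeal (Localization.AtPrime p))
        (Localization.AtPrime p))

/-- A noetherian ring is J-2 if the regular locus of every algebra of finite type is open. -/
def IsJTwo (A : Type u) [CommRing A] : Prop :=
  ∀ (B : Type u) [CommRing B] [Algebra A B], Algebra.FiniteType A B →
    IsOpen {p : PrimeSpectrum B | IsRegularLocalRing (Localization.AtPrime p.asIdeal)}

/-- A noetherian ring is catenary if any two saturated chains of primes with the same ends have
the same length. (Chains between two given primes are automatically of bounded length.) -/
def IsCatenaryRing (B : Type u) [CommRing B] : Prop :=
  ∀ l l' : RelSeries {(p, q) : PrimeSpectrum B × PrimeSpectrum B | p ⋖ q},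
    l.head = l'.head → l.last = l'.last → l.length = l'.length

/-- A noetherian ring is universally catenary if every algebra of finite type is catenary. -/
def IsUniversallyCatenary (A : Type u) [CommRing A] : Prop :=
  ∀ (B : Type u) [CommRing B] [Algebra A B], Algebra.FiniteType A B → IsCatenaryRing B

/-- Excellent rings: noetherian, universally catenary, G-ring and J-2. -/
structure IsExcellentRing (A : Type u) [CommRing A] : Prop where
  isNoetherianRing : IsNoetherianRing A
  isUniversallyCatenary : IsUniversallyCatenary A
  isGRing : IsGRing A
  isJTwo : IsJTwo A

/-! ### Regular morphisms of schemes -/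

/-- A scheme is regular if it is locally noetherian and all its local rings are regular. -/
def IsRegularScheme (X : Scheme.{u}) : Prop :=
  IsLocallyNoetherian X ∧ ∀ x : X, IsRegularLocalRing (X.presheaf.stalk x)

/-- A morphism of schemes is regular if it is flat and each fibre `X_y` is geometrically regular:
`X_y ×_{κ(y)} Spec K` is regular for every finite extension `K` of `κ(y)`. -/
def IsRegularMorphism {X Y : Scheme.{u}} (f : X ⟶ Y) : Prop :=
  Flat f ∧
    ∀ (y : Y) (K : Type u) [Field K] [Algebra (Y.residueField y) K]
      [FiniteDimensional (Y.residueField y) K],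
      IsRegularScheme (pullback (f.fiberToSpecResidueField y)
        (Spec.map (CommRingCat.ofHom (algebraMap (Y.residueField y) K))))

/-! ### Formal spectra and locally noetherian formal schemes

A locally noetherian formal scheme is treated as a locally ringed space that is locally a formal
spectrum. The topology on the sections carries no extra information: on each formal affine piece it
is the adic topology of the ideal of those sections that vanish at every point. -/

/-- The inductive system `Spec (A/I) ⟶ Spec (A/I²) ⟶ Spec (A/I³) ⟶ ⋯`. -/
def infinitesimalNeighborhoods (A : Type u) [CommRing A] (I : Ideal A) :
    ℕ ⥤ LocallyRingedSpace.{u} :=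
  Functor.ofSequence
    (X := fun n => (Spec (CommRingCat.of (A ⧸ I ^ (n + 1)))).toLocallyRingedSpace)
    (fun n => (Spec.map (CommRingCat.ofHom
      (Ideal.Quotient.factor (Ideal.pow_le_pow_right (Nat.le_succ (n + 1)))))).toLRSHom)

/-- The formal spectrum of `A` with its `I`-adic topology, as a locally ringed space: the inductive
limit of the schemes `Spec (A/I^(n+1))`. Its space is `V(I)`, and its structure sheaf is the
projective limit of the structure sheaves of the `Spec (A/I^(n+1))`. -/
def formalSpectrum (A : Type u) [CommRing A] (I : Ideal A) : LocallyRingedSpace.{u} :=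
  colimit (infinitesimalNeighborhoods A I)

/-- A locally noetherian formal scheme: a locally ringed space such that each point has an open
neighbourhood isomorphic to the formal spectrum of a noetherian ring `A` that is separated and
complete for the adic topology of an ideal `I`. -/
def IsLocallyNoetherianFormalScheme (X : LocallyRingedSpace.{u}) : Prop :=
  ∀ x : X, ∃ V : Opens X, x ∈ V ∧ ∃ (A : Type u) (_ : CommRing A) (I : Ideal A),
    IsNoetherianRing A ∧ IsAdicComplete I A ∧
      Nonempty (X.restrict V.isOpenEmbedding ≅ formalSpectrum A I)

/-! ### The reduction

Let `J` be the ideal sheaf of those sections of `𝒪_X` that vanish at every point. In a locally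
noetherian formal scheme this is the largest ideal of definition (over an affine piece `Spf A` its
sections are the topologically nilpotent elements of `A`, i.e. the elements lying in each prime that
contains an ideal of definition). The quotient sheaf `𝒪_X / J` is the image of `𝒪_X` in the sheaf
of families of elements of the residue fields, and it is in this form that it is written here. -/

namespace AlgebraicGeometry.LocallyRingedSpace

variable (X : LocallyRingedSpace.{u})

/-- The families `(f_x)` of elements of the residue fields that are given by a section. -/
def valuesPrelocal : TopCat.PrelocalPredicate (X := X.toTopCat)
    (fun x => (X.residueField x : Type u)) where
  pred {V} f := ∃ s : X.presheaf.obj (op V), ∀ x : V, f x = (X.evaluation x).hom s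
  res := by
    rintro V W i f ⟨s, hs⟩
    refine ⟨(X.presheaf.map i.op).hom s, fun x => ?_⟩
    exact (hs (i x)).trans (congrArg (X.residue x.1).hom
      (TopCat.Presheaf.germ_res_apply X.presheaf i x.1 x.2 s).symm)

/-- The families of elements of the residue fields that are locally given by sections of `𝒪_X`;
they are the sections of `𝒪_X / J`. -/
def reductionSections (V : Opens X.toTopCat) :
    Subring (∀ x : V, (X.residueField x.1 : Type u)) where
  carrier := {f | X.valuesPrelocal.sheafify.pred f}
  add_mem' ha hb := X.valuesPrelocal.sheafify_inductionOn₂' X.valuesPrelocal X.valuesPrelocal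
    (fun a b => a + b) (by
      rintro V W a b ⟨s, hs⟩ ⟨t, ht⟩
      obtain ⟨s', hs'⟩ := X.valuesPrelocal.res (Opens.infLELeft V W) a ⟨s, hs⟩
      obtain ⟨t', ht'⟩ := X.valuesPrelocal.res (Opens.infLERight V W) b ⟨t, ht⟩
      exact ⟨s' + t', fun x => by
        rw [map_add, ← hs' x, ← ht' x]; rfl⟩) ha hb
  mul_mem' ha hb := X.valuesPrelocal.sheafify_inductionOn₂' X.valuesPrelocal X.valuesPrelocal
    (fun a b => a * b) (by
      rintro V W a b ⟨s, hs⟩ ⟨t, ht⟩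
      obtain ⟨s', hs'⟩ := X.valuesPrelocal.res (Opens.infLELeft V W) a ⟨s, hs⟩
      obtain ⟨t', ht'⟩ := X.valuesPrelocal.res (Opens.infLERight V W) b ⟨t, ht⟩
      exact ⟨s' * t', fun x => by
        rw [map_mul, ← hs' x, ← ht' x]; rfl⟩) ha hb
  neg_mem' ha := X.valuesPrelocal.sheafify_inductionOn' (fun a => -a) (by
      rintro V a ⟨s, hs⟩
      exact ⟨-s, fun x => by rw [map_neg, ← hs x]⟩) ha
  zero_mem' := TopCat.PrelocalPredicate.sheafifyOf ⟨0, fun x => by rw [map_zero]; rfl⟩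
  one_mem' := TopCat.PrelocalPredicate.sheafifyOf ⟨1, fun x => by rw [map_one]; rfl⟩

/-- The presheaf of rings `𝒪_X / J`. -/
def reductionPresheaf : TopCat.Presheaf CommRingCat.{u} X.toTopCat where
  obj V := CommRingCat.of (X.reductionSections V.unop)
  map i := CommRingCat.ofHom
    { toFun := fun f => ⟨fun x => f.1 (i.unop x), X.valuesPrelocal.sheafify.res i.unop f.1 f.2⟩
      map_one' := rfl
      map_mul' := fun _ _ => rfl
      map_zero' := rfl
      map_add' := fun _ _ => rfl }

theorem reductionPresheaf_isSheaf : X.reductionPresheaf.IsSheaf :=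
  (TopCat.Presheaf.isSheaf_iff_isSheaf_comp (forget CommRingCat) _).mpr
    (TopCat.Presheaf.isSheaf_of_iso
      (NatIso.ofComponents (fun _ => Iso.refl _) :
        TopCat.subpresheafToTypes X.valuesPrelocal.sheafify.toPrelocalPredicate ≅
          X.reductionPresheaf ⋙ forget CommRingCat)
      (TopCat.subpresheafToTypes.isSheaf X.valuesPrelocal.sheafify))

/-- The projection `𝒪_X ⟶ 𝒪_X / J`; it sends a section to the family of its values. -/
def toReduction : X.presheaf ⟶ X.reductionPresheaf where
  app V := CommRingCat.ofHom
    { toFun := fun s => ⟨fun x => (X.evaluation x).hom s,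
        TopCat.PrelocalPredicate.sheafifyOf (P := X.valuesPrelocal) ⟨s, fun _ => rfl⟩⟩
      map_one' := Subtype.ext (funext fun x => map_one _)
      map_mul' := fun s t => Subtype.ext (funext fun x => map_mul _ s t)
      map_zero' := Subtype.ext (funext fun x => map_zero _)
      map_add' := fun s t => Subtype.ext (funext fun x => map_add _ s t) }
  naturality V W i := by
    ext s
    refine Subtype.ext (funext fun x => ?_)
    exact congrArg (X.residue x.1).hom (TopCat.Presheaf.germ_res_apply X.presheaf i.unop x.1 x.2 s)

/-- The reduction `X_red = (X, 𝒪_X / J)`. For a locally noetherian formal scheme it is a locally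
noetherian reduced scheme with the same underlying space. -/
def reduction : LocallyRingedSpace.{u} where
  carrier := X.toTopCat
  presheaf := X.reductionPresheaf
  IsSheaf := X.reductionPresheaf_isSheaf
  isLocalRing x := by
    have hnt : Nontrivial (X.reductionPresheaf.stalk x) := by
      refine ⟨0, 1, fun h => ?_⟩
      have hx : x ∈ (⊤ : Opens X.toTopCat) := trivial
      rw [← map_zero (X.reductionPresheaf.germ ⊤ x hx).hom,
        ← map_one (X.reductionPresheaf.germ ⊤ x hx).hom] at h
      obtain ⟨W, hW, i, j, hij⟩ := TopCat.Presheaf.germ_eq _ x hx hx _ _ h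
      have := congrFun (congrArg Subtype.val hij) ⟨x, hW⟩
      exact zero_ne_one (α := X.residueField x) this
    have hloc : IsLocalRing ((TopCat.Presheaf.stalkFunctor CommRingCat x).obj X.presheaf) :=
      X.isLocalRing x
    refine IsLocalRing.of_surjective'
      ((TopCat.Presheaf.stalkFunctor CommRingCat x).map X.toReduction).hom fun t => ?_
    obtain ⟨V, hV, s, rfl⟩ := TopCat.Presheaf.exists_germ_eq _ t
    obtain ⟨W, hW, i, r, hr⟩ := s.2 ⟨x, hV⟩
    refine ⟨X.presheaf.germ W x hW r, ?_⟩
    refine (TopCat.Presheaf.stalkFunctor_map_germ_apply W x hW X.toReduction r).trans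
      (Eq.trans ?_ (TopCat.Presheaf.germ_res_apply X.reductionPresheaf i x hW s))
    exact congrArg (X.reductionPresheaf.germ W x hW).hom
      (Subtype.ext (funext fun y => (hr y).symm))

end AlgebraicGeometry.LocallyRingedSpace

/-! ### Affine opens of the reduction, excellent formal schemes, and the schemes `X̂_{/U}` -/

/-- The open subspace `V` of a locally ringed space is an affine scheme. -/
def IsAffineOpenSubspace (Y : LocallyRingedSpace.{u}) (V : Opens Y) : Prop :=
  ∃ R : CommRingCat.{u}, Nonempty (Y.restrict V.isOpenEmbedding ≅ (Spec R).toLocallyRingedSpace)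

/-- A formal scheme `𝒳` is excellent if the ring `A_U = Γ(U, 𝒪_𝒳)` is excellent for each affine open
subscheme `U` of `𝒳_red`. -/
def IsExcellentFormalScheme (X : LocallyRingedSpace.{u}) : Prop :=
  ∀ U : Opens X, IsAffineOpenSubspace X.reduction U → IsExcellentRing (X.presheaf.obj (op U))

/-- The scheme `U`, with its morphism `a : U ⟶ Y`, is a (possibly infinite) disjoint union of affine
open subschemes of `Y`. -/
def IsDisjointUnionOfAffineOpens {Y : LocallyRingedSpace.{u}} {U : Scheme.{u}}
    (a : U.toLocallyRingedSpace ⟶ Y) : Prop :=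
  ∃ (ι : Type u) (W : ι → U.Opens), (∀ i, IsAffineOpen (W i)) ∧
    Pairwise (fun i j => Disjoint (W i) (W j)) ∧ (⨆ i, W i) = ⊤ ∧
    ∀ i, LocallyRingedSpace.IsOpenImmersion ((W i).ι.toLRSHom ≫ a)

section Hat

variable {X : LocallyRingedSpace.{u}} {U U' : Scheme.{u}}

/-- The connected component `c` of `U`, regarded as an open subset of `𝒳` by means of
`a : U ⟶ 𝒳_red`. (If `U` is a disjoint union of affine open subschemes of `𝒳_red`, where `𝒳` is a
locally noetherian formal scheme, the image of `c` is already open.) -/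
def componentOpen (a : U.toLocallyRingedSpace ⟶ X.reduction) (c : _root_.ConnectedComponents U) :
    Opens X where
  carrier := interior (a.base '' {x : U | (x : _root_.ConnectedComponents U) = c})
  is_open' := isOpen_interior

/-- The scheme `X̂_{/U}`: the disjoint union of the schemes `Spec Γ(U_c, 𝒪_𝒳)` over the connected
components `U_c` of `U`. -/
def hatScheme (a : U.toLocallyRingedSpace ⟶ X.reduction) : Scheme.{u} :=
  ∐ fun c : _root_.ConnectedComponents U => Spec (X.presheaf.obj (op (componentOpen a c)))

/-- A morphism `f : U' ⟶ U` over `𝒳_red` maps the component `c'` of `U'` into the component `f(c')` of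
`U`, so that there is an inclusion of the corresponding open subsets of `𝒳`. -/
theorem componentOpen_le (a : U.toLocallyRingedSpace ⟶ X.reduction)
    (a' : U'.toLocallyRingedSpace ⟶ X.reduction) (f : U' ⟶ U) (hf : f.toLRSHom ≫ a = a')
    (c' : _root_.ConnectedComponents U') :
    componentOpen a' c' ≤ componentOpen a (f.continuous.connectedComponentsMap c') := by
  refine interior_mono ?_
  rintro _ ⟨x, rfl, rfl⟩
  exact ⟨f x, rfl, by rw [← hf]; rfl⟩

/-- The morphism `X̂_{/U'} ⟶ X̂_{/U}` induced by a morphism `f : U' ⟶ U` over `𝒳_red`: on the component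
`c'` it is given by the restriction map `Γ(U_{f(c')}, 𝒪_𝒳) ⟶ Γ(U'_{c'}, 𝒪_𝒳)`. -/
def hatMap (a : U.toLocallyRingedSpace ⟶ X.reduction)
    (a' : U'.toLocallyRingedSpace ⟶ X.reduction) (f : U' ⟶ U) (hf : f.toLRSHom ≫ a = a') :
    hatScheme a' ⟶ hatScheme a :=
  Sigma.desc fun c' =>
    Spec.map (X.presheaf.map (homOfLE (componentOpen_le a a' f hf c')).op) ≫
      Sigma.ι (fun c : _root_.ConnectedComponents U => Spec (X.presheaf.obj (op (componentOpen a c))))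
        (f.continuous.connectedComponentsMap c')

end Hat

end

/-! Both schemes are disjoint unions of spectra, and the components of `U` and `U'` are affine open
subschemes of the reduction. It therefore suffices that, for affine opens V' ⊆ V of the reduction,
the restriction A_V → A_V' is flat with geometrically regular fibres.

Let J be the ideal of sections vanishing at every point. It lies in the Jacobson radical of A_V',
and A_V'/J is the coordinate ring of V', so every maximal ideal of A_V' is the ideal of a point x.
The heart of the proof is that A_V and A_V' have the same completed local ring B at x
(`isAdicIso_localRingHom_res`). Write R → R' for the local homomorphism at x. Then R → B is regular
because A_V is a G-ring, and R' → B is faithfully flat because A_V' is noetherian. Flatness and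
regularity of the fibres descend from R → B to R → R' (`IsAdicIso.flat_and_isRegularLocalRing`).

For the comparison of completions, choose an open D around x inside V' that is principal in V, in V'
and in a formal chart. Modulo every power of J the maps A_V → A_D and A_V' → A_D are localizations
(`isAdicLocalization_of_isGood`), and localizations do not change the completed local ring at x
(`IsAdicLocalization.isAdicIso`). Inside a chart this is read off from the description of sections
as a limit of the rings (A/I^(n+1))_a. In general V lies in no single chart. It is then covered by
finitely many such D, and sections that agree modulo J^n are corrected one power of J at a time with
a partition of unity: an explicit form of the vanishing of H¹ on an affine scheme
(`Compat.exists_improvement`). That J^n may be tested on the cover is `filtration_eq`.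

Descent of regularity along flat local homomorphisms (`IsRegularLocalRing.of_flat`) is homological:
modules over a regular local ring have finite projective dimension, finiteness descends along
faithfully flat maps, and Serre's criterion recovers regularity from a finite resolution of the
residue field. -/

namespace AlgebraicGeometry

/-! ### Sections and points of colimits of locally ringed spaces -/

section ColimitSections

variable {J : Type} [SmallCategory J]

theorem presheafedSpace_colimit_section_ext (G : J ⥤ PresheafedSpace CommRingCat.{u})
    (U : Opens (colimit G).carrier) (s t : (colimit G).presheaf.obj (op U))
    (h : ∀ j, (colimit.ι G j).c.app (op U) s = (colimit.ι G j).c.app (op U) t) : s = t := by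
  let e := PresheafedSpace.colimitPresheafObjIsoComponentwiseLimit G U
  have he : Function.Injective e.hom := (ConcreteCategory.bijective_of_isIso e.hom).1
  apply he
  refine Concrete.limit_ext _ _ _ fun j => ?_
  have key (z) := ConcreteCategory.congr_hom
    (PresheafedSpace.colimitPresheafObjIsoComponentwiseLimit_hom_π G U j.unop) z
  exact (key s).trans ((h j.unop).trans (key t).symm)

/-- Sections of a colimit form a componentwise limit. The family consists of sections of the colimit
itself, compared after pullback to the same `G.obj j`, so no transition map between sections over
varying opens has to be named. -/
theorem presheafedSpace_colimit_exists_section (G : J ⥤ PresheafedSpace CommRingCat.{u})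
    (U : Opens (colimit G).carrier) (s : J → (colimit G).presheaf.obj (op U))
    (h : ∀ j k, (j ⟶ k) → (colimit.ι G j).c.app (op U) (s k) = (colimit.ι G j).c.app (op U) (s j)) :
    ∃ t : (colimit G).presheaf.obj (op U), ∀ j,
      (colimit.ι G j).c.app (op U) t = (colimit.ι G j).c.app (op U) (s j) := by
  let e := PresheafedSpace.colimitPresheafObjIsoComponentwiseLimit G U
  have key (j z) := ConcreteCategory.congr_hom
    (PresheafedSpace.colimitPresheafObjIsoComponentwiseLimit_hom_π G U j) z
  have hl := isLimitOfPreserves (forget CommRingCat)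
    (limit.isLimit (PresheafedSpace.componentwiseDiagram G U))
  let σ : (PresheafedSpace.componentwiseDiagram G U ⋙ forget CommRingCat).sections :=
    ⟨fun j => (colimit.ι G j.unop).c.app (op U) (s j.unop), by
      intro j k f
      have h1 := h _ _ f.unop
      refine Eq.trans ?_ h1
      have hw := ConcreteCategory.congr_hom
        (limit.w (PresheafedSpace.componentwiseDiagram G U) f) (e.hom (s j.unop))
      refine Eq.trans ?_ (hw.trans (key _ _))
      exact congrArg ((PresheafedSpace.componentwiseDiagram G U).map f) (key _ _).symm⟩
  let y := (Types.isLimitEquivSections hl).symm σ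
  refine ⟨e.inv y, fun j => ?_⟩
  have h3 := Types.isLimitEquivSections_symm_apply hl σ (op j)
  refine (key j _).symm.trans (Eq.trans ?_ h3)
  have h4 := ConcreteCategory.congr_hom e.inv_hom_id y
  exact congrArg (limit.π (PresheafedSpace.componentwiseDiagram G U) (op j)) h4

theorem presheafedSpace_iso_app_bijective {P Q : PresheafedSpace CommRingCat.{u}} (e : P ⟶ Q)
    [IsIso e] (U : Opens Q.carrier) : Function.Bijective (e.c.app (op U)) :=
  have := PresheafedSpace.c_isIso_of_iso e
  have : IsIso (e.c.app (op U)) := inferInstance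
  ConcreteCategory.bijective_of_isIso (e.c.app (op U))

/-- The forgetful functors preserve colimits; this carries the description of sections as a limit
over from presheafed spaces. -/
theorem colimit_iso_presheafedSpace (F : J ⥤ LocallyRingedSpace.{u}) [HasColimit F] :
    ∃ e : (colimit (F ⋙ LocallyRingedSpace.forgetToSheafedSpace ⋙
        SheafedSpace.forgetToPresheafedSpace)) ⟶ (colimit F).toPresheafedSpace,
      IsIso e ∧ ∀ j, colimit.ι (F ⋙ LocallyRingedSpace.forgetToSheafedSpace ⋙
        SheafedSpace.forgetToPresheafedSpace) j ≫ e = (colimit.ι F j).toHom := by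
  have h1 : PreservesColimitsOfSize.{0, 0} LocallyRingedSpace.forgetToSheafedSpace.{u} :=
    preservesColimitsOfSize_shrink.{0, u, 0, u} _
  have h2 : PreservesColimit F (LocallyRingedSpace.forgetToSheafedSpace.{u} ⋙
        SheafedSpace.forgetToPresheafedSpace) := inferInstance
  let e := preservesColimitIso (LocallyRingedSpace.forgetToSheafedSpace ⋙
        SheafedSpace.forgetToPresheafedSpace) F
  refine ⟨e.inv, e.isIso_inv, fun j => ?_⟩
  exact ι_preservesColimitIso_inv (LocallyRingedSpace.forgetToSheafedSpace ⋙
        SheafedSpace.forgetToPresheafedSpace) F j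

theorem LocallyRingedSpace.colimit_section_ext (F : J ⥤ LocallyRingedSpace.{u}) [HasColimit F]
    (U : Opens (colimit F).toTopCat) (s t : (colimit F).presheaf.obj (op U))
    (h : ∀ j, (colimit.ι F j).c.app (op U) s = (colimit.ι F j).c.app (op U) t) : s = t := by
  obtain ⟨e, he, hj⟩ := colimit_iso_presheafedSpace F
  apply (presheafedSpace_iso_app_bijective e U).1
  apply presheafedSpace_colimit_section_ext
  intro j
  have := h j
  rw [← hj j] at this
  exact this

theorem LocallyRingedSpace.colimit_exists_section (F : J ⥤ LocallyRingedSpace.{u}) [HasColimit F]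
    (U : Opens (colimit F).toTopCat) (s : J → (colimit F).presheaf.obj (op U))
    (h : ∀ j k, (j ⟶ k) → (colimit.ι F j).c.app (op U) (s k) = (colimit.ι F j).c.app (op U) (s j)) :
    ∃ t : (colimit F).presheaf.obj (op U), ∀ j,
      (colimit.ι F j).c.app (op U) t = (colimit.ι F j).c.app (op U) (s j) := by
  obtain ⟨e, he, hj⟩ := colimit_iso_presheafedSpace F
  obtain ⟨t', ht'⟩ := presheafedSpace_colimit_exists_section _ _ (fun j => e.c.app (op U) (s j))
    (by 
      intro j k f
      have := h j k f
      rw [← hj j] at this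
      exact this)
  obtain ⟨t, rfl⟩ := (presheafedSpace_iso_app_bijective e U).2 t'
  refine ⟨t, fun j => ?_⟩
  rw [← hj j]
  exact ht' j

theorem LocallyRingedSpace.colimit_exists_point (F : J ⥤ LocallyRingedSpace.{u}) [HasColimit F]
    (x : (colimit F).toTopCat) : ∃ j, ∃ y : (F.obj j).toTopCat, (colimit.ι F j).base y = x := by
  have h1 : PreservesColimitsOfSize.{0, 0} LocallyRingedSpace.forgetToSheafedSpace.{u} :=
    preservesColimitsOfSize_shrink.{0, u, 0, u} _
  have := Concrete.isColimit_exists_rep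
    (F ⋙ LocallyRingedSpace.forgetToSheafedSpace ⋙ SheafedSpace.forget CommRingCat)
    (isColimitOfPreserves (LocallyRingedSpace.forgetToSheafedSpace ⋙ SheafedSpace.forget CommRingCat)
      (colimit.isColimit F)) x
  exact this

end ColimitSections

theorem LocallyRingedSpace.IsOpenImmersion.app_bijective {Z Y : LocallyRingedSpace.{u}} (f : Z ⟶ Y)
    [H : LocallyRingedSpace.IsOpenImmersion f] (U : Opens Y.toTopCat)
    (hU : ∀ x ∈ U, ∃ z, f.base z = x) : Function.Bijective (f.c.app (op U)) := by
  have hc := H.c_iso ((Opens.map f.base).obj U)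
  have : H.base_open.functor.obj ((Opens.map f.base).obj U) = U := by
    ext x
    constructor
    · rintro ⟨z, hz, rfl⟩
      exact hz
    · intro hx
      obtain ⟨z, rfl⟩ := hU x hx
      exact ⟨z, hx, rfl⟩
  rw [this] at hc
  have : IsIso (f.c.app (op U)) := hc
  exact ConcreteCategory.bijective_of_isIso (f.c.app (op U))

/-- A local homomorphism induces an injection of residue fields. This lets the vanishing of a
section be tested on the schemes that map to the formal scheme. -/
theorem LocallyRingedSpace.evaluation_eq_zero_iff_of_hom {Z Y : LocallyRingedSpace.{u}} (f : Z ⟶ Y)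
    (U : Opens Y.toTopCat) (s : Y.presheaf.obj (op U)) (z : Z) (hz : f.base z ∈ U) :
    Z.evaluation (U := (Opens.map f.base).obj U) ⟨z, hz⟩ (f.c.app (op U) s) = 0 ↔
      Y.evaluation ⟨f.base z, hz⟩ s = 0 := by
  have h := LocallyRingedSpace.evaluation_naturality_apply f
    (⟨z, hz⟩ : (Opens.map f.base).obj U) s
  rw [← h]
  exact map_eq_zero (LocallyRingedSpace.residueFieldMap f z).hom

end AlgebraicGeometry

/-! ### Calculus of sections, values and vanishing ideals -/

noncomputable section

namespace AlgebraicGeometry.LocallyRingedSpace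

variable (X : LocallyRingedSpace.{u}) {Y Z : LocallyRingedSpace.{u}}

/-- The ring of sections of `X` over `D`. -/
abbrev Sec (D : Opens X.toTopCat) : Type u := X.presheaf.obj (op D)

/-- Restriction of sections. -/
def res {D D' : Opens X.toTopCat} (h : D' ≤ D) : X.Sec D →+* X.Sec D' :=
  (X.presheaf.map (homOfLE h).op).hom

/-- The value of a section at a point. -/
def ev {D : Opens X.toTopCat} (x : X) (hx : x ∈ D) : X.Sec D →+* X.residueField x :=
  (X.evaluation ⟨x, hx⟩).hom

/-- Pullback of sections along a morphism. -/
def pull (f : Y ⟶ Z) (D : Opens Z.toTopCat) : Z.Sec D →+* Y.Sec ((Opens.map f.base).obj D) :=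
  (f.c.app (op D)).hom

@[simp]
theorem res_res {D D' D'' : Opens X.toTopCat} (h : D' ≤ D) (h' : D'' ≤ D') (s : X.Sec D) :
    X.res h' (X.res h s) = X.res (h'.trans h) s := by
  have := X.presheaf.map_comp (homOfLE h).op (homOfLE h').op
  exact (ConcreteCategory.congr_hom this s).symm

@[simp]
theorem res_self {D : Opens X.toTopCat} (h : D ≤ D) (s : X.Sec D) : X.res h s = s :=
  ConcreteCategory.congr_hom (X.presheaf.map_id (op D)) s

@[simp]
theorem ev_res {D D' : Opens X.toTopCat} (h : D' ≤ D) (s : X.Sec D) (x : X) (hx : x ∈ D') :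
    X.ev x hx (X.res h s) = X.ev x (h hx) s :=
  congrArg (X.residue x).hom (TopCat.Presheaf.germ_res_apply X.presheaf (homOfLE h) x hx s)

theorem pull_res (f : Y ⟶ Z) {D D' : Opens Z.toTopCat} (h : D' ≤ D) (s : Z.Sec D) :
    pull f D' (Z.res h s) = Y.res (fun _ hx => h hx) (pull f D s) :=
  ConcreteCategory.congr_hom (f.c.naturality (homOfLE h).op) s

theorem pull_comp {W : LocallyRingedSpace.{u}} (f : Y ⟶ Z) (g : Z ⟶ W) (D : Opens W.toTopCat)
    (s : W.Sec D) : pull (f ≫ g) D s = pull f _ (pull g D s) := rfl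

theorem ev_pull_eq_zero_iff (f : Y ⟶ Z) {D : Opens Z.toTopCat} (s : Z.Sec D) (y : Y)
    (hy : f.base y ∈ D) :
    Y.ev (D := (Opens.map f.base).obj D) y hy (pull f D s) = 0 ↔ Z.ev (f.base y) hy s = 0 :=
  evaluation_eq_zero_iff_of_hom f D s y hy

theorem ev_ne_zero_iff_isUnit_germ {D : Opens X.toTopCat} (s : X.Sec D) (x : X) (hx : x ∈ D) :
    X.ev x hx s ≠ 0 ↔ IsUnit (X.presheaf.germ D x hx s) :=
  (X.evaluation_ne_zero_iff_mem_basicOpen ⟨x, hx⟩ s).trans (X.toRingedSpace.mem_basicOpen s x hx)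

theorem isUnit_of_forall_ev_ne_zero {D : Opens X.toTopCat} (s : X.Sec D)
    (h : ∀ x (hx : x ∈ D), X.ev x hx s ≠ 0) : IsUnit s := by
  refine X.toRingedSpace.isUnit_of_isUnit_germ D s fun x hx => ?_
  exact (X.ev_ne_zero_iff_isUnit_germ s x hx).1 (h x hx)

/-- The open set where a section does not vanish. -/
def nonvanishing {D : Opens X.toTopCat} (s : X.Sec D) : Opens X.toTopCat :=
  X.toRingedSpace.basicOpen s

theorem mem_nonvanishing {D : Opens X.toTopCat} (s : X.Sec D) (x : X) :
    x ∈ X.nonvanishing s ↔ ∃ hx : x ∈ D, X.ev x hx s ≠ 0 := by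
  constructor
  · intro h
    have hx : x ∈ D := X.toRingedSpace.basicOpen_le s h
    exact ⟨hx, (X.evaluation_ne_zero_iff_mem_basicOpen ⟨x, hx⟩ s).2 h⟩
  · rintro ⟨hx, h⟩
    exact (X.evaluation_ne_zero_iff_mem_basicOpen ⟨x, hx⟩ s).1 h

theorem nonvanishing_le {D : Opens X.toTopCat} (s : X.Sec D) : X.nonvanishing s ≤ D :=
  X.toRingedSpace.basicOpen_le s

theorem sec_ext {ι : Type u} {V : Opens X.toTopCat} (D : ι → Opens X.toTopCat) (hD : ∀ i, D i ≤ V)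
    (hV : ∀ x ∈ V, ∃ i, x ∈ D i) (s t : X.Sec V)
    (h : ∀ i, X.res (hD i) s = X.res (hD i) t) : s = t :=
  X.𝒪.eq_of_locally_eq' D V (fun i => homOfLE (hD i)) (fun x hx => by
    obtain ⟨i, hi⟩ := hV x hx
    exact Opens.mem_iSup.2 ⟨i, hi⟩) s t h

theorem exists_glue {ι : Type u} {V : Opens X.toTopCat} (D : ι → Opens X.toTopCat)
    (hD : ∀ i, D i ≤ V) (hV : ∀ x ∈ V, ∃ i, x ∈ D i) (s : ∀ i, X.Sec (D i))
    (h : ∀ i j, X.res (inf_le_left : D i ⊓ D j ≤ D i) (s i) =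
      X.res (inf_le_right : D i ⊓ D j ≤ D j) (s j)) :
    ∃ t : X.Sec V, ∀ i, X.res (hD i) t = s i := by
  obtain ⟨t, ht, -⟩ := X.𝒪.existsUnique_gluing' D V (fun i => homOfLE (hD i)) (fun x hx => by
    obtain ⟨i, hi⟩ := hV x hx
    exact Opens.mem_iSup.2 ⟨i, hi⟩) s (fun i j => h i j)
  exact ⟨t, ht⟩

/-- The ideal of the sections that vanish at every point. -/
def vanishing (D : Opens X.toTopCat) : Ideal (X.Sec D) where
  carrier := {s | ∀ x (hx : x ∈ D), X.ev x hx s = 0}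
  add_mem' ha hb x hx := by rw [map_add, ha x hx, hb x hx, add_zero]
  zero_mem' x hx := map_zero _
  smul_mem' c s hs x hx := by rw [smul_eq_mul, map_mul, hs x hx, mul_zero]

theorem res_mem_vanishing {D D' : Opens X.toTopCat} (h : D' ≤ D) {s : X.Sec D}
    (hs : s ∈ X.vanishing D) : X.res h s ∈ X.vanishing D' := fun x hx => by
  rw [ev_res]; exact hs x (h hx)

theorem vanishing_le_map_res {D D' : Opens X.toTopCat} (h : D' ≤ D) (n : ℕ) {s : X.Sec D}
    (hs : s ∈ X.vanishing D ^ n) : X.res h s ∈ X.vanishing D' ^ n := by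
  have h1 : (X.vanishing D).map (X.res h) ≤ X.vanishing D' :=
    Ideal.map_le_iff_le_comap.2 fun s hs => X.res_mem_vanishing h hs
  have h2 := Ideal.mem_map_of_mem (X.res h) hs
  rw [Ideal.map_pow] at h2
  exact Ideal.pow_right_mono h1 n h2

/-- For s in the ideal, 1 + sy has the value 1 everywhere, and a section without zeros is a unit. -/
theorem vanishing_le_jacobson (D : Opens X.toTopCat) :
    X.vanishing D ≤ Ideal.jacobson ⊥ := by
  intro s hs
  rw [Ideal.mem_jacobson_bot]
  intro y
  apply X.isUnit_of_forall_ev_ne_zero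
  intro x hx
  rw [map_add, map_mul, hs x hx, zero_mul, zero_add, map_one]
  exact one_ne_zero

end AlgebraicGeometry.LocallyRingedSpace

end

/-! ### Sections over open subsets of an affine scheme -/

noncomputable section

namespace AlgebraicGeometry.LocallyRingedSpace

/-- `Spec R` as a locally ringed space. -/
abbrev spec (R : Type u) [CommRing R] : LocallyRingedSpace.{u} :=
  (Spec (CommRingCat.of R)).toLocallyRingedSpace

/-- The section of the structure sheaf of `Spec R` given by an element of `R`. -/
def specSec (R : Type u) [CommRing R] (U : Opens (spec R).toTopCat) : R →+* (spec R).Sec U :=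
  ((spec R).res (le_top : U ≤ ⊤)).comp (Scheme.ΓSpecIso (CommRingCat.of R)).inv.hom

variable (R : Type u) [CommRing R]

theorem res_specSec {U U' : Opens (spec R).toTopCat} (h : U' ≤ U) (a : R) :
    (spec R).res h (specSec R U a) = specSec R U' a :=
  (spec R).res_res _ _ _

theorem ev_specSec_eq_zero_iff {U : Opens (spec R).toTopCat} (y : PrimeSpectrum R) (hy : y ∈ U)
    (a : R) : (spec R).ev (D := U) y hy (specSec R U a) = 0 ↔ a ∈ y.asIdeal := by
  have h : (spec R).ev (D := U) y hy (specSec R U a) =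
      (spec R).ev (D := ⊤) y trivial ((Scheme.ΓSpecIso (CommRingCat.of R)).inv a) :=
    (spec R).ev_res _ _ _ _
  rw [h]
  have h2 := basicOpen_eq_of_affine (R := CommRingCat.of R) a
  have h3 := (spec R).evaluation_eq_zero_iff_notMem_basicOpen (U := ⊤) ⟨y, trivial⟩
    ((Scheme.ΓSpecIso (CommRingCat.of R)).inv a)
  refine h3.trans ?_
  change y ∉ (Spec (CommRingCat.of R)).basicOpen _ ↔ _
  rw [h2]
  change ¬ (a ∉ y.asIdeal) ↔ _
  exact not_not

theorem pull_specSec {S : Type u} [CommRing S] (φ : R →+* S) (f : spec S ⟶ spec R)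
    (hf : f = (Spec.map (CommRingCat.ofHom φ)).toLRSHom) (U : Opens (spec R).toTopCat) (a : R) :
    pull f U (specSec R U a) = specSec S _ (φ a) := by
  subst hf
  have h1 := pull_res (Spec.map (CommRingCat.ofHom φ)).toLRSHom (le_top : U ≤ ⊤)
    ((Scheme.ΓSpecIso (CommRingCat.of R)).inv a)
  refine h1.trans ?_
  have h2 := ConcreteCategory.congr_hom (Scheme.ΓSpecIso_inv_naturality (CommRingCat.ofHom φ)) a
  exact congrArg ((spec S).res _) h2.symm

/-- Sections over the basic open of a are the localization R_a. The open is described by its points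
because it will occur as the preimage of an open of the formal scheme. -/
theorem specSec_surj {U : Opens (spec R).toTopCat} (a : R)
    (hU : ∀ y : PrimeSpectrum R, y ∈ U ↔ a ∉ y.asIdeal) (z : (spec R).Sec U) :
    ∃ (e : ℕ) (c : R), specSec R U a ^ e * z = specSec R U c := by
  obtain rfl : U = (Spec (CommRingCat.of R)).basicOpen
      ((Scheme.ΓSpecIso (CommRingCat.of R)).inv a) := by
    rw [basicOpen_eq_of_affine (R := CommRingCat.of R) a]
    ext y; exact hU y
  have := (isAffineOpen_top (Spec (CommRingCat.of R))).isLocalization_basicOpen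
    ((Scheme.ΓSpecIso (CommRingCat.of R)).inv a)
  obtain ⟨e, c, h⟩ := IsLocalization.Away.surj ((Scheme.ΓSpecIso (CommRingCat.of R)).inv a) z
  refine ⟨e, (Scheme.ΓSpecIso (CommRingCat.of R)).hom c, ?_⟩
  rw [mul_comm]
  refine h.trans ?_
  have h2 := ConcreteCategory.congr_hom (Scheme.ΓSpecIso (CommRingCat.of R)).hom_inv_id c
  exact congrArg ((spec R).res _) h2.symm

theorem specSec_inj {U : Opens (spec R).toTopCat} (a : R)
    (hU : ∀ y : PrimeSpectrum R, y ∈ U ↔ a ∉ y.asIdeal) (c : R) (hc : specSec R U c = 0) :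
    ∃ (e : ℕ), a ^ e * c = 0 := by
  obtain rfl : U = (Spec (CommRingCat.of R)).basicOpen
      ((Scheme.ΓSpecIso (CommRingCat.of R)).inv a) := by
    rw [basicOpen_eq_of_affine (R := CommRingCat.of R) a]
    ext y; exact hU y
  have := (isAffineOpen_top (Spec (CommRingCat.of R))).isLocalization_basicOpen
    ((Scheme.ΓSpecIso (CommRingCat.of R)).inv a)
  obtain ⟨e, h⟩ := IsLocalization.Away.exists_of_eq ((Scheme.ΓSpecIso (CommRingCat.of R)).inv a)
    (S := Γ(Spec (CommRingCat.of R), (Spec (CommRingCat.of R)).basicOpen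
      ((Scheme.ΓSpecIso (CommRingCat.of R)).inv a)))
    (a := (Scheme.ΓSpecIso (CommRingCat.of R)).inv c) (b := 0) (hc.trans (map_zero _).symm)
  refine ⟨e, ?_⟩
  apply (ConcreteCategory.bijective_of_isIso (Scheme.ΓSpecIso (CommRingCat.of R)).inv).1
  rw [map_mul, map_pow, h, mul_zero, map_zero]

theorem isUnit_specSec {U : Opens (spec R).toTopCat} (a : R)
    (hU : ∀ y : PrimeSpectrum R, y ∈ U → a ∉ y.asIdeal) : IsUnit (specSec R U a) := by
  apply isUnit_of_forall_ev_ne_zero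
  intro y hy h
  exact hU y hy ((ev_specSec_eq_zero_iff R y hy a).1 h)

/-- Write z = c/a^e. Then ac lies in every prime: those containing a trivially, the others because c
vanishes there. So ac is nilpotent, and a is invertible on U. -/
theorem isNilpotent_of_mem_vanishing {U : Opens (spec R).toTopCat} (a : R)
    (hU : ∀ y : PrimeSpectrum R, y ∈ U ↔ a ∉ y.asIdeal) (z : (spec R).Sec U)
    (hz : z ∈ (spec R).vanishing U) : IsNilpotent z := by
  obtain ⟨e, c, hc⟩ := specSec_surj R a hU z
  have h1 : IsNilpotent (a * c) := by
    rw [nilpotent_iff_mem_prime]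
    intro p hp
    by_cases ha : a ∈ p
    · exact p.mul_mem_right _ ha
    · apply p.mul_mem_left
      refine (ev_specSec_eq_zero_iff R ⟨p, hp⟩ ((hU ⟨p, hp⟩).2 ha) c).1 ?_
      rw [← hc, map_mul]
      exact mul_eq_zero_of_right _ (hz _ _)
  have hu := isUnit_specSec R a (U := U) fun y hy => (hU y).1 hy
  have h2 := h1.map (specSec R U)
  rw [map_mul, ← hc, ← mul_assoc, ← pow_succ'] at h2
  obtain ⟨n, hn⟩ := h2
  rw [mul_pow] at hn
  refine ⟨n, ?_⟩
  exact ((hu.pow (e + 1)).pow n).mul_right_eq_zero.1 hn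

theorem eq_zero_of_mem_vanishing [_root_.IsReduced R] {U : Opens (spec R).toTopCat} (z : (spec R).Sec U)
    (hz : z ∈ (spec R).vanishing U) : z = 0 := by
  have hr : AlgebraicGeometry.IsReduced (Spec (CommRingCat.of R)) := by
    have : _root_.IsReduced (CommRingCat.of R) := ‹_root_.IsReduced R›
    infer_instance
  have hb : (spec R).toRingedSpace.basicOpen z = ⊥ :=
    ((spec R).basicOpen_eq_bot_iff_forall_evaluation_eq_zero z).2 fun x => hz x.1 x.2
  exact (AlgebraicGeometry.basicOpen_eq_bot_iff (X := Spec (CommRingCat.of R)) z).1 hb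

end AlgebraicGeometry.LocallyRingedSpace

end

/-! ### Formal spectra and formal charts -/

noncomputable section

namespace AlgebraicGeometry.LocallyRingedSpace

/-- An open subset `W` of `X` that is identified with the formal spectrum of `A` for the `I`-adic
topology, in terms of the morphisms `Spec (A/I^(n+1)) ⟶ X`. -/
structure FormalChart (X : LocallyRingedSpace.{u}) (W : Opens X.toTopCat) (A : Type u) [CommRing A]
    (I : Ideal A) where
  r : ∀ n : ℕ, spec (A ⧸ I ^ (n + 1)) ⟶ X
  r_mem : ∀ n y, (r n).base y ∈ W
  exists_r : ∀ x ∈ W, ∃ y, (r 0).base y = x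
  β : A →+* X.Sec W
  pull_β : ∀ n a, pull (r n) W (β a) = specSec _ _ (Ideal.Quotient.mk _ a)
  pull_eq_zero_of_le : ∀ {m n : ℕ}, m ≤ n → ∀ (D : Opens X.toTopCat) (s : X.Sec D),
    pull (r n) D s = 0 → pull (r m) D s = 0
  sep : ∀ D : Opens X.toTopCat, D ≤ W → ∀ s : X.Sec D, (∀ n, pull (r n) D s = 0) → s = 0
  complete : ∀ D : Opens X.toTopCat, D ≤ W → ∀ s : ℕ → X.Sec D,
    (∀ m n, m ≤ n → pull (r m) D (s n) = pull (r m) D (s m)) →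
      ∃ t : X.Sec D, ∀ n, pull (r n) D t = pull (r n) D (s n)

section FormalSpectrum

variable (A : Type u) [CommRing A] (I : Ideal A)

/-- The morphisms `Spec (A/I^(n+1)) ⟶ Spf A`. -/
def formalSpectrumι (n : ℕ) : spec (A ⧸ I ^ (n + 1)) ⟶ formalSpectrum A I :=
  colimit.ι (infinitesimalNeighborhoods A I) n

/-- The transition morphism. -/
def thickening (n : ℕ) : spec (A ⧸ I ^ (n + 1)) ⟶ spec (A ⧸ I ^ (n + 1 + 1)) :=
  (Spec.map (CommRingCat.ofHom
      (Ideal.Quotient.factor (Ideal.pow_le_pow_right (Nat.le_succ (n + 1)))))).toLRSHom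

theorem thickening_formalSpectrumι (n : ℕ) :
    thickening A I n ≫ formalSpectrumι A I (n + 1) = formalSpectrumι A I n := by
  have h := colimit.w (infinitesimalNeighborhoods A I) (homOfLE (Nat.le_succ n))
  have h2 : (infinitesimalNeighborhoods A I).map (homOfLE (Nat.le_succ n)) = thickening A I n :=
    Functor.ofSequence_map_homOfLE_succ _ n
  rw [h2] at h
  exact h

theorem thickening_toSpec (n : ℕ) : thickening A I n ≫
    (Spec.map (CommRingCat.ofHom (Ideal.Quotient.mk (I ^ (n + 1 + 1))))).toLRSHom =
      (Spec.map (CommRingCat.ofHom (Ideal.Quotient.mk (I ^ (n + 1))))).toLRSHom := by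
  have h := Spec.map_comp (CommRingCat.ofHom (Ideal.Quotient.mk (I ^ (n + 1 + 1))))
    (CommRingCat.ofHom (Ideal.Quotient.factor
      (Ideal.pow_le_pow_right (I := I) (Nat.le_succ (n + 1)))))
  exact (congrArg Scheme.Hom.toLRSHom h).symm

/-- The morphism `Spf A ⟶ Spec A`. -/
def formalSpectrumToSpec : formalSpectrum A I ⟶ spec A :=
  colimit.desc (infinitesimalNeighborhoods A I)
    { pt := spec A
      ι := NatTrans.ofSequence
        (fun n => (Spec.map (CommRingCat.ofHom (Ideal.Quotient.mk (I ^ (n + 1))))).toLRSHom)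
        (fun n => by
          refine (congrArg (· ≫ _) (Functor.ofSequence_map_homOfLE_succ _ n)).trans ?_
          refine Eq.trans ?_ (Category.comp_id _).symm
          exact thickening_toSpec A I n) }

theorem formalSpectrumι_toSpec (n : ℕ) : formalSpectrumι A I n ≫ formalSpectrumToSpec A I =
    (Spec.map (CommRingCat.ofHom (Ideal.Quotient.mk (I ^ (n + 1))))).toLRSHom :=
  colimit.ι_desc _ _

theorem thickening_base_surjective (n : ℕ) : Function.Surjective (thickening A I n).base := by
  intro (p : PrimeSpectrum (A ⧸ I ^ (n + 1 + 1)))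
  have hs : Function.Surjective
      (Ideal.Quotient.factor (Ideal.pow_le_pow_right (I := I) (Nat.le_succ (n + 1)))) :=
    Ideal.Quotient.factor_surjective _
  have hp : p ∈ Set.range (PrimeSpectrum.comap
      (Ideal.Quotient.factor (Ideal.pow_le_pow_right (I := I) (Nat.le_succ (n + 1))))) := by
    rw [range_comap_of_surjective _ _ hs]
    intro z hz
    obtain ⟨a, rfl⟩ := Ideal.Quotient.mk_surjective z
    rw [SetLike.mem_coe, RingHom.mem_ker, Ideal.Quotient.factor_mk, Ideal.Quotient.eq_zero_iff_mem] at hz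
    -- The kernel I^(n+1)/I^(n+2) has square zero, since 2(n+1) ≥ n+2.
    apply p.isPrime.mem_of_pow_mem 2
    have : Ideal.Quotient.mk (I ^ (n + 1 + 1)) a ^ 2 = 0 := by
      rw [← map_pow, Ideal.Quotient.eq_zero_iff_mem]
      have := Ideal.pow_mem_pow hz 2
      rw [← pow_mul] at this
      exact Ideal.pow_le_pow_right (by lia) this
    rw [this]
    exact p.asIdeal.zero_mem
  exact hp

/-- Each point comes from some stage of the colimit, and nilpotent thickenings are bijective on
points, so stage 0 is enough. -/
theorem exists_formalSpectrumι (x : (formalSpectrum A I).toTopCat) :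
    ∃ y, (formalSpectrumι A I 0).base y = x := by
  have h : ∃ n y, (formalSpectrumι A I n).base y = x :=
    colimit_exists_point (infinitesimalNeighborhoods A I) x
  obtain ⟨n, y, hy⟩ := h
  induction n with
  | zero => exact ⟨y, hy⟩
  | succ n ih =>
    obtain ⟨y', rfl⟩ := thickening_base_surjective A I n y
    apply ih y'
    rw [← hy, ← thickening_formalSpectrumι]
    rfl

variable {A I} {X : LocallyRingedSpace.{u}} {W : Opens X.toTopCat}

theorem pull_formalSpectrumι_eq_zero {m n : ℕ} (h : m ≤ n) (D : Opens (formalSpectrum A I).toTopCat)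
    (s : (formalSpectrum A I).Sec D) (hs : pull (formalSpectrumι A I n) D s = 0) :
    pull (formalSpectrumι A I m) D s = 0 := by
  induction n, h using Nat.le_induction with
  | base => exact hs
  | succ n h ih =>
    apply ih
    rw [← thickening_formalSpectrumι, pull_comp, hs]
    exact map_zero _

/-- The chart given by an isomorphism with a formal spectrum. -/
def FormalChart.ofIso (e : X.restrict W.isOpenEmbedding ≅ formalSpectrum A I) :
    FormalChart X W A I :=
  let j : formalSpectrum A I ⟶ X := e.inv ≫ X.ofRestrict W.isOpenEmbedding
  have hj : ∀ x, j.base x ∈ W := fun x => (e.inv.base x).2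
  have hj' : ∀ x ∈ W, ∃ z, j.base z = x := fun x hx =>
    ⟨e.hom.base ⟨x, hx⟩, congrArg Subtype.val (iso_hom_base_inv_base_apply e ⟨x, hx⟩)⟩
  have hb : ∀ D ≤ W, Function.Bijective (pull j D) := fun D hD =>
    IsOpenImmersion.app_bijective j D fun x hx => hj' x (hD hx)
  { r := fun n => formalSpectrumι A I n ≫ j
    r_mem := fun n y => hj _
    exists_r := fun x hx => by
      obtain ⟨z, rfl⟩ := hj' x hx
      obtain ⟨y, rfl⟩ := exists_formalSpectrumι A I z
      exact ⟨y, rfl⟩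
    -- Elements of A become functions on Spf A by pullback along Spf A ⟶ Spec A, and then sections
    -- over W by inverting the pullback along j.
    β := ((RingEquiv.ofBijective _ (hb W le_rfl)).symm.toRingHom.comp
      ((formalSpectrum A I).res (D := ⊤) le_top)).comp
        ((pull (formalSpectrumToSpec A I) ⊤).comp (specSec A ⊤))
    pull_β := fun n a => by
      rw [pull_comp]
      have h1 : ∀ s, pull j W ((RingEquiv.ofBijective _ (hb W le_rfl)).symm s) = s := fun s =>
        (RingEquiv.ofBijective _ (hb W le_rfl)).apply_symm_apply s
      refine (congrArg _ (h1 _)).trans ?_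
      refine (pull_res _ _ _).trans ?_
      have h2 := pull_specSec A (Ideal.Quotient.mk (I ^ (n + 1))) _ (formalSpectrumι_toSpec A I n) ⊤ a
      refine (congrArg _ h2).trans ?_
      exact res_specSec _ _ _
    pull_eq_zero_of_le := fun h D s hs => pull_formalSpectrumι_eq_zero h _ _ hs
    sep := fun D hD s hs => by
      apply (hb D hD).1
      rw [map_zero]
      apply colimit_section_ext
      intro n
      refine (hs n).trans (map_zero _).symm
    complete := fun D hD s hs => by
      obtain ⟨t, ht⟩ := colimit_exists_section (infinitesimalNeighborhoods A I) 
        ((Opens.map j.base).obj D) (fun n => pull j D (s n)) (fun m n f => hs m n (leOfHom f))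
      obtain ⟨t, rfl⟩ := (hb D hD).2 t
      exact ⟨t, ht⟩ }

end FormalSpectrum

end AlgebraicGeometry.LocallyRingedSpace

end

/-! ### Filtrations, adic completeness and adic localization -/

section AdicAlgebra

variable {A : Type*} [CommRing A]

/-- Modulo K (n+i+1) the element y lies in J^(n+i) = J^i · J^n, hence is a combination of the
generators a of J^n with coefficients in J^i. -/
theorem exists_approx_of_filtration (J : Ideal A) (K : ℕ → Ideal A)
    (hK : ∀ n, K n ≤ J ^ n ⊔ K (n + 1)) (n m : ℕ) (a : Fin m → A)
    (ha : Ideal.span (Set.range a) = J ^ n) (i : ℕ) (y : A) (hy : y ∈ K (n + i)) :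
    ∃ c : Fin m → A, (∀ α, c α ∈ J ^ i) ∧ y - ∑ α, c α * a α ∈ K (n + (i + 1)) := by
  obtain ⟨z, hz, w, hw, rfl⟩ := Submodule.mem_sup.1 (hK _ hy)
  rw [add_comm n i, pow_add, ← ha] at hz
  have hz' : z ∈ J ^ i • Submodule.span A (Set.range a) := hz
  rw [Submodule.mem_ideal_smul_span_iff_exists_sum] at hz'
  obtain ⟨c, hc, rfl⟩ := hz'
  refine ⟨c, hc, ?_⟩
  rw [Finsupp.sum_fintype _ _ (by simp)]
  simpa [add_assoc] using hw

/-- Iterating the approximation writes x ∈ K n as a series in the finitely many generators of J^n.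
The partial sums S of the coefficients converge because J^i ≤ K i, and by separatedness x equals the
combination with the limits t as coefficients. -/
theorem le_pow_of_filtration (J : Ideal A) (hJ : J.FG) (K : ℕ → Ideal A) (anti : Antitone K)
    (sep : ∀ x, (∀ n, x ∈ K n) → x = 0)
    (complete : ∀ s : ℕ → A, (∀ n, s (n + 1) - s n ∈ K n) → ∃ t, ∀ n, t - s n ∈ K n)
    (hJK : ∀ n, J ^ n ≤ K n) (hK : ∀ n, K n ≤ J ^ n ⊔ K (n + 1)) (n : ℕ) : K n ≤ J ^ n := by
  obtain ⟨m, a, ha⟩ := Submodule.fg_iff_exists_fin_generating_family.1 (hJ.pow (n := n))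
  intro x hx
  choose c hcJ hc using exists_approx_of_filtration J K hK n m a ha
  let X : ∀ i, {y : A // y ∈ K (n + i)} := fun i => Nat.rec ⟨x, hx⟩
    (fun i y => ⟨y.1 - ∑ α, c i y.1 y.2 α * a α, hc i y.1 y.2⟩) i
  let d : ℕ → Fin m → A := fun i => c i (X i).1 (X i).2
  have hX : ∀ i, (X (i + 1)).1 = (X i).1 - ∑ α, d i α * a α := fun i => rfl
  have hd : ∀ i α, d i α ∈ J ^ i := fun i α => hcJ _ _ _ _
  let S : ℕ → Fin m → A := fun i α => ∑ j ∈ Finset.range i, d j α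
  have hS : ∀ i, x - ∑ α, S i α * a α = (X i).1 := by
    intro i
    induction i with
    | zero => simp [S, X]
    | succ i ih =>
      rw [hX, ← ih, sub_sub, ← Finset.sum_add_distrib]
      congr 1
      refine Finset.sum_congr rfl fun α _ => ?_
      simp only [S, Finset.sum_range_succ, add_mul]
  choose t ht using fun α => complete (fun i => S i α) (fun i => by
    simp only [S, Finset.sum_range_succ, add_sub_cancel_left]
    exact hJK i (hd i α))
  have h0 : x - ∑ α, t α * a α = 0 := by
    apply sep
    intro i
    have h1 : x - ∑ α, t α * a α = (X i).1 - ∑ α, (t α - S i α) * a α := by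
      rw [← hS]
      simp only [sub_mul, Finset.sum_sub_distrib]
      ring
    rw [h1]
    refine (K i).sub_mem (anti (Nat.le_add_left i n) (X i).2) ?_
    exact Ideal.sum_mem _ fun α _ => Ideal.mul_mem_right _ _ (ht α i)
  rw [sub_eq_zero.1 h0]
  refine Ideal.sum_mem _ fun α _ => Ideal.mul_mem_left _ _ ?_
  have : a α ∈ Submodule.span A (Set.range a) := Submodule.subset_span ⟨α, rfl⟩
  rwa [ha] at this

theorem isAdicComplete_of_filtration (J : Ideal A) (hJ : J.FG) (K : ℕ → Ideal A)
    (anti : Antitone K) (sep : ∀ x, (∀ n, x ∈ K n) → x = 0)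
    (complete : ∀ s : ℕ → A, (∀ n, s (n + 1) - s n ∈ K n) → ∃ t, ∀ n, t - s n ∈ K n)
    (hJK : ∀ n, J ^ n ≤ K n) (hK : ∀ n, K n ≤ J ^ n ⊔ K (n + 1)) :
    (∀ n, K n = J ^ n) ∧ IsAdicComplete J A := by
  have h : ∀ n, K n = J ^ n := fun n =>
    le_antisymm (le_pow_of_filtration J hJ K anti sep complete hJK hK n) (hJK n)
  have hs : ∀ n, (J ^ n • ⊤ : Submodule A A) = K n := fun n => by
    rw [h n]; simp
  refine ⟨h, { haus' := fun x hx => sep x fun n => ?_, prec' := fun f hf => ?_ }⟩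
  · have := (SModEq.sub_mem.1 (hx n))
    rwa [hs, sub_zero] at this
  · obtain ⟨t, ht⟩ := complete f fun n => by
      have := SModEq.sub_mem.1 (hf (Nat.le_succ n)).symm
      rwa [hs] at this
    refine ⟨t, fun n => ?_⟩
    rw [SModEq.comm, SModEq.sub_mem, hs]
    exact ht n

theorem IsAdicComplete.exists_limit {J : Ideal A} (h : IsAdicComplete J A) (s : ℕ → A)
    (hs : ∀ n, s (n + 1) - s n ∈ J ^ n) : ∃ t, ∀ n, t - s n ∈ J ^ n := by
  have hs' : ∀ m n, m ≤ n → s n - s m ∈ J ^ m := by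
    intro m n hmn
    induction n, hmn using Nat.le_induction with
    | base => simp
    | succ n hmn ih =>
      rw [← sub_add_sub_cancel]
      exact (J ^ m).add_mem (Ideal.pow_le_pow_right hmn (hs n)) ih
  obtain ⟨t, ht⟩ := h.prec' s fun {m n} hmn => by
    rw [SModEq.comm, SModEq.sub_mem]
    simpa using hs' m n hmn
  refine ⟨t, fun n => ?_⟩
  have := SModEq.sub_mem.1 (ht n).symm
  simpa using this

theorem IsAdicComplete.eq_zero {J : Ideal A} (h : IsAdicComplete J A) (x : A)
    (hx : ∀ n, x ∈ J ^ n) : x = 0 := by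
  refine h.haus' x fun n => ?_
  rw [SModEq.sub_mem]
  simpa using hx n

/-- V and J define the same topology. A V-adic Cauchy sequence f becomes J-adic Cauchy along the
subsequence f (N n), and the limit of that subsequence is the limit of f. -/
theorem IsAdicComplete.of_pow_le {J V : Ideal A} (h : IsAdicComplete J A) (hJV : J ≤ V) {N : ℕ}
    (hN : V ^ N ≤ J) : IsAdicComplete V A := by
  have hsm : ∀ n, (V ^ n • ⊤ : Submodule A A) = V ^ n := fun n => by simp
  have hN' : ∀ n, V ^ (N * n) ≤ J ^ n := fun n => by
    rw [pow_mul]; exact Ideal.pow_right_mono hN n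
  refine { haus' := fun x hx => h.eq_zero x fun n => ?_, prec' := fun f hf => ?_ }
  · have := SModEq.sub_mem.1 (hx (N * n))
    rw [hsm, sub_zero] at this
    exact hN' n this
  · have hf' : ∀ m n, m ≤ n → f n - f m ∈ V ^ m := fun m n hmn => by
      have := SModEq.sub_mem.1 (hf hmn).symm
      rwa [hsm] at this
    obtain ⟨t, ht⟩ := h.exists_limit (fun n => f (N * n)) fun n =>
      hN' n (hf' _ _ (Nat.mul_le_mul_left N (Nat.le_succ n)))
    refine ⟨t, fun n => ?_⟩
    rw [SModEq.comm, SModEq.sub_mem, hsm]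
    -- For N = 0 the subsequence is constant, but then V^0 ≤ J forces J = V = ⊤.
    rcases Nat.eq_zero_or_pos N with rfl | hpos
    · have h1 : (1 : A) ∈ J := hN (by simp)
      have hJ : J = ⊤ := (Ideal.eq_top_iff_one J).2 h1
      have hV : V = ⊤ := top_le_iff.1 (hJ ▸ hJV)
      rw [hV, Ideal.top_pow]
      trivial
    · rw [← sub_add_sub_cancel]
      exact (V ^ n).add_mem (Ideal.pow_right_mono hJV n (ht n))
        (hf' _ _ (Nat.le_mul_of_pos_left n hpos))

/-- `ρ : A → A'` identifies all `A'/J'^n` with the localizations `(A/J^n)_h`, except that `ρ h` need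
not be invertible. -/
structure IsAdicLocalization {A A' : Type*} [CommRing A] [CommRing A'] (ρ : A →+* A') (h : A)
    (J : Ideal A) (J' : Ideal A') : Prop where
  surj : ∀ (n : ℕ) (s : A'), ∃ (e : ℕ) (t : A), ρ h ^ e * s - ρ t ∈ J' ^ n
  inj : ∀ (n : ℕ) (t : A), ρ t ∈ J' ^ n → ∃ e : ℕ, h ^ e * t ∈ J ^ n

end AdicAlgebra

/-! ### Sections over a basic open of a chart -/

noncomputable section

namespace AlgebraicGeometry.LocallyRingedSpace.FormalChart

variable {X : LocallyRingedSpace.{u}} {W : Opens X.toTopCat} {A : Type u} [CommRing A]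
  {I : Ideal A} (C : FormalChart X W A I) {D : Opens X.toTopCat}

/-- The section over `D ≤ W` given by an element of `A`. -/
def sec (hD : D ≤ W) : A →+* X.Sec D := (X.res hD).comp C.β

theorem res_sec {D' : Opens X.toTopCat} (hD : D ≤ W) (h : D' ≤ D) (c : A) :
    X.res h (C.sec hD c) = C.sec (h.trans hD) c := X.res_res _ _ _

theorem ev_sec (hD : D ≤ W) (c : A) (x : X) (hx : x ∈ D) :
    X.ev x hx (C.sec hD c) = X.ev x (hD hx) (C.β c) := X.ev_res _ _ _ _

theorem pull_sec (hD : D ≤ W) (n : ℕ) (c : A) :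
    pull (C.r n) D (C.sec hD c) = specSec _ _ (Ideal.Quotient.mk _ c) := by
  refine (pull_res (C.r n) hD (C.β c)).trans ?_
  rw [C.pull_β]
  exact res_specSec _ _ _

/-- `D` is the open subset of `W` where `a` does not vanish. -/
def IsBasic (D : Opens X.toTopCat) (a : A) : Prop :=
  D ≤ W ∧ ∀ x (hx : x ∈ W), x ∈ D ↔ X.ev x hx (C.β a) ≠ 0

variable {C} {a : A}

theorem IsBasic.mem_preimage (h : C.IsBasic D a) (n : ℕ) (y : PrimeSpectrum (A ⧸ I ^ (n + 1))) :
    y ∈ (Opens.map (C.r n).base).obj D ↔ Ideal.Quotient.mk _ a ∉ y.asIdeal := by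
  have h1 : y ∈ (Opens.map (C.r n).base).obj D ↔ (C.r n).base y ∈ D := Iff.rfl
  rw [h1, h.2 _ (C.r_mem n y), not_iff_not]
  have h2 := ev_pull_eq_zero_iff (C.r n) (C.β a) y (C.r_mem n y)
  rw [C.pull_β] at h2
  exact h2.symm.trans (ev_specSec_eq_zero_iff _ _ _ _)

theorem IsBasic.isUnit (h : C.IsBasic D a) : IsUnit (C.sec h.1 a) := by
  apply X.isUnit_of_forall_ev_ne_zero
  intro x hx
  rw [ev_sec]
  exact (h.2 x (h.1 hx)).1 hx

theorem IsBasic.pull_surj (h : C.IsBasic D a) (n : ℕ)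
    (z : (spec (A ⧸ I ^ (n + 1))).Sec ((Opens.map (C.r n).base).obj D)) :
    ∃ (e : ℕ) (c : A), pull (C.r n) D (C.sec h.1 a ^ e) * z = pull (C.r n) D (C.sec h.1 c) := by
  obtain ⟨e, c, hc⟩ := specSec_surj _ (Ideal.Quotient.mk _ a) (h.mem_preimage n) z
  obtain ⟨c, rfl⟩ := Ideal.Quotient.mk_surjective c
  refine ⟨e, c, ?_⟩
  rw [map_pow, pull_sec, pull_sec]
  exact hc

theorem IsBasic.pull_eq_zero (h : C.IsBasic D a) (n : ℕ) (c : A)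
    (hc : pull (C.r n) D (C.sec h.1 c) = 0) : ∃ e : ℕ, a ^ e * c ∈ I ^ (n + 1) := by
  rw [pull_sec] at hc
  obtain ⟨e, he⟩ := specSec_inj _ (Ideal.Quotient.mk _ a) (h.mem_preimage n) _ hc
  refine ⟨e, ?_⟩
  rwa [← map_pow, ← map_mul, Ideal.Quotient.eq_zero_iff_mem] at he

theorem pull_eq_zero_of_mem (hD : D ≤ W) (n : ℕ) {s : X.Sec D}
    (hs : s ∈ I.map (C.sec hD) ^ (n + 1)) : pull (C.r n) D s = 0 := by
  rw [← RingHom.mem_ker]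
  suffices h : I.map (C.sec hD) ^ (n + 1) ≤ RingHom.ker (pull (C.r n) D) from h hs
  rw [← Ideal.map_pow, Ideal.map_le_iff_le_comap]
  intro c hc
  rw [Ideal.mem_comap, RingHom.mem_ker, pull_sec, Ideal.Quotient.eq_zero_iff_mem.2 hc, map_zero]

/-- The chart axioms make the sections over D separated and complete for the kernels of pullback to
the Spec (A/I^(n+1)). Consecutive kernels differ only by powers of the extension of I, because a
section can be approximated by elements of A after multiplying by a power of a, which is invertible
on D. Hence the kernels are the powers of that ideal. -/
theorem IsBasic.filtration [IsNoetherianRing A] (h : C.IsBasic D a) :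
    (∀ n s, pull (C.r n) D s = 0 ↔ s ∈ I.map (C.sec h.1) ^ (n + 1)) ∧
      IsAdicComplete (I.map (C.sec h.1)) (X.Sec D) := by
  -- The index is shifted: stage n of the chart is A/I^(n+1), so its kernel is to be compared with
  -- the power n+1, and K 0 is the whole ring.
  let K : ℕ → Ideal (X.Sec D) := fun n => Nat.casesOn n ⊤ fun n => RingHom.ker (pull (C.r n) D)
  have hK1 : ∀ n, K (n + 1) = RingHom.ker (pull (C.r n) D) := fun n => rfl
  suffices h' : (∀ n, K n = I.map (C.sec h.1) ^ n) ∧ IsAdicComplete (I.map (C.sec h.1)) (X.Sec D) by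
    refine ⟨fun n s => ?_, h'.2⟩
    rw [← h'.1, hK1, RingHom.mem_ker]
  refine isAdicComplete_of_filtration (I.map (C.sec h.1))
    (Ideal.FG.map (IsNoetherian.noetherian I) _) K ?_ ?_ ?_ ?_ ?_
  · refine antitone_nat_of_succ_le fun n => ?_
    cases n with
    | zero => exact le_top
    | succ n => exact fun s hs => C.pull_eq_zero_of_le (Nat.le_succ n) D s hs
  · exact fun s hs => C.sep D h.1 s fun n => hs (n + 1)
  · intro s hs
    have hle : ∀ m n, m ≤ n → pull (C.r m) D (s (n + 1)) = pull (C.r m) D (s (m + 1)) := by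
      intro m n hmn
      induction n, hmn using Nat.le_induction with
      | base => rfl
      | succ n hmn ih =>
        rw [← ih, ← sub_eq_zero, ← map_sub]
        exact C.pull_eq_zero_of_le hmn D _ (hs (n + 1))
    obtain ⟨t, ht⟩ := C.complete D h.1 (fun n => s (n + 1)) hle
    refine ⟨t, fun n => ?_⟩
    cases n with
    | zero => trivial
    | succ n => rw [hK1, RingHom.mem_ker, map_sub, ht, sub_self]
  · intro n
    cases n with
    | zero => exact le_top
    | succ n => exact fun s hs => pull_eq_zero_of_mem h.1 n hs
  · intro n
    cases n with
    | zero => rw [pow_zero, Ideal.one_eq_top]; exact le_sup_of_le_left le_top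
    | succ n =>
      intro s hs
      -- One stage further, a^e s agrees with some c ∈ A. As s dies at stage n, so does c, hence
      -- a^e' c ∈ I^(n+1) for some e'.
      obtain ⟨e, c, hc⟩ := h.pull_surj (n + 1) (pull (C.r (n + 1)) D s)
      rw [← map_mul] at hc
      have h3 : pull (C.r (n + 1)) D (C.sec h.1 a ^ e * s - C.sec h.1 c) = 0 := by
        rw [map_sub, hc, sub_self]
      have h4 := C.pull_eq_zero_of_le (Nat.le_succ n) D _ h3
      have hs' : pull (C.r n) D s = 0 := hs
      rw [map_sub, map_mul, hs', mul_zero, zero_sub, neg_eq_zero] at h4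
      obtain ⟨e', he'⟩ := h.pull_eq_zero n c h4
      have hu := h.isUnit.pow (e' + e)
      have hmem : C.sec h.1 a ^ (e' + e) * s ∈ I.map (C.sec h.1) ^ (n + 1) ⊔ K (n + 2) := by
        have : C.sec h.1 a ^ (e' + e) * s =
            C.sec h.1 (a ^ e' * c) + C.sec h.1 a ^ e' * (C.sec h.1 a ^ e * s - C.sec h.1 c) := by
          rw [map_mul, map_pow]; ring
        rw [this]
        refine Submodule.add_mem_sup ?_ (Ideal.mul_mem_left _ _ h3)
        rw [← Ideal.map_pow]
        exact Ideal.mem_map_of_mem _ he'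
      exact (Ideal.unit_mul_mem_iff_mem _ hu).1 hmem

/-- All points of W come from Spec (A/I), where a section over a basic open that vanishes at every
point is nilpotent; the kernel of pullback to that stage is the extension of I. -/
theorem IsBasic.mem_vanishing_iff [IsNoetherianRing A] (h : C.IsBasic D a) (s : X.Sec D) :
    s ∈ X.vanishing D ↔ s ∈ (I.map (C.sec h.1)).radical := by
  have hf := h.filtration.1 0
  constructor
  · intro hs
    have h1 : pull (C.r 0) D s ∈ (spec _).vanishing ((Opens.map (C.r 0).base).obj D) := by
      intro y hy
      exact (ev_pull_eq_zero_iff (C.r 0) s y hy).2 (hs _ hy)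
    obtain ⟨n, hn⟩ := isNilpotent_of_mem_vanishing _ _ (h.mem_preimage 0) _ h1
    refine ⟨n, ?_⟩
    rw [← map_pow, hf] at hn
    simpa using hn
  · rintro ⟨n, hn⟩ x hx
    obtain ⟨y, rfl⟩ := C.exists_r x (h.1 hx)
    have h1 := (hf (s ^ n)).2 (by simpa using hn)
    have h2 := (ev_pull_eq_zero_iff (C.r 0) (s ^ n) y hx).1 (by rw [h1, map_zero])
    rw [map_pow] at h2
    exact eq_zero_of_pow_eq_zero h2
end AlgebraicGeometry.LocallyRingedSpace.FormalChart
end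

/-! ### Smaller basic opens, and lifting from the reduction -/

noncomputable section

namespace AlgebraicGeometry.LocallyRingedSpace

namespace FormalChart

variable {X : LocallyRingedSpace.{u}} {W : Opens X.toTopCat} {A : Type u} [CommRing A]
  {I : Ideal A} {C : FormalChart X W A I} {D D' : Opens X.toTopCat} {a : A}

theorem map_le_vanishing [IsNoetherianRing A] (h : C.IsBasic D a) :
    I.map (C.sec h.1) ≤ X.vanishing D := fun s hs =>
  (h.mem_vanishing_iff s).2 (Ideal.le_radical hs)

/-- The vanishing ideal is the radical of the extension of I; being finitely generated, it has a
power inside that extension, so both ideals define the same topology. -/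
theorem IsBasic.isAdicComplete [IsNoetherianRing A] [IsNoetherianRing (X.Sec D)]
    (h : C.IsBasic D a) : IsAdicComplete (X.vanishing D) (X.Sec D) := by
  obtain ⟨N, hN⟩ := Ideal.exists_pow_le_of_le_radical_of_fg
    (I := X.vanishing D) (J := I.map (C.sec h.1))
    (fun s hs => (h.mem_vanishing_iff s).1 hs) (IsNoetherian.noetherian _)
  exact h.filtration.2.of_pow_le (map_le_vanishing h) hN

theorem IsBasic.approx [IsNoetherianRing A] (h : C.IsBasic D a) (n : ℕ) (s : X.Sec D) :
    ∃ (e : ℕ) (c : A), C.sec h.1 a ^ e * s - C.sec h.1 c ∈ I.map (C.sec h.1) ^ (n + 1) := by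
  obtain ⟨e, c, hc⟩ := h.pull_surj n (pull (C.r n) D s)
  refine ⟨e, c, ?_⟩
  rw [← h.filtration.1 n, map_sub, ← hc, map_mul, sub_self]

theorem IsBasic.exists_mem_pow [IsNoetherianRing A] (h : C.IsBasic D a) (n : ℕ) (c : A)
    (hc : C.sec h.1 c ∈ I.map (C.sec h.1) ^ (n + 1)) : ∃ e : ℕ, a ^ e * c ∈ I ^ (n + 1) :=
  h.pull_eq_zero n c ((h.filtration.1 n _).2 hc)

/-- Modulo vanishing sections s is c/a^e with a invertible on D. Hence D' is where c does not vanish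
inside D, that is, where ac does not vanish in the whole of W. -/
theorem IsBasic.mul [IsNoetherianRing A] (h : C.IsBasic D a) (hD' : D' ≤ D) (s : X.Sec D)
    (hs : ∀ x (hx : x ∈ D), x ∈ D' ↔ X.ev x hx s ≠ 0) {e : ℕ} {c : A}
    (hc : C.sec h.1 a ^ e * s - C.sec h.1 c ∈ X.vanishing D) : C.IsBasic D' (a * c) := by
  refine ⟨hD'.trans h.1, fun x hx => ?_⟩
  rw [map_mul, map_mul, mul_ne_zero_iff, ← h.2 x hx]
  have key : ∀ hxD : x ∈ D, x ∈ D' ↔ X.ev x hx (C.β c) ≠ 0 := by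
    intro hxD
    have h1 := hc x hxD
    rw [map_sub, map_mul, map_pow, ev_sec, ev_sec, sub_eq_zero] at h1
    rw [← h1, hs x hxD, mul_ne_zero_iff]
    have := (h.2 x hx).1 hxD
    exact ⟨fun h => ⟨pow_ne_zero _ this, h⟩, fun h => h.2⟩
  exact ⟨fun hx' => ⟨hD' hx', (key (hD' hx')).1 hx'⟩, fun hx' => (key hx'.1).2 hx'.2⟩

/-- Up to powers of b and up to high order, elements of J(D')^k come from J(D)^k. This is what gives
the injectivity half of adic localization, where membership in a power of J(D) must be concluded
from information over D' only. -/
theorem IsBasic.vanishing_pow_approx [IsNoetherianRing A] {b : A} (h : C.IsBasic D a)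
    (h' : C.IsBasic D' b) (hD : D' ≤ D) (n k : ℕ) (s : X.Sec D') (hs : s ∈ X.vanishing D' ^ k) :
    ∃ (e : ℕ), ∃ t ∈ X.vanishing D ^ k,
      C.sec h'.1 b ^ e * s - X.res hD t ∈ I.map (C.sec h'.1) ^ (n + 1) := by
  have hres : ∀ c, X.res hD (C.sec h.1 c) = C.sec h'.1 c := fun c => C.res_sec _ _ _
  induction k generalizing s with
  | zero =>
    obtain ⟨e, d, hd⟩ := h'.approx n s
    exact ⟨e, C.sec h.1 d, by simp, by rwa [hres]⟩
  | succ k ih =>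
    rw [pow_succ] at hs
    induction hs using Submodule.mul_induction_on' with
    | mem_mul_mem s₁ hs₁ s₂ hs₂ =>
      obtain ⟨e₁, t₁, ht₁, h₁⟩ := ih s₁ hs₁
      obtain ⟨e, d, hd⟩ := h'.approx n s₂
      have hdv : C.sec h'.1 d ∈ X.vanishing D' := by
        have h1 := map_le_vanishing h' (Ideal.pow_le_self (Nat.succ_ne_zero n) hd)
        rw [← sub_sub_cancel (C.sec h'.1 b ^ e * s₂) (C.sec h'.1 d)]
        exact (X.vanishing D').sub_mem (Ideal.mul_mem_left _ _ hs₂) h1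
      -- d vanishes on D' and b vanishes off D', so the product vanishes on all of D.
      have hbd : C.sec h.1 (b * d) ∈ X.vanishing D := by
        intro x hx
        rw [ev_sec, map_mul, map_mul]
        by_cases hx' : x ∈ D'
        · have := hdv x hx'
          rw [ev_sec] at this
          rw [this, mul_zero]
        · have := mt (h'.2 x (h.1 hx)).2 hx'
          rw [not_not.1 this, zero_mul]
      refine ⟨e₁ + (e + 1), t₁ * C.sec h.1 (b * d), ?_, ?_⟩
      · rw [pow_succ]; exact Ideal.mul_mem_mul ht₁ hbd
      · rw [← Ideal.Quotient.eq] at h₁ hd ⊢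
        simp only [map_mul, map_pow, hres] at h₁ hd ⊢
        rw [← h₁, ← hd]
        ring
    | add s₁ _ s₂ _ h₁ h₂ =>
      obtain ⟨e₁, t₁, ht₁, h₁⟩ := h₁
      obtain ⟨e₂, t₂, ht₂, h₂⟩ := h₂
      refine ⟨e₁ + e₂, C.sec h.1 b ^ e₂ * t₁ + C.sec h.1 b ^ e₁ * t₂,
        Ideal.add_mem _ (Ideal.mul_mem_left _ _ ht₁) (Ideal.mul_mem_left _ _ ht₂), ?_⟩
      rw [← Ideal.Quotient.eq] at h₁ h₂ ⊢
      simp only [map_mul, map_pow, map_add, hres] at h₁ h₂ ⊢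
      rw [← h₁, ← h₂]
      ring

/-- To order n the section f may be replaced by c/a^e₀ with c ∈ A, so that D' becomes the basic open
of ac in the chart. Both halves then reduce to fractions of elements of A with denominator ac. -/
theorem IsBasic.isAdicLocalization [IsNoetherianRing A] (h : C.IsBasic D a) (hD : D' ≤ D)
    (f : X.Sec D) (hf : ∀ x (hx : x ∈ D), x ∈ D' ↔ X.ev x hx f ≠ 0) :
    IsAdicLocalization (X.res hD) f (X.vanishing D) (X.vanishing D') := by
  have hres : ∀ c, X.res hD (C.sec h.1 c) = C.sec (hD.trans h.1) c := fun c => C.res_sec _ _ _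
  obtain ⟨v, hv⟩ := h.isUnit.exists_right_inv
  have hle : ∀ n, I.map (C.sec h.1) ^ (n + 1) ≤ X.vanishing D ^ n := fun n =>
    (Ideal.pow_right_mono (map_le_vanishing h) _).trans (Ideal.pow_le_pow_right (Nat.le_succ n))
  have key : ∀ n, ∃ (e₀ : ℕ) (c : A), C.sec h.1 a ^ e₀ * f - C.sec h.1 c ∈ X.vanishing D ^ n ∧
      C.IsBasic D' (a * c) := by
    intro n
    obtain ⟨e₀, c, hc⟩ := h.approx n f
    refine ⟨e₀, c, hle n hc, h.mul hD f hf (e := e₀) ?_⟩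
    exact map_le_vanishing h (Ideal.pow_le_self (Nat.succ_ne_zero n) hc)
  constructor
  · intro n s
    obtain ⟨e₀, c, hc, h'⟩ := key n
    obtain ⟨e, d, hd⟩ := h'.approx n s
    have hd' : C.sec h'.1 (a * c) ^ e * s - C.sec h'.1 d ∈ X.vanishing D' ^ n :=
      ((Ideal.pow_right_mono (map_le_vanishing h') _).trans
        (Ideal.pow_le_pow_right (Nat.le_succ n))) hd
    have hc' := X.vanishing_le_map_res hD n hc
    have hv' : X.res hD v * C.sec h'.1 a = 1 := by
      rw [← hres, ← map_mul, mul_comm, hv, map_one]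
    -- From (ac)^e s ≡ d and c ≡ a^e₀ f follows a^(e(1+e₀)) f^e s ≡ d; v is the inverse of a.
    refine ⟨e, v ^ (e * (1 + e₀)) * C.sec h.1 d, ?_⟩
    rw [map_sub] at hc'
    rw [← Ideal.Quotient.eq] at hd' hc' ⊢
    have hv'' := congrArg (Ideal.Quotient.mk (X.vanishing D' ^ n)) hv'
    simp only [map_mul, map_pow, hres, map_one] at hd' hc' hv'' ⊢
    rw [← hd', ← hc', mul_pow, mul_pow]
    generalize Ideal.Quotient.mk (X.vanishing D' ^ n) (X.res hD v) = V at *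
    generalize Ideal.Quotient.mk (X.vanishing D' ^ n) (C.sec _ a) = α at *
    have : V ^ (e * (1 + e₀)) * (α ^ e * (α ^ e₀) ^ e) = 1 := by
      rw [← pow_mul, ← pow_add, mul_comm e₀ e, mul_add, mul_one, ← mul_pow, hv'', one_pow]
    linear_combination (-(Ideal.Quotient.mk (X.vanishing D' ^ n)) (X.res hD f) ^ e *
      (Ideal.Quotient.mk (X.vanishing D' ^ n)) s) * this
  · intro n t ht
    obtain ⟨e₀, c, hc, h'⟩ := key n
    have hle' : I.map (C.sec h'.1) ^ (n + 1) ≤ X.vanishing D' ^ n :=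
      (Ideal.pow_right_mono (map_le_vanishing h') _).trans (Ideal.pow_le_pow_right (Nat.le_succ n))
    have hmap : ∀ z ∈ I.map (C.sec h.1) ^ (n + 1), X.res hD z ∈ I.map (C.sec h'.1) ^ (n + 1) := by
      intro z hz
      have h1 := Ideal.mem_map_of_mem (X.res hD) hz
      rw [Ideal.map_pow, Ideal.map_map] at h1
      have h2 : (X.res hD).comp (C.sec h.1) = C.sec h'.1 := RingHom.ext hres
      rwa [h2] at h1
    -- Subtracting an element t₂ of J(D)^n leaves a section whose restriction lies in the power n+1
    -- of the extension of I. Approximated by d₃ ∈ A, it is killed modulo I^(n+1) by a power of ac.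
    obtain ⟨e₂, t₂, ht₂, h₂⟩ := h.vanishing_pow_approx h' hD n n _ ht
    obtain ⟨e₃, d₃, h₃⟩ := h.approx n (C.sec h.1 (a * c) ^ e₂ * t - t₂)
    have h₄ : C.sec h'.1 d₃ ∈ I.map (C.sec h'.1) ^ (n + 1) := by
      have h5 := hmap _ h₃
      rw [map_sub, hres] at h5
      have h6 : X.res hD (C.sec h.1 a ^ e₃ * (C.sec h.1 (a * c) ^ e₂ * t - t₂)) ∈
          I.map (C.sec h'.1) ^ (n + 1) := by
        have h7 : X.res hD (C.sec h.1 a ^ e₃ * (C.sec h.1 (a * c) ^ e₂ * t - t₂)) =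
            X.res hD (C.sec h.1 a ^ e₃) *
              (C.sec h'.1 (a * c) ^ e₂ * X.res hD t - X.res hD t₂) := by
          simp only [map_mul, map_sub, map_pow, hres]
        rw [h7]
        exact Ideal.mul_mem_left _ _ h₂
      exact (Submodule.sub_mem_iff_right _ h6).1 h5
    obtain ⟨e₄, he₄⟩ := h'.exists_mem_pow n d₃ h₄
    refine ⟨e₄ + e₂, ?_⟩
    have h₇ : C.sec h.1 ((a * c) ^ e₄ * d₃) ∈ X.vanishing D ^ n := by
      apply hle
      rw [← Ideal.map_pow]
      exact Ideal.mem_map_of_mem _ he₄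
    have h₃' := hle n h₃
    rw [← Ideal.Quotient.eq] at hc h₃'
    rw [← Ideal.Quotient.eq_zero_iff_mem] at h₇ ht₂ ⊢
    have hv'' := congrArg (Ideal.Quotient.mk (X.vanishing D ^ n)) hv
    simp only [map_mul, map_pow, map_sub, map_one, ht₂, sub_zero] at hc h₃' h₇ hv'' ⊢
    rw [← h₃', ← hc] at h₇
    generalize Ideal.Quotient.mk (X.vanishing D ^ n) v = V at *
    generalize Ideal.Quotient.mk (X.vanishing D ^ n) (C.sec _ a) = α at *
    generalize Ideal.Quotient.mk (X.vanishing D ^ n) f = φ at *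
    generalize Ideal.Quotient.mk (X.vanishing D ^ n) t = τ at *
    have hu : IsUnit α := IsUnit.of_mul_eq_one _ hv''
    have hu2 : IsUnit (α ^ e₃ * (α * α ^ e₀) ^ (e₄ + e₂)) :=
      (hu.pow _).mul ((hu.mul (hu.pow _)).pow _)
    rw [← hu2.mul_right_eq_zero, ← h₇]
    ring

theorem comap_factor_surjective {A : Type u} [CommRing A] (I J : Ideal A) (hIJ : I ≤ J)
    (hJ : J ≤ I.radical) :
    Function.Surjective (PrimeSpectrum.comap (Ideal.Quotient.factor hIJ)) := by
  intro p
  have hp : p ∈ Set.range (PrimeSpectrum.comap (Ideal.Quotient.factor hIJ)) := by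
    rw [range_comap_of_surjective _ _ (Ideal.Quotient.factor_surjective _)]
    intro z hz
    obtain ⟨a, rfl⟩ := Ideal.Quotient.mk_surjective z
    rw [SetLike.mem_coe, RingHom.mem_ker, Ideal.Quotient.factor_mk,
      Ideal.Quotient.eq_zero_iff_mem] at hz
    obtain ⟨n, hn⟩ := hJ hz
    apply p.isPrime.mem_of_pow_mem n
    rw [← map_pow, Ideal.Quotient.eq_zero_iff_mem.2 hn]
    exact p.asIdeal.zero_mem
  exact hp

/-- The closed immersion `Spec (A/J) ⟶ Spec (A/I)` for `I ≤ J`. -/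
def specFactor {A : Type u} [CommRing A] (I J : Ideal A) (hIJ : I ≤ J) :
    spec (A ⧸ J) ⟶ spec (A ⧸ I) :=
  (Spec.map (CommRingCat.ofHom (Ideal.Quotient.factor hIJ))).toLRSHom

theorem specFactor_surjective {A : Type u} [CommRing A] (I J : Ideal A) (hIJ : I ≤ J)
    (hJ : J ≤ I.radical) (p : PrimeSpectrum (A ⧸ I)) :
    ∃ q : PrimeSpectrum (A ⧸ J), (specFactor I J hIJ).base q = p :=
  comap_factor_surjective I J hIJ hJ p

theorem pow_zero_add_one_le_radical : I ^ (0 + 1) ≤ I.radical :=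
  (pow_one I).le.trans Ideal.le_radical

theorem pull_specFactor {A : Type u} [CommRing A] (I J : Ideal A) (hIJ : I ≤ J)
    (U : Opens (spec (A ⧸ I)).toTopCat) (c : A) :
    pull (specFactor I J hIJ) U (specSec (A ⧸ I) U (Ideal.Quotient.mk I c)) =
      specSec (A ⧸ J) _ (Ideal.Quotient.mk J c) :=
  pull_specSec _ (Ideal.Quotient.factor hIJ) _ rfl _ _

/-- The sections t and σ are families over all opens, so that the two forms of the preimage of D,
equal by unfolding, need not be rewritten into each other. -/
theorem pull_comp_eq {Y Z W : LocallyRingedSpace.{u}} (g : Y ⟶ Z) (r : Z ⟶ W)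
    (D : Opens W.toTopCat) (s : W.Sec D) (t : ∀ U, Z.Sec U) (σ : ∀ U, Y.Sec U)
    (hs : pull r D s = t _) (hσ : ∀ U, pull g U (t U) = σ ((Opens.map g.base).obj U)) :
    pull (g ≫ r) D s = σ ((Opens.map (g ≫ r).base).obj D) := by
  have h := pull_comp g r D s
  rw [hs, hσ] at h
  exact h

/-- The morphism `Spec (A/√I) ⟶ X`. -/
def rRed (C : FormalChart X W A I) : spec (A ⧸ I.radical) ⟶ X :=
  specFactor (I ^ (0 + 1)) I.radical pow_zero_add_one_le_radical ≫ C.r 0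

theorem rRed_base (y) : C.rRed.base y = (C.r 0).base ((specFactor (I ^ (0 + 1)) I.radical
    pow_zero_add_one_le_radical).base y) := rfl

theorem exists_rRed (x : X) (hx : x ∈ W) : ∃ y, C.rRed.base y = x := by
  obtain ⟨p, hp⟩ := C.exists_r x hx
  have hle : I.radical ≤ (I ^ (0 + 1)).radical := by rw [zero_add, pow_one]
  have h := specFactor_surjective (I ^ (0 + 1)) I.radical pow_zero_add_one_le_radical hle p
  exact h.elim fun q hq => ⟨q, (rRed_base q).trans ((congrArg _ hq).trans hp)⟩

theorem pull_rRed_sec (hD : D ≤ W) (c : A) :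
    pull C.rRed D (C.sec hD c) = specSec (A ⧸ I.radical) ((Opens.map C.rRed.base).obj D)
      (Ideal.Quotient.mk _ c) :=
  pull_comp_eq (specFactor (I ^ (0 + 1)) I.radical pow_zero_add_one_le_radical) (C.r 0) D
    (C.sec hD c) (fun U => specSec _ U (Ideal.Quotient.mk _ c))
    (fun U => specSec _ U (Ideal.Quotient.mk _ c)) (C.pull_sec hD 0 c)
    fun U => pull_specFactor (I ^ (0 + 1)) I.radical pow_zero_add_one_le_radical U c

/-- The local sections representing f pull back to Spec (A/√I). On overlaps two of them differ by a
section vanishing at every point, which is zero on a reduced scheme, so they glue to a fraction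
c/a^e; this fraction lifts because a is a unit over D. -/
theorem IsBasic.exists_lift (h : C.IsBasic D a) (f : X.reductionSections D) :
    ∃ s : X.Sec D, ∀ x (hx : x ∈ D), X.ev x hx s = f.1 ⟨x, hx⟩ := by
  have hrW : ∀ y, C.rRed.base y ∈ W := fun y => C.r_mem 0 _
  have hpre : ∀ y : PrimeSpectrum (A ⧸ I.radical),
      y ∈ (Opens.map C.rRed.base).obj D ↔ Ideal.Quotient.mk _ a ∉ y.asIdeal := by
    intro y
    have h1 : y ∈ (Opens.map C.rRed.base).obj D ↔ C.rRed.base y ∈ D := Iff.rfl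
    rw [h1, h.2 _ (hrW y), not_iff_not]
    have h2 := ev_pull_eq_zero_iff C.rRed (C.sec le_rfl a) y (hrW y)
    rw [pull_rRed_sec, ev_sec] at h2
    exact h2.symm.trans (ev_specSec_eq_zero_iff _ _ _ _)
  have hred : _root_.IsReduced (A ⧸ I.radical) :=
    (Ideal.isRadical_iff_quotient_reduced _).1 (Ideal.radical_isRadical I)
  choose V hV i s hs using f.2
  let U : D → Opens (spec (A ⧸ I.radical)).toTopCat := fun x => (Opens.map C.rRed.base).obj (V x)
  obtain ⟨t, ht⟩ := (spec (A ⧸ I.radical)).exists_glue (V := (Opens.map C.rRed.base).obj D) U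
    (fun x y hy => (i x).le hy) (fun y hy => ⟨⟨_, hy⟩, hV ⟨_, hy⟩⟩)
    (fun x => pull C.rRed (V x) (s x)) (by
      intro x x'
      rw [← sub_eq_zero]
      apply eq_zero_of_mem_vanishing
      have h1 := pull_res C.rRed (inf_le_left : V x ⊓ V x' ≤ V x) (s x)
      have h2 := pull_res C.rRed (inf_le_right : V x ⊓ V x' ≤ V x') (s x')
      intro y hy
      have h3 := ev_pull_eq_zero_iff C.rRed
        (X.res (inf_le_left : V x ⊓ V x' ≤ V x) (s x) -
          X.res (inf_le_right : V x ⊓ V x' ≤ V x') (s x')) y hy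
      rw [map_sub, h1, h2] at h3
      refine h3.2 ?_
      have hy' : C.rRed.base y ∈ V x ⊓ V x' := hy
      have h4 := X.ev_res (inf_le_left : V x ⊓ V x' ≤ V x) (s x) _ hy'
      have h5 := X.ev_res (inf_le_right : V x ⊓ V x' ≤ V x') (s x') _ hy'
      have h6 := h4.trans ((hs x ⟨_, hy'.1⟩).symm.trans ((hs x' ⟨_, hy'.2⟩).trans h5.symm))
      exact (map_sub (X.ev _ hy') _ _).trans (sub_eq_zero.2 h6))
  obtain ⟨e, c, hc⟩ := specSec_surj _ _ hpre t
  obtain ⟨c, rfl⟩ := Ideal.Quotient.mk_surjective c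
  obtain ⟨v, hv⟩ := h.isUnit.exists_right_inv
  have hst : pull C.rRed D (v ^ e * C.sec h.1 c) = t := by
    have hv' := congrArg (pull C.rRed D) hv
    rw [map_mul, pull_rRed_sec, map_one] at hv'
    rw [map_mul, pull_rRed_sec, map_pow]
    have h2 : (pull C.rRed D v) ^ e * (specSec _ _ (Ideal.Quotient.mk _ c)) =
        (pull C.rRed D v) ^ e * (specSec _ _ (Ideal.Quotient.mk _ a) ^ e * t) :=
      congrArg _ hc.symm
    refine h2.trans ?_
    rw [← mul_assoc, ← mul_pow, mul_comm (pull C.rRed D v), hv', one_pow, one_mul]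
  refine ⟨v ^ e * C.sec h.1 c, fun x hx => ?_⟩
  obtain ⟨y, rfl⟩ := C.exists_rRed x (h.1 hx)
  let x' : D := ⟨_, hx⟩
  have h1 := pull_res C.rRed (i x').le (v ^ e * C.sec h.1 c)
  rw [hst] at h1
  have h2 := h1.trans (ht x')
  have h3 := (ev_pull_eq_zero_iff C.rRed
    (X.res (i x').le (v ^ e * C.sec h.1 c) - s x') y (hV x')).1 (by
      rw [map_sub, h2, sub_self, map_zero])
  rw [map_sub, ev_res, sub_eq_zero] at h3
  exact h3.trans (hs x' ⟨_, hV x'⟩).symm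

/-- The open sets `D` with `C.IsBasic D a` form a basis. -/
theorem exists_isBasic (C : FormalChart X W A I) (N : Opens X.toTopCat) (x : X) (hx : x ∈ W)
    (hxN : x ∈ N) : ∃ (a : A) (D : Opens X.toTopCat), C.IsBasic D a ∧ x ∈ D ∧ D ≤ N := by
  obtain ⟨y, rfl⟩ := C.exists_r x hx
  let y' : PrimeSpectrum (A ⧸ I ^ (0 + 1)) := y
  have hopen : IsOpen {p : PrimeSpectrum (A ⧸ I ^ (0 + 1)) | (C.r 0).base p ∈ N} :=
    ((Opens.map (C.r 0).base).obj N).isOpen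
  obtain ⟨_, ⟨b, rfl⟩, hyb, hb⟩ :=
    PrimeSpectrum.isTopologicalBasis_basic_opens.exists_subset_of_mem_open
      (show y' ∈ {p : PrimeSpectrum (A ⧸ I ^ (0 + 1)) | (C.r 0).base p ∈ N} from hxN) hopen
  obtain ⟨b, rfl⟩ := Ideal.Quotient.mk_surjective b
  have hB : C.IsBasic (X.nonvanishing (C.β b)) b := by
    refine ⟨X.nonvanishing_le _, fun x hx => ?_⟩
    rw [mem_nonvanishing]
    exact ⟨fun h => h.2, fun h => ⟨hx, h⟩⟩
  refine ⟨b, _, hB, (hB.mem_preimage 0 y').2 hyb, fun x hx => ?_⟩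
  obtain ⟨z, rfl⟩ := C.exists_r x (hB.1 hx)
  exact hb ((hB.mem_preimage 0 z).1 hx)

end FormalChart

end AlgebraicGeometry.LocallyRingedSpace
end

/-! ### Affine opens of the reduction -/

noncomputable section

namespace AlgebraicGeometry.LocallyRingedSpace

variable {X Y : LocallyRingedSpace.{u}} {V : Opens X.toTopCat}

theorem _root_.IsAffineOpenSubspace.exists_hom {V : Opens Y.toTopCat} (h : IsAffineOpenSubspace Y V) :
    ∃ (R : Type u) (_ : CommRing R) (j : spec R ⟶ Y), LocallyRingedSpace.IsOpenImmersion j ∧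
      ∀ x, x ∈ V ↔ ∃ z, j.base z = x := by
  obtain ⟨R, ⟨e⟩⟩ := h
  refine ⟨R, inferInstance, e.inv ≫ Y.ofRestrict V.isOpenEmbedding,
    LocallyRingedSpace.IsOpenImmersion.comp _ _, fun x => ⟨fun hx => ?_, ?_⟩⟩
  · exact ⟨e.hom.base ⟨x, hx⟩, congrArg Subtype.val (iso_hom_base_inv_base_apply e ⟨x, hx⟩)⟩
  · rintro ⟨z, rfl⟩
    exact (e.inv.base z).2

theorem isAffineOpenSubspace_of_hom {V : Opens Y.toTopCat} {R : Type u} [CommRing R]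
    (j : spec R ⟶ Y) [hj : LocallyRingedSpace.IsOpenImmersion j] (h : ∀ x, x ∈ V ↔ ∃ z, j.base z = x) :
    IsAffineOpenSubspace Y V := by
  have hr : Set.range j.base = (V : Set Y.toTopCat) := Set.ext fun x => (h x).symm
  have hr' : Set.range (Y.ofRestrict V.isOpenEmbedding).base = (V : Set Y.toTopCat) :=
    Subtype.range_coe
  let f := IsOpenImmersion.lift (Y.ofRestrict V.isOpenEmbedding) j (hr.trans hr'.symm).le
  let g := IsOpenImmersion.lift j (Y.ofRestrict V.isOpenEmbedding) (hr'.trans hr.symm).le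
  refine ⟨CommRingCat.of R, ⟨⟨g, f, ?_, ?_⟩⟩⟩
  · rw [← cancel_mono (Y.ofRestrict V.isOpenEmbedding), Category.assoc,
      IsOpenImmersion.lift_fac, IsOpenImmersion.lift_fac, Category.id_comp]
  · refine (cancel_mono j).1 ?_
    rw [Category.assoc, IsOpenImmersion.lift_fac, IsOpenImmersion.lift_fac]
    exact (Category.id_comp _).symm

/-- A section of the reduction as a section of a sheaf of rings. -/
abbrev toRedSec (f : X.reductionSections V) : X.reduction.Sec V := f

theorem isUnit_res_of_ev_ne_zero {D D' : Opens X.toTopCat} (h : D' ≤ D) (s : X.Sec D)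
    (hs : ∀ x (hx : x ∈ D'), X.ev x (h hx) s ≠ 0) : IsUnit (X.res h s) :=
  X.isUnit_of_forall_ev_ne_zero _ fun x hx => by rw [ev_res]; exact hs x hx

/-- Either side is nonzero exactly when f is invertible near x. If the component of f at x is
nonzero, f is given near x by a section of 𝒪_X with nonzero value, and an inverse of that section
gives an inverse of f. -/
theorem reduction_ev_eq_zero_iff (f : X.reductionSections V) (x : X) (hx : x ∈ V) :
    X.reduction.ev (D := V) x hx (toRedSec f) = 0 ↔ f.1 ⟨x, hx⟩ = 0 := by
  rw [← not_iff_not]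
  constructor
  · intro h h0
    have hle : X.reduction.nonvanishing (D := V) (toRedSec f) ≤ V := X.reduction.nonvanishing_le _
    have hx' : x ∈ X.reduction.nonvanishing (D := V) (toRedSec f) :=
      (X.reduction.mem_nonvanishing _ _).2 ⟨hx, h⟩
    obtain ⟨g, hg⟩ := (X.reduction.isUnit_res_of_ev_ne_zero hle (toRedSec f) fun y hy =>
      ((X.reduction.mem_nonvanishing _ _).1 hy).2).exists_right_inv
    have h1 : f.1 ⟨x, hx⟩ * Subtype.val (p := (· ∈ X.reductionSections _)) g ⟨x, hx'⟩ = 1 :=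
      congrFun (congrArg (Subtype.val (p := (· ∈ X.reductionSections _))) hg) ⟨x, hx'⟩
    rw [h0, zero_mul] at h1
    exact zero_ne_one h1
  · intro h
    obtain ⟨W, hW, i, s, hs⟩ := f.2 ⟨x, hx⟩
    have h1 : X.ev x hW s ≠ 0 := fun h0 => h ((hs ⟨x, hW⟩).trans h0)
    have hle := X.nonvanishing_le s
    have hx' : x ∈ X.nonvanishing s := (X.mem_nonvanishing _ _).2 ⟨hW, h1⟩
    obtain ⟨v, hv⟩ := (X.isUnit_res_of_ev_ne_zero hle s fun y hy =>
      ((X.mem_nonvanishing _ _).1 hy).2).exists_right_inv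
    let g : X.reductionSections (X.nonvanishing s) := (X.toReduction.app (op (X.nonvanishing s))).hom v
    have hg : X.reduction.res (D := V) (hle.trans i.le) (toRedSec f) * toRedSec g = 1 := by
      refine Subtype.ext (funext fun y => ?_)
      have hyW : y.1 ∈ W := hle y.2
      have h2 : f.1 ⟨y.1, i.le hyW⟩ = X.ev y.1 hyW s := hs ⟨y.1, hyW⟩
      have h3 : f.1 ⟨y.1, i.le hyW⟩ * X.ev y.1 y.2 v = 1 := by
        rw [h2, ← X.ev_res hle s y.1 y.2, ← map_mul, hv, map_one]
      exact h3
    intro h0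
    have h2 := congrArg (X.reduction.ev (D := X.nonvanishing s) x hx') hg
    have h3 := X.reduction.ev_res (D := V) (hle.trans i.le) (toRedSec f) x hx'
    have h4 := map_mul (X.reduction.ev (D := X.nonvanishing s) x hx')
      (X.reduction.res (D := V) (hle.trans i.le) (toRedSec f)) (toRedSec g)
    have h5 := h4.symm.trans (h2.trans (map_one _))
    rw [h3, h0, zero_mul] at h5
    exact zero_ne_one (α := X.reduction.residueField (show X.reduction from x)) h5

/-- The open set where a section of the reduction does not vanish. -/
def redNonvanishing (g : X.reductionSections V) : Opens X.toTopCat :=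
  X.reduction.nonvanishing (D := V) (toRedSec g)

theorem mem_redNonvanishing (g : X.reductionSections V) (x : X) :
    x ∈ redNonvanishing g ↔ ∃ hx : x ∈ V, g.1 ⟨x, hx⟩ ≠ 0 :=
  (X.reduction.mem_nonvanishing _ _).trans
    (exists_congr fun hx => not_congr (reduction_ev_eq_zero_iff g x hx))

theorem redNonvanishing_le (g : X.reductionSections V) : redNonvanishing g ≤ V :=
  fun x hx => ((mem_redNonvanishing g x).1 hx).1

section Affine

variable {R : Type u} [CommRing R] (j : spec R ⟶ X.reduction)

theorem ev_eq_zero_iff_of_pull_eq (g : X.reductionSections V) (r : R)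
    (hg : pull j V (toRedSec g) = specSec R _ r) (y : PrimeSpectrum R) (hy : j.base y ∈ V) :
    g.1 ⟨j.base y, hy⟩ = 0 ↔ r ∈ y.asIdeal := by
  refine (reduction_ev_eq_zero_iff g (j.base y) hy).symm.trans ?_
  have h := ev_pull_eq_zero_iff j (D := V) (toRedSec g) y hy
  rw [hg] at h
  exact h.symm.trans (ev_specSec_eq_zero_iff _ _ _ _)

theorem exists_pull_eq_specSec [LocallyRingedSpace.IsOpenImmersion j]
    (hV : ∀ x, x ∈ V ↔ ∃ z, j.base z = x) (r : R) :
    ∃ g : X.reductionSections V, pull j V (toRedSec g) = specSec R _ r :=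
  (IsOpenImmersion.app_bijective j V fun x hx => (hV x).1 hx).2 _

theorem exists_specSec_eq_pull (hV : ∀ x, x ∈ V ↔ ∃ z, j.base z = x)
    (g : X.reductionSections V) :
    ∃ r : R, pull j V (toRedSec g) = specSec R _ r := by
  obtain ⟨e, r, h⟩ := specSec_surj R (1 : R) (U := (Opens.map j.base).obj V) (fun y =>
    ⟨fun _ h1 => y.2.ne_top ((Ideal.eq_top_iff_one _).2 h1), fun _ => (hV _).2 ⟨y, rfl⟩⟩)
    (pull j V (toRedSec g))
  refine ⟨r, ?_⟩
  rw [← h, map_one, one_pow, one_mul]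

end Affine

theorem exists_mem_redNonvanishing (h : IsAffineOpenSubspace X.reduction V) (N : Opens X.toTopCat)
    (x : X) (hx : x ∈ V) (hN : x ∈ N) :
    ∃ g : X.reductionSections V, x ∈ redNonvanishing g ∧ redNonvanishing g ≤ N := by
  obtain ⟨R, _, j, hj, hV⟩ := h.exists_hom
  obtain ⟨y, rfl⟩ := (hV x).1 hx
  have hopen : IsOpen {p : PrimeSpectrum R | j.base p ∈ N} := ((Opens.map j.base).obj N).isOpen
  obtain ⟨_, ⟨r, rfl⟩, hyr, hr⟩ :=
    PrimeSpectrum.isTopologicalBasis_basic_opens.exists_subset_of_mem_open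
      (show y ∈ {p : PrimeSpectrum R | j.base p ∈ N} from hN) hopen
  obtain ⟨g, hg⟩ := exists_pull_eq_specSec j hV r
  refine ⟨g, (mem_redNonvanishing _ _).2 ⟨hx, fun h0 => ?_⟩, fun x hx => ?_⟩
  · exact hyr ((ev_eq_zero_iff_of_pull_eq j g r hg y hx).1 h0)
  · obtain ⟨hxV, hx0⟩ := (mem_redNonvanishing _ _).1 hx
    obtain ⟨z, rfl⟩ := (hV x).1 hxV
    exact hr fun h0 => hx0 ((ev_eq_zero_iff_of_pull_eq j g r hg z hxV).2 h0)

theorem isAffineOpenSubspace_redNonvanishing (h : IsAffineOpenSubspace X.reduction V)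
    (g : X.reductionSections V) : IsAffineOpenSubspace X.reduction (redNonvanishing (X := X) g) := by
  obtain ⟨R, _, j, hj, hV⟩ := h.exists_hom
  obtain ⟨r, hg⟩ := exists_specSec_eq_pull j hV g
  let i : spec (Localization.Away r) ⟶ spec R :=
    (Spec.map (CommRingCat.ofHom (algebraMap R (Localization.Away r)))).toLRSHom
  have hi : LocallyRingedSpace.IsOpenImmersion i :=
    inferInstanceAs (AlgebraicGeometry.IsOpenImmersion
      (Spec.map (CommRingCat.ofHom (algebraMap R (Localization.Away r)))))
  have hi' : ∀ z : PrimeSpectrum R, (∃ w, i.base w = z) ↔ r ∉ z.asIdeal := fun z =>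
    Set.ext_iff.1 (PrimeSpectrum.localization_away_comap_range (Localization.Away r) r) z
  have : LocallyRingedSpace.IsOpenImmersion (i ≫ j) := LocallyRingedSpace.IsOpenImmersion.comp _ _
  refine isAffineOpenSubspace_of_hom (i ≫ j) fun x => ?_
  refine (mem_redNonvanishing g x).trans ⟨?_, ?_⟩
  · rintro ⟨hx, h0⟩
    obtain ⟨z, rfl⟩ := (hV x).1 hx
    obtain ⟨w, rfl⟩ := (hi' z).2 fun hz => h0 ((ev_eq_zero_iff_of_pull_eq j g r hg z hx).2 hz)
    exact ⟨w, rfl⟩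
  · rintro ⟨w, rfl⟩
    have hx : j.base (i.base w) ∈ V := (hV _).2 ⟨_, rfl⟩
    exact ⟨hx, fun h0 => (hi' _).1 ⟨w, rfl⟩
      ((ev_eq_zero_iff_of_pull_eq j g r hg (i.base w) hx).1 h0)⟩

/-- A proper ideal lies in a maximal ideal, which is a point of the affine scheme. This serves
twice: for finite coverings and for locating the maximal ideals of A_V. -/
theorem exists_forall_mem_eq_zero (h : IsAffineOpenSubspace X.reduction V)
    (I : Ideal (X.reductionSections V)) (hI : I ≠ ⊤) :
    ∃ (x : X) (hx : x ∈ V), ∀ g ∈ I, g.1 ⟨x, hx⟩ = 0 := by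
  obtain ⟨R, _, j, hj, hV⟩ := h.exists_hom
  let φ : X.reductionSections V →+* (spec R).Sec ((Opens.map j.base).obj V) := pull j V
  have hφ : Function.Bijective φ := IsOpenImmersion.app_bijective j V fun x hx => (hV x).1 hx
  have hI' : (I.map φ).comap (specSec R _) ≠ ⊤ := by
    rw [Ne, Ideal.comap_eq_top_iff]
    intro h1
    have h2 := Ideal.comap_map_of_bijective φ hφ (I := I)
    rw [h1, Ideal.comap_top] at h2
    exact hI h2.symm
  obtain ⟨m, hm, hle⟩ := Ideal.exists_le_maximal _ hI'
  let y : PrimeSpectrum R := ⟨m, hm.isPrime⟩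
  have hy : j.base y ∈ V := (hV _).2 ⟨y, rfl⟩
  refine ⟨j.base y, hy, fun g hg => ?_⟩
  obtain ⟨r, hr⟩ := exists_specSec_eq_pull j hV g
  refine (ev_eq_zero_iff_of_pull_eq j g r hr y hy).2 (hle ?_)
  rw [Ideal.mem_comap, ← hr]
  exact Ideal.mem_map_of_mem φ hg

end AlgebraicGeometry.LocallyRingedSpace

end

/-! ### Good opens and finite good coverings -/

noncomputable section

namespace AlgebraicGeometry.LocallyRingedSpace

variable {X : LocallyRingedSpace.{u}} {V D D' : Opens X.toTopCat}

/-- `D` is a basic open subset of a noetherian formal chart and its ring of sections is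
noetherian. -/
def IsGood (D : Opens X.toTopCat) : Prop :=
  IsNoetherianRing (X.Sec D) ∧ ∃ (W : Opens X.toTopCat) (A : Type u) (_ : CommRing A) (I : Ideal A)
    (C : FormalChart X W A I) (a : A), IsNoetherianRing A ∧ C.IsBasic D a

theorem IsGood.isAdicComplete (h : IsGood D) : IsAdicComplete (X.vanishing D) (X.Sec D) := by
  obtain ⟨_, W, A, _, I, C, a, _, ha⟩ := h
  exact ha.isAdicComplete

theorem IsGood.exists_lift (h : IsGood D) (f : X.reductionSections D) :
    ∃ s : X.Sec D, ∀ x (hx : x ∈ D), X.ev x hx s = f.1 ⟨x, hx⟩ := by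
  obtain ⟨_, W, A, _, I, C, a, _, ha⟩ := h
  exact ha.exists_lift f

theorem IsGood.isAdicLocalization (h : IsGood D) (hD : D' ≤ D) (f : X.Sec D)
    (hf : ∀ x (hx : x ∈ D), x ∈ D' ↔ X.ev x hx f ≠ 0) :
    IsAdicLocalization (X.res hD) f (X.vanishing D) (X.vanishing D') := by
  obtain ⟨_, W, A, _, I, C, a, _, ha⟩ := h
  exact ha.isAdicLocalization hD f hf

/-- Restriction of the sections of the reduction. -/
def redRes (h : D' ≤ D) (f : X.reductionSections D) : X.reductionSections D' :=
  (X.reductionPresheaf.map (homOfLE h).op).hom f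

theorem redRes_apply (h : D' ≤ D) (f : X.reductionSections D) (x : X) (hx : x ∈ D') :
    (redRes h f).1 ⟨x, hx⟩ = f.1 ⟨x, h hx⟩ := rfl

/-- Principal opens of V and basic opens of a chart are reconciled here: g lifts to a section over
D, and a nonvanishing locus of such a section is basic in the chart. -/
theorem FormalChart.IsBasic.exists_of_redNonvanishing_le {W : Opens X.toTopCat} {A : Type u}
    [CommRing A] [IsNoetherianRing A] {I : Ideal A} {C : FormalChart X W A I} {a : A}
    (h : C.IsBasic D a) (g : X.reductionSections V) (hg : redNonvanishing g ≤ D) (hD : D ≤ V) :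
    ∃ b, C.IsBasic (redNonvanishing g) b := by
  obtain ⟨s, hs⟩ := h.exists_lift (redRes hD g)
  obtain ⟨e, c, hc⟩ := h.approx 0 s
  refine ⟨a * c, h.mul hg s (fun x hx => ?_) (e := e) (map_le_vanishing h
    (by simpa using hc))⟩
  rw [hs, redRes_apply, mem_redNonvanishing]
  exact ⟨fun h => h.2, fun h => ⟨hD hx, h⟩⟩

theorem exists_isGood (hX : IsLocallyNoetherianFormalScheme X)
    (hN : ∀ U : Opens X, IsAffineOpenSubspace X.reduction U → IsNoetherianRing (X.Sec U))
    (hV : IsAffineOpenSubspace X.reduction V) (N : Opens X.toTopCat) (x : X) (hx : x ∈ V)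
    (hxN : x ∈ N) : ∃ g : X.reductionSections V, x ∈ redNonvanishing g ∧ redNonvanishing g ≤ N ∧
      IsGood (redNonvanishing g) := by
  obtain ⟨W, hxW, A, _, I, hA, _, ⟨e⟩⟩ := hX x
  let C := FormalChart.ofIso e
  obtain ⟨a, D, ha, hxD, hD⟩ := FormalChart.exists_isBasic C (V ⊓ N) x hxW ⟨hx, hxN⟩
  obtain ⟨g, hxg, hg⟩ := exists_mem_redNonvanishing hV D x hx hxD
  obtain ⟨b, hb⟩ := ha.exists_of_redNonvanishing_le g hg (hD.trans inf_le_left)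
  exact ⟨g, hxg, hg.trans (hD.trans inf_le_right),
    hN _ (isAffineOpenSubspace_redNonvanishing hV g), W, A, _, I, C, b, hA, hb⟩

theorem redNonvanishing_mul (g h : X.reductionSections V) :
    redNonvanishing (g * h) = redNonvanishing g ⊓ redNonvanishing h := by
  ext x
  refine (mem_redNonvanishing _ x).trans (Iff.trans ?_ (and_congr (mem_redNonvanishing _ x).symm
    (mem_redNonvanishing _ x).symm))
  have (hx : x ∈ V) : (g * h).1 ⟨x, hx⟩ = g.1 ⟨x, hx⟩ * h.1 ⟨x, hx⟩ := rfl
  simp only [this, mul_ne_zero_iff]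
  exact ⟨fun ⟨hx, h1, h2⟩ => ⟨⟨hx, h1⟩, hx, h2⟩, fun ⟨⟨hx, h1⟩, _, h2⟩ => ⟨hx, h1, h2⟩⟩

theorem IsGood.inf
    (hN : ∀ U : Opens X, IsAffineOpenSubspace X.reduction U → IsNoetherianRing (X.Sec U))
    (hV : IsAffineOpenSubspace X.reduction V) {g : X.reductionSections V}
    (hg : IsGood (redNonvanishing g)) (h : X.reductionSections V) :
    IsGood (redNonvanishing g ⊓ redNonvanishing h) := by
  obtain ⟨_, W, A, _, I, C, a, hA, ha⟩ := hg
  rw [← redNonvanishing_mul]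
  have hle : redNonvanishing (g * h) ≤ redNonvanishing g :=
    (redNonvanishing_mul g h).le.trans inf_le_left
  obtain ⟨b, hb⟩ := ha.exists_of_redNonvanishing_le (g * h) hle (redNonvanishing_le g)
  exact ⟨hN _ (isAffineOpenSubspace_redNonvanishing hV _), W, A, _, I, C, b, hA, hb⟩

theorem mul_mem_vanishing_pow_succ {n : ℕ} {s t : X.Sec D} (hs : s ∈ X.vanishing D)
    (ht : t ∈ X.vanishing D ^ n) : s * t ∈ X.vanishing D ^ (n + 1) := by
  rw [pow_succ']
  exact Ideal.mul_mem_mul hs ht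

/-- A finite covering of `V` by good open sets that are given by sections of the reduction. -/
structure GoodCover (V : Opens X.toTopCat) (ι : Type u) [Fintype ι] where
  g : ι → X.reductionSections V
  h : ι → X.reductionSections V
  sum_eq : ∑ k, h k * g k = 1
  good : ∀ k, IsGood (redNonvanishing (g k))
  good_inf : ∀ k l, IsGood (redNonvanishing (g k) ⊓ redNonvanishing (g l))

/-- The sections g with good nonvanishing locus have no common zero, so finitely many generate the
unit ideal. A prescribed `g₀` is inserted, so that any given good open may be taken as a member. -/
theorem exists_goodCover (hX : IsLocallyNoetherianFormalScheme X)
    (hN : ∀ U : Opens X, IsAffineOpenSubspace X.reduction U → IsNoetherianRing (X.Sec U))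
    (hV : IsAffineOpenSubspace X.reduction V) (g₀ : X.reductionSections V)
    (hg₀ : IsGood (redNonvanishing g₀)) :
    ∃ (ι : Type u) (_ : Fintype ι) (c : GoodCover V ι) (k : ι), c.g k = g₀ := by
  classical
  let S : Set (X.reductionSections V) := {g | IsGood (redNonvanishing g)}
  have hS : Ideal.span S = ⊤ := by
    by_contra hne
    obtain ⟨x, hx, h0⟩ := exists_forall_mem_eq_zero hV _ hne
    obtain ⟨g, hxg, -, hg⟩ := exists_isGood hX hN hV V x hx hx
    exact ((mem_redNonvanishing g x).1 hxg).2 (h0 g (Ideal.subset_span hg))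
  have h1 : (1 : X.reductionSections V) ∈ Ideal.span S := by rw [hS]; trivial
  obtain ⟨T, hTS, hT⟩ := Submodule.mem_span_finite_of_mem_span h1
  let T' : Finset (X.reductionSections V) := insert g₀ T
  have hT' : (1 : X.reductionSections V) ∈ Ideal.span (T' : Set (X.reductionSections V)) :=
    Ideal.span_mono (by simp [T']) hT
  obtain ⟨f, -, hf⟩ := Submodule.mem_span_finset.1 hT'
  refine ⟨T', inferInstance, ⟨fun k => k.1, fun k => f k, ?_, ?_, ?_⟩, ⟨g₀, by simp [T']⟩, rfl⟩
  · rw [← hf]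
    exact Finset.sum_coe_sort T' fun k => f k * k
  · rintro ⟨k, hk⟩
    rcases Finset.mem_insert.1 hk with rfl | hk
    · exact hg₀
    · exact hTS hk
  · rintro ⟨k, hk⟩ l
    refine IsGood.inf hN hV ?_ _
    rcases Finset.mem_insert.1 hk with rfl | hk
    · exact hg₀
    · exact hTS hk

end AlgebraicGeometry.LocallyRingedSpace

end

/-! ### Correction of sections modulo powers of J on a good covering -/

noncomputable section

namespace AlgebraicGeometry.LocallyRingedSpace.GoodCover

variable {X : LocallyRingedSpace.{u}} {V : Opens X.toTopCat} {ι : Type u} [Fintype ι]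
  (c : GoodCover V ι)

/-- The members of the covering. -/
def D (k : ι) : Opens X.toTopCat := redNonvanishing (c.g k)

theorem D_le (k : ι) : c.D k ≤ V := redNonvanishing_le _

theorem mem_D (k : ι) (x : X) (hx : x ∈ V) : x ∈ c.D k ↔ (c.g k).1 ⟨x, hx⟩ ≠ 0 :=
  (mem_redNonvanishing _ x).trans ⟨fun h => h.2, fun h => ⟨hx, h⟩⟩

theorem good_D (k : ι) : IsGood (c.D k) := c.good k

theorem good_D_inf (k l : ι) : IsGood (c.D k ⊓ c.D l) := c.good_inf k l

theorem exists_partition (E : ℕ) : ∃ p : ι → X.reductionSections V, ∑ k, p k * c.g k ^ E = 1 := by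
  have h1 : Ideal.span (Set.range c.g) = ⊤ := by
    rw [Ideal.eq_top_iff_one, ← c.sum_eq]
    exact Ideal.sum_mem _ fun k _ => Ideal.mul_mem_left _ _ (Ideal.subset_span ⟨k, rfl⟩)
  have h2 := Ideal.span_pow_eq_top _ h1 E
  rw [← Set.range_comp] at h2
  have h3 : (1 : X.reductionSections V) ∈ Ideal.span (Set.range ((fun x => x ^ E) ∘ c.g)) := by
    rw [h2]; trivial
  obtain ⟨p, hp⟩ := Ideal.mem_span_range_iff_exists_fun.1 h3
  exact ⟨p, hp⟩

theorem exists_mem_D (x : X) (hx : x ∈ V) : ∃ k, x ∈ c.D k := by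
  by_contra hne
  simp only [not_exists, c.mem_D _ x hx, not_not] at hne
  have h := congrFun (congrArg Subtype.val c.sum_eq) ⟨x, hx⟩
  have h2 : (∑ k, c.h k * c.g k).1 ⟨x, hx⟩ = ∑ k, (c.h k).1 ⟨x, hx⟩ * (c.g k).1 ⟨x, hx⟩ := by
    rw [AddSubmonoidClass.coe_finsetSum, Finset.sum_apply]
    rfl
  rw [h2] at h
  simp only [hne, mul_zero, Finset.sum_const_zero] at h
  exact zero_ne_one (α := X.residueField x) h

theorem exists_lift (k : ι) (f : X.reductionSections V) :
    ∃ s : X.Sec (c.D k), ∀ x (hx : x ∈ c.D k), X.ev x hx s = f.1 ⟨x, c.D_le k hx⟩ :=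
  (c.good_D k).exists_lift (redRes (c.D_le k) f)

theorem sum_apply_eq {E : ℕ} {p : ι → X.reductionSections V} (hp : ∑ k, p k * c.g k ^ E = 1)
    (x : X) (hx : x ∈ V) : ∑ k, (p k).1 ⟨x, hx⟩ * (c.g k).1 ⟨x, hx⟩ ^ E = 1 := by
  have h := congrFun (congrArg Subtype.val hp) ⟨x, hx⟩
  have h2 : (∑ k, p k * c.g k ^ E).1 ⟨x, hx⟩ = ∑ k, (p k).1 ⟨x, hx⟩ * (c.g k).1 ⟨x, hx⟩ ^ E := by
    rw [AddSubmonoidClass.coe_finsetSum, Finset.sum_apply]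
    rfl
  rw [h2] at h
  exact h

theorem isAdicLocalization {O : Opens X.toTopCat} (hO : IsGood O) (hOV : O ≤ V) (m : ι)
    {O' : Opens X.toTopCat} (hO' : O' = O ⊓ c.D m) (s : X.Sec O)
    (hs : ∀ x (hx : x ∈ O), X.ev x hx s = (c.g m).1 ⟨x, hOV hx⟩) :
    IsAdicLocalization (X.res (hO'.le.trans inf_le_left)) s (X.vanishing O) (X.vanishing O') := by
  subst hO'
  refine hO.isAdicLocalization _ s fun x hx => ?_
  rw [hs, ← c.mem_D m x (hOV hx)]
  exact ⟨fun h => h.2, fun h => ⟨hx, h⟩⟩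

/-- A family of sections over the members of the covering that agree modulo `J^n`. -/
def Compat (n : ℕ) (a : ∀ k, X.Sec (c.D k)) : Prop :=
  ∀ k l, X.res (inf_le_left : c.D k ⊓ c.D l ≤ c.D k) (a k) -
    X.res (inf_le_right : c.D k ⊓ c.D l ≤ c.D l) (a l) ∈ X.vanishing (c.D k ⊓ c.D l) ^ n

variable {c}

/-- The difference of `a k` and `a m` is a section of J^n over the overlap, which modulo J^(n+1) is
a localization of D k at g m. A power of g m clears the denominator, and a second power brings the
extension into J^n. Finiteness of the covering makes the exponent uniform. -/
theorem Compat.exists_extension {n : ℕ} {a : ∀ k, X.Sec (c.D k)} (ha : c.Compat n a)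
    (γ : ∀ k (_ : ι), X.Sec (c.D k))
    (hγ : ∀ k l x (hx : x ∈ c.D k), X.ev x hx (γ k l) = (c.g l).1 ⟨x, c.D_le k hx⟩) :
    ∃ (E : ℕ) (t : ∀ k (_ : ι), X.Sec (c.D k)), ∀ k m, t k m ∈ X.vanishing (c.D k) ^ n ∧
      X.res (inf_le_left : c.D k ⊓ c.D m ≤ c.D k) (γ k m) ^ E *
        (X.res (inf_le_left : c.D k ⊓ c.D m ≤ c.D k) (a k) -
          X.res (inf_le_right : c.D k ⊓ c.D m ≤ c.D m) (a m)) -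
        X.res (inf_le_left : c.D k ⊓ c.D m ≤ c.D k) (t k m) ∈
        X.vanishing (c.D k ⊓ c.D m) ^ (n + 1) := by
  have h1 : ∀ k m, ∃ (e : ℕ) (t : X.Sec (c.D k)), t ∈ X.vanishing (c.D k) ^ n ∧
      X.res (inf_le_left : c.D k ⊓ c.D m ≤ c.D k) (γ k m) ^ e *
        (X.res (inf_le_left : c.D k ⊓ c.D m ≤ c.D k) (a k) -
          X.res (inf_le_right : c.D k ⊓ c.D m ≤ c.D m) (a m)) -
        X.res (inf_le_left : c.D k ⊓ c.D m ≤ c.D k) t ∈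
        X.vanishing (c.D k ⊓ c.D m) ^ (n + 1) := by
    intro k m
    have hloc := c.isAdicLocalization (c.good_D k) (c.D_le k) m rfl (γ k m) (hγ k m)
    have hd := ha k m
    generalize X.res (inf_le_left : c.D k ⊓ c.D m ≤ c.D k) (a k) -
          X.res (inf_le_right : c.D k ⊓ c.D m ≤ c.D m) (a m) = d at hd ⊢
    obtain ⟨e, t, ht⟩ := hloc.surj (n + 1) d
    have ht' : X.res (inf_le_left : c.D k ⊓ c.D m ≤ c.D k) t ∈
        X.vanishing (c.D k ⊓ c.D m) ^ n := by
      have h2 := Ideal.mul_mem_left (X.vanishing (c.D k ⊓ c.D m) ^ n)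
        (X.res (inf_le_left : c.D k ⊓ c.D m ≤ c.D k) (γ k m) ^ e) hd
      have h3 := Ideal.sub_mem _ h2 (Ideal.pow_le_pow_right (Nat.le_succ n) ht)
      rwa [sub_sub_cancel] at h3
    obtain ⟨e', he'⟩ := hloc.inj n t ht'
    refine ⟨e' + e, γ k m ^ e' * t, he', ?_⟩
    have h4 := Ideal.mul_mem_left _
      (X.res (inf_le_left : c.D k ⊓ c.D m ≤ c.D k) (γ k m) ^ e') ht
    rw [mul_sub, ← mul_assoc, ← pow_add] at h4
    rwa [map_mul, map_pow]
  choose e t ht h using h1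
  refine ⟨∑ k, ∑ m, e k m, fun k m => γ k m ^ (∑ k, ∑ m, e k m - e k m) * t k m, fun k m =>
    ⟨Ideal.mul_mem_left _ _ (ht k m), ?_⟩⟩
  have hle : e k m ≤ ∑ k, ∑ m, e k m :=
    (Finset.single_le_sum (f := fun m => e k m) (fun _ _ => Nat.zero_le _)
      (Finset.mem_univ m)).trans (Finset.single_le_sum (f := fun k => ∑ m, e k m)
        (fun _ _ => Nat.zero_le _) (Finset.mem_univ k))
  have h5 := Ideal.mul_mem_left _ (X.res (inf_le_left : c.D k ⊓ c.D m ≤ c.D k) (γ k m) ^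
    (∑ k, ∑ m, e k m - e k m)) (h k m)
  rw [mul_sub, ← mul_assoc, pow_sub_mul_pow _ hle] at h5
  rwa [map_mul, map_pow]

/-- This is the vanishing of H¹ for J^n/J^(n+1), in cochains. After multiplication by a power of g m
one has t k m − t l m ≡ (g m)^E₁ (a k − a l), so summing against a partition of unity makes the
difference a coboundary, which is subtracted. -/
theorem Compat.exists_improvement {n : ℕ} {a : ∀ k, X.Sec (c.D k)} (ha : c.Compat n a) :
    ∃ a' : ∀ k, X.Sec (c.D k), c.Compat (n + 1) a' ∧
      ∀ k, a' k - a k ∈ X.vanishing (c.D k) ^ n := by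
  choose γ hγ using fun k l => c.exists_lift k (c.g l)
  obtain ⟨E₁, t, ht⟩ := ha.exists_extension γ hγ
  have h1 : ∀ k l m, ∃ e : ℕ, X.res (inf_le_left : c.D k ⊓ c.D l ≤ c.D k) (γ k m) ^ e *
      (X.res (inf_le_left : c.D k ⊓ c.D l ≤ c.D k) (t k m) -
        X.res (inf_le_right : c.D k ⊓ c.D l ≤ c.D l) (t l m) -
        X.res (inf_le_left : c.D k ⊓ c.D l ≤ c.D k) (γ k m) ^ E₁ *
          (X.res (inf_le_left : c.D k ⊓ c.D l ≤ c.D k) (a k) -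
          X.res (inf_le_right : c.D k ⊓ c.D l ≤ c.D l) (a l))) ∈
        X.vanishing (c.D k ⊓ c.D l) ^ (n + 1) := by
    intro k l m
    have hloc := c.isAdicLocalization (c.good_D_inf k l) (inf_le_left.trans (c.D_le k)) m rfl
      (X.res (inf_le_left : c.D k ⊓ c.D l ≤ c.D k) (γ k m)) (fun x hx => by rw [ev_res, hγ])
    apply hloc.inj
    have hkm : c.D k ⊓ c.D l ⊓ c.D m ≤ c.D k ⊓ c.D m := inf_le_inf_right _ inf_le_left
    have hlm : c.D k ⊓ c.D l ⊓ c.D m ≤ c.D l ⊓ c.D m := inf_le_inf_right _ inf_le_right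
    have g1 := X.vanishing_le_map_res hkm _ (ht k m).2
    have g2 := X.vanishing_le_map_res hlm _ (ht l m).2
    have g3 := X.vanishing_le_map_res hlm _ (ha l m)
    -- `γ k m` and `γ l m` are different lifts of g m and agree only modulo J; multiplied by a
    -- difference in J^n, the error falls into J^(n+1).
    have g4 : X.res (hkm.trans inf_le_left) (γ k m) ^ E₁ -
        X.res (hlm.trans inf_le_left) (γ l m) ^ E₁ ∈ X.vanishing (c.D k ⊓ c.D l ⊓ c.D m) := by
      intro x hx
      rw [map_sub, map_pow, map_pow, ev_res, ev_res, hγ, hγ, sub_self]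
    have g5 := mul_mem_vanishing_pow_succ g4 g3
    have g6 := Ideal.add_mem _ (Ideal.sub_mem _ g2 g1) g5
    convert g6 using 1
    simp only [map_sub, map_mul, map_pow, res_res]
    ring
  choose e he using h1
  let E₂ := ∑ k, ∑ l, ∑ m, e k l m
  have hle : ∀ k l m, e k l m ≤ E₂ := fun k l m =>
    (Finset.single_le_sum (f := fun m => e k l m) (fun _ _ => Nat.zero_le _)
      (Finset.mem_univ m)).trans <| (Finset.single_le_sum (f := fun l => ∑ m, e k l m)
        (fun _ _ => Nat.zero_le _) (Finset.mem_univ l)).trans <|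
      Finset.single_le_sum (f := fun k => ∑ l, ∑ m, e k l m)
        (fun _ _ => Nat.zero_le _) (Finset.mem_univ k)
  -- E₁ is the power used to extend the differences, E₂ the power that makes the extensions satisfy
  -- the cocycle relation.
  obtain ⟨p, hp⟩ := c.exists_partition (E₂ + E₁)
  choose η hη using fun k m => c.exists_lift k (p m)
  refine ⟨fun k => a k - ∑ m, η k m * (γ k m ^ E₂ * t k m), fun k l => ?_, fun k => ?_⟩
  · have g1 : 1 - ∑ m, X.res (inf_le_left : c.D k ⊓ c.D l ≤ c.D k) (η k m) *
        X.res (inf_le_left : c.D k ⊓ c.D l ≤ c.D k) (γ k m) ^ (E₂ + E₁) ∈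
        X.vanishing (c.D k ⊓ c.D l) := by
      intro x hx
      simp only [map_sub, map_one, map_sum, map_mul, map_pow, ev_res, hγ, hη]
      rw [sub_eq_zero]
      exact (c.sum_apply_eq hp x _).symm
    have g2 := mul_mem_vanishing_pow_succ g1 (ha k l)
    have g3 : ∀ m, X.res (inf_le_left : c.D k ⊓ c.D l ≤ c.D k) (η k m) *
        (X.res (inf_le_left : c.D k ⊓ c.D l ≤ c.D k) (γ k m) ^ E₂ *
      (X.res (inf_le_left : c.D k ⊓ c.D l ≤ c.D k) (t k m) -
        X.res (inf_le_right : c.D k ⊓ c.D l ≤ c.D l) (t l m) -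
        X.res (inf_le_left : c.D k ⊓ c.D l ≤ c.D k) (γ k m) ^ E₁ *
          (X.res (inf_le_left : c.D k ⊓ c.D l ≤ c.D k) (a k) -
          X.res (inf_le_right : c.D k ⊓ c.D l ≤ c.D l) (a l)))) ∈
        X.vanishing (c.D k ⊓ c.D l) ^ (n + 1) := fun m => by
      refine Ideal.mul_mem_left _ _ ?_
      rw [← pow_sub_mul_pow _ (hle k l m), mul_assoc]
      exact Ideal.mul_mem_left _ _ (he k l m)
    have g4 : ∀ m, (X.res (inf_le_left : c.D k ⊓ c.D l ≤ c.D k) (η k m) *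
        X.res (inf_le_left : c.D k ⊓ c.D l ≤ c.D k) (γ k m) ^ E₂ -
        X.res (inf_le_right : c.D k ⊓ c.D l ≤ c.D l) (η l m) *
        X.res (inf_le_right : c.D k ⊓ c.D l ≤ c.D l) (γ l m) ^ E₂) *
        X.res (inf_le_right : c.D k ⊓ c.D l ≤ c.D l) (t l m) ∈
        X.vanishing (c.D k ⊓ c.D l) ^ (n + 1) := fun m => by
      refine mul_mem_vanishing_pow_succ (fun x hx => ?_) (X.vanishing_le_map_res _ _ (ht l m).1)
      simp only [map_sub, map_mul, map_pow, ev_res, hγ, hη, sub_self]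
    have g5 := Ideal.sub_mem _ g2 (Ideal.sum_mem _ fun m (_ : m ∈ Finset.univ) =>
      Ideal.add_mem _ (g3 m) (g4 m))
    convert g5 using 1
    simp only [map_sub, map_mul, map_pow, map_sum, sub_mul, one_mul, Finset.sum_mul,
      Finset.sum_add_distrib, Finset.sum_sub_distrib, mul_sub, pow_add, mul_assoc]
    ring
  · rw [sub_sub_cancel_left, neg_mem_iff]
    exact Ideal.sum_mem _ fun m _ => Ideal.mul_mem_left _ _ (Ideal.mul_mem_left _ _ (ht k m).1)

theorem exists_glue_of_forall_mem (b : ∀ k, X.Sec (c.D k)) (hb : ∀ i, c.Compat i b) :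
    ∃ s : X.Sec V, ∀ k, X.res (c.D_le k) s = b k := by
  refine X.exists_glue c.D c.D_le c.exists_mem_D b fun k l => ?_
  rw [← sub_eq_zero]
  exact (c.good_D_inf k l).isAdicComplete.eq_zero _ fun i => hb i k l

theorem Compat.congr {n : ℕ} {a b : ∀ k, X.Sec (c.D k)} (ha : c.Compat n a)
    (h : ∀ k, b k - a k ∈ X.vanishing (c.D k) ^ n) : c.Compat n b := fun k l => by
  have h1 := X.vanishing_le_map_res (inf_le_left : c.D k ⊓ c.D l ≤ c.D k) _ (h k)
  have h2 := X.vanishing_le_map_res (inf_le_right : c.D k ⊓ c.D l ≤ c.D l) _ (h l)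
  have h3 := Ideal.add_mem _ (Ideal.sub_mem _ h1 h2) (ha k l)
  convert h3 using 1
  simp only [map_sub]
  ring

theorem Compat.mono {m n : ℕ} (hmn : m ≤ n) {a : ∀ k, X.Sec (c.D k)} (ha : c.Compat n a) :
    c.Compat m a := fun k l => Ideal.pow_le_pow_right hmn (ha k l)

/-- Successive corrections converge in the complete rings over the D k. The limits agree modulo
every power of J on the overlaps, whose rings are separated, and so glue. -/
theorem Compat.exists_section {n : ℕ} {a : ∀ k, X.Sec (c.D k)} (ha : c.Compat n a) :
    ∃ s : X.Sec V, ∀ k, X.res (c.D_le k) s - a k ∈ X.vanishing (c.D k) ^ n := by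
  choose F hF hF' using fun (n : ℕ) (a : {a // c.Compat n a}) => a.2.exists_improvement
  let f : ∀ i : ℕ, {a // c.Compat (n + i) a} := fun i =>
    Nat.rec ⟨a, ha⟩ (fun i b => ⟨F (n + i) b, hF (n + i) b⟩) i
  have hf : ∀ i k, (f (i + 1)).1 k - (f i).1 k ∈ X.vanishing (c.D k) ^ (n + i) := fun i k =>
    hF' (n + i) (f i) k
  choose b hb using fun k => (c.good_D k).isAdicComplete.exists_limit (fun i => (f i).1 k)
    fun i => Ideal.pow_le_pow_right (Nat.le_add_left _ _) (hf i k)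
  obtain ⟨s, hs⟩ := exists_glue_of_forall_mem b fun i =>
    ((f i).2.mono (Nat.le_add_left _ _)).congr fun k => hb k i
  refine ⟨s, fun k => ?_⟩
  have h1 : ∀ i, (f i).1 k - a k ∈ X.vanishing (c.D k) ^ n := by
    intro i
    induction i with
    | zero => rw [show (f 0).1 k = a k from rfl, sub_self]; exact zero_mem _
    | succ i ih =>
      rw [← sub_add_sub_cancel _ ((f i).1 k)]
      exact Ideal.add_mem _ (Ideal.pow_le_pow_right (Nat.le_add_right _ _) (hf i k)) ih
  rw [hs, ← sub_add_sub_cancel _ ((f n).1 k)]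
  exact Ideal.add_mem _ (hb k n) (h1 n)

end AlgebraicGeometry.LocallyRingedSpace.GoodCover

end

/-! ### The ring of sections over an affine open of the reduction -/

noncomputable section

namespace AlgebraicGeometry.LocallyRingedSpace

variable {X : LocallyRingedSpace.{u}} {V : Opens X.toTopCat} {ι : Type u} [Fintype ι]

namespace GoodCover

/-- Local lifts of f agree modulo J on overlaps, so the correction procedure applies with n = 1. -/
theorem exists_section_lift (c : GoodCover V ι) (f : X.reductionSections V) :
    ∃ s : X.Sec V, ∀ x (hx : x ∈ V), X.ev x hx s = f.1 ⟨x, hx⟩ := by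
  choose a ha using fun k => c.exists_lift k f
  have hc : c.Compat 1 a := fun k l => by
    rw [pow_one]
    intro x hx
    rw [map_sub, ev_res, ev_res, ha, ha, sub_self]
  obtain ⟨s, hs⟩ := hc.exists_section
  refine ⟨s, fun x hx => ?_⟩
  obtain ⟨k, hk⟩ := c.exists_mem_D x hx
  have h := hs k
  rw [pow_one] at h
  have h2 := h x hk
  rwa [map_sub, ev_res, ha, sub_eq_zero] at h2

/-- The sections over `V` whose restrictions to the members of the covering lie in `J^n`. -/
def filtration (c : GoodCover V ι) (n : ℕ) : Ideal (X.Sec V) :=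
  ⨅ k, (X.vanishing (c.D k) ^ n).comap (X.res (c.D_le k))

variable {c : GoodCover V ι}

theorem mem_filtration {n : ℕ} {s : X.Sec V} :
    s ∈ c.filtration n ↔ ∀ k, X.res (c.D_le k) s ∈ X.vanishing (c.D k) ^ n := by
  simp [filtration]

theorem isAdicLocalization_res {k : ι} {γ : X.Sec V}
    (hγ : ∀ x (hx : x ∈ V), X.ev x hx γ = (c.g k).1 ⟨x, hx⟩) (l : ι) :
    IsAdicLocalization (X.res (inf_le_left : c.D l ⊓ c.D k ≤ c.D l)) (X.res (c.D_le l) γ)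
      (X.vanishing (c.D l)) (X.vanishing (c.D l ⊓ c.D k)) :=
  c.isAdicLocalization (c.good_D l) (c.D_le l) k rfl (X.res (c.D_le l) γ)
    fun x hx => by rw [ev_res, hγ]

theorem exists_pow_mul_mem_filtration {k : ι} {γ : X.Sec V}
    (hγ : ∀ x (hx : x ∈ V), X.ev x hx γ = (c.g k).1 ⟨x, hx⟩) (n : ℕ) (s : X.Sec V)
    (hs : X.res (c.D_le k) s ∈ X.vanishing (c.D k) ^ n) : ∃ e : ℕ, γ ^ e * s ∈ c.filtration n := by
  choose e he using fun l => (isAdicLocalization_res hγ l).inj n (X.res (c.D_le l) s) (by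
    have h := X.vanishing_le_map_res (inf_le_right : c.D l ⊓ c.D k ≤ c.D k) n hs
    rw [res_res] at h ⊢
    exact h)
  refine ⟨∑ l, e l, mem_filtration.2 fun l => ?_⟩
  rw [map_mul, map_pow, ← pow_sub_mul_pow _ (Finset.single_le_sum (f := e)
    (fun _ _ => Nat.zero_le _) (Finset.mem_univ l)), mul_assoc]
  exact Ideal.mul_mem_left _ _ (he l)

/-- After multiplication by a power of γ, s extends modulo J^n to every D l. A further power makes
the extensions compatible modulo J^n, so that they come from one section over V. -/
theorem exists_pow_mul_sub_mem {k : ι} {γ : X.Sec V}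
    (hγ : ∀ x (hx : x ∈ V), X.ev x hx γ = (c.g k).1 ⟨x, hx⟩) (n : ℕ) (s : X.Sec (c.D k)) :
    ∃ (e : ℕ) (t : X.Sec V),
      X.res (c.D_le k) γ ^ e * s - X.res (c.D_le k) t ∈ X.vanishing (c.D k) ^ n := by
  have h1 : ∃ (E : ℕ) (t : ∀ l, X.Sec (c.D l)), ∀ l,
      X.res (inf_le_left.trans (c.D_le l) : c.D l ⊓ c.D k ≤ V) γ ^ E *
        X.res (inf_le_right : c.D l ⊓ c.D k ≤ c.D k) s -
        X.res (inf_le_left : c.D l ⊓ c.D k ≤ c.D l) (t l) ∈ X.vanishing (c.D l ⊓ c.D k) ^ n := by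
    choose e t ht using fun l => (isAdicLocalization_res hγ l).surj n
      (X.res (inf_le_right : c.D l ⊓ c.D k ≤ c.D k) s)
    refine ⟨∑ l, e l, fun l => X.res (c.D_le l) γ ^ (∑ l, e l - e l) * t l, fun l => ?_⟩
    have h2 := Ideal.mul_mem_left _ (X.res (inf_le_left : c.D l ⊓ c.D k ≤ c.D l)
      (X.res (c.D_le l) γ) ^ (∑ l, e l - e l)) (ht l)
    rw [mul_sub, ← mul_assoc, pow_sub_mul_pow _ (Finset.single_le_sum (f := e)
      (fun _ _ => Nat.zero_le _) (Finset.mem_univ l))] at h2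
    rw [map_mul, map_pow]
    rw [res_res] at h2 ⊢
    exact h2
  obtain ⟨E, t, ht⟩ := h1
  have h3 : ∀ l l', ∃ e : ℕ, X.res (inf_le_left.trans (c.D_le l) : c.D l ⊓ c.D l' ≤ V) γ ^ e *
      (X.res (inf_le_left : c.D l ⊓ c.D l' ≤ c.D l) (t l) -
        X.res (inf_le_right : c.D l ⊓ c.D l' ≤ c.D l') (t l')) ∈
        X.vanishing (c.D l ⊓ c.D l') ^ n := by
    intro l l'
    have hloc := c.isAdicLocalization (c.good_D_inf l l') (inf_le_left.trans (c.D_le l)) k rfl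
      (X.res (inf_le_left.trans (c.D_le l) : c.D l ⊓ c.D l' ≤ V) γ)
      (fun x hx => by rw [ev_res, hγ])
    apply hloc.inj
    have hl : c.D l ⊓ c.D l' ⊓ c.D k ≤ c.D l ⊓ c.D k := inf_le_inf_right _ inf_le_left
    have hl' : c.D l ⊓ c.D l' ⊓ c.D k ≤ c.D l' ⊓ c.D k := inf_le_inf_right _ inf_le_right
    have g1 := X.vanishing_le_map_res hl _ (ht l)
    have g2 := X.vanishing_le_map_res hl' _ (ht l')
    have g3 := Ideal.sub_mem _ g2 g1
    simp only [map_sub, map_mul, map_pow, res_res] at g3 ⊢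
    convert g3 using 1
    ring
  choose e he using h3
  let E' := ∑ l, ∑ l', e l l'
  have hle : ∀ l l', e l l' ≤ E' := fun l l' =>
    (Finset.single_le_sum (f := fun m => e l m) (fun _ _ => Nat.zero_le _)
      (Finset.mem_univ l')).trans (Finset.single_le_sum (f := fun k => ∑ m, e k m)
        (fun _ _ => Nat.zero_le _) (Finset.mem_univ l))
  have hcompat : c.Compat n fun l => X.res (c.D_le l) γ ^ E' * t l := by
    intro l l'
    have g1 := Ideal.mul_mem_left _ (X.res (inf_le_left.trans (c.D_le l) : c.D l ⊓ c.D l' ≤ V) γ ^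
      (E' - e l l')) (he l l')
    rw [← mul_assoc, pow_sub_mul_pow _ (hle l l')] at g1
    simp only [map_mul, map_pow, res_res]
    rwa [mul_sub] at g1
  obtain ⟨T, hT⟩ := hcompat.exists_section
  refine ⟨E' + E, T, ?_⟩
  -- On D k itself the extension is compared with s through the overlap of D k with itself.
  have g1 := X.vanishing_le_map_res (le_inf le_rfl le_rfl : c.D k ≤ c.D k ⊓ c.D k) _ (ht k)
  simp only [map_sub, map_mul, map_pow, res_res, res_self] at g1
  have g2 := Ideal.sub_mem _ (Ideal.mul_mem_left _ (X.res (c.D_le k) γ ^ E') g1) (hT k)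
  convert g2 using 1
  ring

/-- The counterpart over V of the approximation inside a chart: s is lifted factor by factor, and
multiplying a lift by γ, which vanishes off D k, makes it vanish on all of V. -/
theorem exists_pow_mul_sub_mem_of_mem {k : ι} {γ : X.Sec V}
    (hγ : ∀ x (hx : x ∈ V), X.ev x hx γ = (c.g k).1 ⟨x, hx⟩) (n : ℕ) (s : X.Sec (c.D k))
    (hs : s ∈ X.vanishing (c.D k) ^ n) :
    ∃ (e : ℕ) (t : X.Sec V), t ∈ X.vanishing V ^ n ∧
      X.res (c.D_le k) γ ^ e * s - X.res (c.D_le k) t ∈ X.vanishing (c.D k) ^ (n + 1) := by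
  induction n generalizing s with
  | zero =>
    obtain ⟨e, t, ht⟩ := exists_pow_mul_sub_mem hγ 1 s
    exact ⟨e, t, by simp, ht⟩
  | succ n ih =>
    rw [pow_succ] at hs
    induction hs using Submodule.mul_induction_on' with
    | mem_mul_mem s₁ hs₁ s₂ hs₂ =>
      obtain ⟨e₁, t₁, ht₁, h₁⟩ := ih s₁ hs₁
      -- Precision 2 suffices: the error is multiplied by t₁, whose restriction lies in J^n, and
      -- must end in J^(n+2).
      obtain ⟨e, t, ht⟩ := exists_pow_mul_sub_mem hγ 2 s₂
      have htv : X.res (c.D_le k) t ∈ X.vanishing (c.D k) := by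
        have h1 := Ideal.pow_le_self two_ne_zero ht
        have h2 := Ideal.sub_mem _ (Ideal.mul_mem_left _ (X.res (c.D_le k) γ ^ e) hs₂) h1
        rwa [sub_sub_cancel] at h2
      have hγt : γ * t ∈ X.vanishing V := by
        intro x hx
        rw [map_mul, hγ]
        by_cases hx' : x ∈ c.D k
        · have := htv x hx'
          rw [ev_res] at this
          rw [this, mul_zero]
        · rw [not_not.1 (mt (c.mem_D k x hx).2 hx'), zero_mul]
      refine ⟨e₁ + (e + 1), t₁ * (γ * t), ?_, ?_⟩
      · rw [pow_succ]; exact Ideal.mul_mem_mul ht₁ hγt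
      · have h2 : X.res (c.D_le k) t₁ ∈ X.vanishing (c.D k) ^ n := X.vanishing_le_map_res _ _ ht₁
        have h3 : X.res (c.D_le k) t₁ * (X.res (c.D_le k) γ ^ e * s₂ - X.res (c.D_le k) t) ∈
            X.vanishing (c.D k) ^ (n + 1 + 1) := by
          rw [add_assoc, pow_add]; exact Ideal.mul_mem_mul h2 ht
        have h4 : (X.res (c.D_le k) γ ^ e₁ * s₁ - X.res (c.D_le k) t₁) * s₂ ∈
            X.vanishing (c.D k) ^ (n + 1 + 1) := by
          rw [pow_succ]; exact Ideal.mul_mem_mul h₁ hs₂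
        have h5 := Ideal.add_mem _ (Ideal.mul_mem_left _ (X.res (c.D_le k) γ ^ (e + 1)) h4)
          (Ideal.mul_mem_left _ (X.res (c.D_le k) γ) h3)
        convert h5 using 1
        simp only [map_mul]
        ring
    | add s₁ _ s₂ _ h₁ h₂ =>
      obtain ⟨e₁, t₁, ht₁, h₁⟩ := h₁
      obtain ⟨e₂, t₂, ht₂, h₂⟩ := h₂
      refine ⟨e₁ + e₂, γ ^ e₂ * t₁ + γ ^ e₁ * t₂,
        Ideal.add_mem _ (Ideal.mul_mem_left _ _ ht₁) (Ideal.mul_mem_left _ _ ht₂), ?_⟩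
      have h5 := Ideal.add_mem _ (Ideal.mul_mem_left _ (X.res (c.D_le k) γ ^ e₂) h₁)
        (Ideal.mul_mem_left _ (X.res (c.D_le k) γ ^ e₁) h₂)
      convert h5 using 1
      simp only [map_mul, map_add, map_pow]
      ring

/-- The filtration is separated and complete because it is so on each D k. A member of stage n,
times a power of any γ k, lies in J(V)^n plus stage n+1; the γ k generate the unit ideal. The
general statement on filtrations then applies, J(V) being finitely generated. -/
theorem filtration_eq [IsNoetherianRing (X.Sec V)] (n : ℕ) :
    c.filtration n = X.vanishing V ^ n := by
  have hle : ∀ n, X.vanishing V ^ n ≤ c.filtration n := fun n s hs =>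
    mem_filtration.2 fun k => X.vanishing_le_map_res _ _ hs
  refine le_antisymm (le_pow_of_filtration (X.vanishing V) (IsNoetherian.noetherian _) c.filtration
    ?_ ?_ ?_ hle ?_ n) (hle n)
  · exact antitone_nat_of_succ_le fun n s hs =>
      mem_filtration.2 fun k => Ideal.pow_le_pow_right (Nat.le_succ n) (mem_filtration.1 hs k)
  · intro s hs
    refine X.sec_ext c.D c.D_le c.exists_mem_D s 0 fun k => ?_
    rw [map_zero]
    exact (c.good_D k).isAdicComplete.eq_zero _ fun i => mem_filtration.1 (hs i) k
  · intro s hs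
    choose b hb using fun k => (c.good_D k).isAdicComplete.exists_limit
      (fun i => X.res (c.D_le k) (s i)) fun i => by
        rw [← map_sub]; exact mem_filtration.1 (hs i) k
    have h0 : ∀ i, c.Compat i fun k => X.res (c.D_le k) (s i) := fun i k l => by
      rw [res_res, res_res, sub_self]; exact zero_mem _
    obtain ⟨t, ht⟩ := exists_glue_of_forall_mem b fun i => (h0 i).congr fun k => hb k i
    refine ⟨t, fun i => mem_filtration.2 fun k => ?_⟩
    rw [map_sub, ht]
    exact hb k i
  · intro n s hs
    choose γ hγ using fun k => c.exists_section_lift (c.g k)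
    have h1 : ∀ k, ∃ e : ℕ, γ k ^ e * s ∈ X.vanishing V ^ n ⊔ c.filtration (n + 1) := by
      intro k
      obtain ⟨e, t, ht, h⟩ := exists_pow_mul_sub_mem_of_mem (hγ k) n _ (mem_filtration.1 hs k)
      rw [← map_pow, ← map_mul, ← map_sub] at h
      obtain ⟨e', he'⟩ := exists_pow_mul_mem_filtration (hγ k) (n + 1) _ h
      refine ⟨e' + e, ?_⟩
      have : γ k ^ (e' + e) * s = γ k ^ e' * t + γ k ^ e' * (γ k ^ e * s - t) := by ring
      rw [this]
      exact Submodule.add_mem_sup (Ideal.mul_mem_left _ _ ht) he'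
    choose e he using h1
    let E := ∑ k, e k
    obtain ⟨p, hp⟩ := c.exists_partition E
    choose η hη using fun k => c.exists_section_lift (p k)
    -- Lifting a partition of unity gives a section with value 1 everywhere, a unit rather than 1
    -- itself.
    have hu : IsUnit (∑ k, η k * γ k ^ E) := by
      apply X.isUnit_of_forall_ev_ne_zero
      intro x hx
      simp only [map_sum, map_mul, map_pow, hη, hγ]
      rw [c.sum_apply_eq hp x hx]
      exact one_ne_zero
    refine (Ideal.unit_mul_mem_iff_mem _ hu).1 ?_
    rw [Finset.sum_mul]
    refine Ideal.sum_mem _ fun k _ => ?_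
    rw [mul_assoc, ← pow_sub_mul_pow _ (Finset.single_le_sum (f := e)
      (fun _ _ => Nat.zero_le _) (Finset.mem_univ k)), mul_assoc]
    exact Ideal.mul_mem_left _ _ (Ideal.mul_mem_left _ _ (he k))

end GoodCover

theorem exists_section_lift_of_isAffine (hX : IsLocallyNoetherianFormalScheme X)
    (hN : ∀ U : Opens X, IsAffineOpenSubspace X.reduction U → IsNoetherianRing (X.Sec U))
    (hV : IsAffineOpenSubspace X.reduction V) (f : X.reductionSections V) :
    ∃ s : X.Sec V, ∀ x (hx : x ∈ V), X.ev x hx s = f.1 ⟨x, hx⟩ := by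
  by_cases h : ∃ x, x ∈ V
  · obtain ⟨x, hx⟩ := h
    obtain ⟨g, -, -, hg⟩ := exists_isGood hX hN hV V x hx hx
    obtain ⟨ι, _, c, k, -⟩ := exists_goodCover hX hN hV g hg
    exact c.exists_section_lift f
  · exact ⟨0, fun x hx => (h ⟨x, hx⟩).elim⟩

theorem isAdicLocalization_of_isGood (hX : IsLocallyNoetherianFormalScheme X)
    (hN : ∀ U : Opens X, IsAffineOpenSubspace X.reduction U → IsNoetherianRing (X.Sec U))
    (hV : IsAffineOpenSubspace X.reduction V) (g : X.reductionSections V)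
    (hg : IsGood (redNonvanishing g)) (γ : X.Sec V)
    (hγ : ∀ x (hx : x ∈ V), X.ev x hx γ = g.1 ⟨x, hx⟩) :
    IsAdicLocalization (X.res (redNonvanishing_le g)) γ (X.vanishing V)
      (X.vanishing (redNonvanishing g)) := by
  obtain ⟨ι, _, c, k, rfl⟩ := exists_goodCover hX hN hV g hg
  have := hN V hV
  refine ⟨fun n s => GoodCover.exists_pow_mul_sub_mem hγ n s, fun n t ht => ?_⟩
  obtain ⟨e, he⟩ := GoodCover.exists_pow_mul_mem_filtration hγ n t ht
  exact ⟨e, (GoodCover.filtration_eq (c := c) n).le he⟩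

/-- The prime ideal of the sections that vanish at a point. -/
def pointIdeal {D : Opens X.toTopCat} (x : X) (hx : x ∈ D) : Ideal (X.Sec D) :=
  RingHom.ker (X.ev x hx)

instance {D : Opens X.toTopCat} (x : X) (hx : x ∈ D) : (pointIdeal x hx).IsPrime :=
  RingHom.ker_isPrime _

theorem comap_pointIdeal {D D' : Opens X.toTopCat} (h : D' ≤ D) (x : X) (hx : x ∈ D') :
    (pointIdeal x hx).comap (X.res h) = pointIdeal x (h hx) := by
  ext s
  rw [Ideal.mem_comap, pointIdeal, RingHom.mem_ker, ev_res]
  rfl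

theorem vanishing_le_pointIdeal {D : Opens X.toTopCat} (x : X) (hx : x ∈ D) :
    X.vanishing D ≤ pointIdeal x hx := fun _ hs => hs x hx

/-- A maximal ideal contains J, so its image in the ring of the affine scheme V is still proper and
has a common zero. -/
theorem exists_le_pointIdeal (hX : IsLocallyNoetherianFormalScheme X)
    (hN : ∀ U : Opens X, IsAffineOpenSubspace X.reduction U → IsNoetherianRing (X.Sec U))
    (hV : IsAffineOpenSubspace X.reduction V) (m : Ideal (X.Sec V)) (hm : m.IsMaximal) :
    ∃ (x : X) (hx : x ∈ V), m ≤ pointIdeal x hx := by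
  let ψ : X.Sec V →+* X.reductionSections V := (X.toReduction.app (op V)).hom
  have hψ : Function.Surjective ψ := fun f => by
    obtain ⟨s, hs⟩ := exists_section_lift_of_isAffine hX hN hV f
    exact ⟨s, Subtype.ext (funext fun x => hs x.1 x.2)⟩
  have hker : RingHom.ker ψ ≤ m := by
    have h1 : RingHom.ker ψ ≤ X.vanishing V := fun s hs x hx =>
      congrFun (congrArg Subtype.val ((RingHom.mem_ker).1 hs)) ⟨x, hx⟩
    exact h1.trans ((X.vanishing_le_jacobson V).trans ((Ideal.jacobson_mono bot_le).trans
      (Ideal.jacobson_eq_self_of_isMaximal (I := m)).le))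
  have hne : m.map ψ ≠ ⊤ := by
    intro h
    have h2 := Ideal.comap_map_of_surjective ψ hψ m
    rw [h, Ideal.comap_top] at h2
    apply hm.ne_top
    rw [h2]
    exact (sup_eq_left.2 hker).symm
  obtain ⟨x, hx, h⟩ := exists_forall_mem_eq_zero hV _ hne
  exact ⟨x, hx, fun s hs => h _ (Ideal.mem_map_of_mem ψ hs)⟩

end AlgebraicGeometry.LocallyRingedSpace

end

/-! ### Comparison of completed local rings -/

noncomputable section

section AdicIso

/-- `φ : R → R'` induces isomorphisms of all `R/m^n` with `R'/m'^n`. -/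
structure IsAdicIso {R R' : Type*} [CommRing R] [CommRing R'] (φ : R →+* R') (m : Ideal R)
    (m' : Ideal R') : Prop where
  le : m ≤ m'.comap φ
  surj : ∀ (n : ℕ) (b : R'), ∃ a : R, b - φ a ∈ m' ^ n
  inj : ∀ (n : ℕ) (a : R), φ a ∈ m' ^ n → a ∈ m ^ n

namespace IsAdicIso

variable {R R' R'' : Type*} [CommRing R] [CommRing R'] [CommRing R''] {φ : R →+* R'}
  {ψ : R' →+* R''} {m : Ideal R} {m' : Ideal R'} {m'' : Ideal R''}

theorem le_pow (hm : m ≤ m'.comap φ) (n : ℕ) : m ^ n ≤ (m' ^ n).comap φ := by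
  rw [← Ideal.map_le_iff_le_comap, Ideal.map_pow]
  exact Ideal.pow_right_mono (Ideal.map_le_iff_le_comap.2 hm) n

theorem of_comp (h : IsAdicIso (ψ.comp φ) m m'') (hψ : IsAdicIso ψ m' m'')
    (hφ : m ≤ m'.comap φ) : IsAdicIso φ m m' where
  le := hφ
  surj n b := by
    obtain ⟨a, ha⟩ := h.surj n (ψ b)
    refine ⟨a, hψ.inj n _ ?_⟩
    rwa [map_sub]
  inj n a ha := h.inj n a (le_pow hψ.le n ha)

/-- The isomorphism of `R/m^n` with `R'/m'^n`. -/
def quotientEquiv (h : IsAdicIso φ m m') (n : ℕ) : R ⧸ m ^ n ≃+* R' ⧸ m' ^ n :=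
  RingEquiv.ofBijective (Ideal.quotientMap (m' ^ n) φ (le_pow h.le n)) ⟨by
    refine Ideal.quotientMap_injective' fun a ha => h.inj n a ha, by
    intro b
    obtain ⟨b, rfl⟩ := Ideal.Quotient.mk_surjective b
    obtain ⟨a, ha⟩ := h.surj n b
    exact ⟨Ideal.Quotient.mk _ a, ((Ideal.Quotient.eq).2 ha).symm⟩⟩

theorem factorPow_quotientEquiv (h : IsAdicIso φ m m') {k n : ℕ} (hkn : k ≤ n) (x : R ⧸ m ^ n) :
    Ideal.Quotient.factorPow m' hkn (h.quotientEquiv n x) =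
      h.quotientEquiv k (Ideal.Quotient.factorPow m hkn x) := by
  obtain ⟨a, rfl⟩ := Ideal.Quotient.mk_surjective x
  rfl

theorem factorPow_evalₐ {R : Type*} [CommRing R] (m : Ideal R) {k n : ℕ} (hkn : k ≤ n)
    (x : AdicCompletion m R) :
    Ideal.Quotient.factorPow m hkn (AdicCompletion.evalₐ m n x) = AdicCompletion.evalₐ m k x := by
  obtain ⟨x, rfl⟩ := AdicCompletion.mk_surjective m R x
  rw [AdicCompletion.evalₐ_mk, AdicCompletion.evalₐ_mk]
  refine (Ideal.Quotient.eq).2 ?_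
  have := SModEq.sub_mem.1 (x.2 hkn).symm
  simpa using this

theorem factorPow_comp (h : IsAdicIso φ m m') {k n : ℕ} (hkn : k ≤ n) :
    (Ideal.Quotient.factorPow m' hkn).comp
      ((h.quotientEquiv n).toRingHom.comp (AdicCompletion.evalₐ m n).toRingHom) =
      (h.quotientEquiv k).toRingHom.comp (AdicCompletion.evalₐ m k).toRingHom :=
  RingHom.ext fun x => (h.factorPow_quotientEquiv hkn _).trans
    (congrArg (h.quotientEquiv k) (factorPow_evalₐ m hkn x))

theorem factorPow_comp_symm (h : IsAdicIso φ m m') {k n : ℕ} (hkn : k ≤ n) :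
    (Ideal.Quotient.factorPow m hkn).comp
      ((h.quotientEquiv n).symm.toRingHom.comp (AdicCompletion.evalₐ m' n).toRingHom) =
      (h.quotientEquiv k).symm.toRingHom.comp (AdicCompletion.evalₐ m' k).toRingHom :=
  RingHom.ext fun x => (h.quotientEquiv k).injective <|
    (h.factorPow_quotientEquiv hkn _).symm.trans <|
      (congrArg _ ((h.quotientEquiv n).apply_symm_apply _)).trans <|
        (factorPow_evalₐ m' hkn x).trans ((h.quotientEquiv k).apply_symm_apply _).symm

/-- The homomorphism of the completions. -/
def completionHom (h : IsAdicIso φ m m') : AdicCompletion m R →+* AdicCompletion m' R' :=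
  AdicCompletion.liftRingHom m' _ h.factorPow_comp

/-- The inverse of `completionHom`. -/
def completionInv (h : IsAdicIso φ m m') : AdicCompletion m' R' →+* AdicCompletion m R :=
  AdicCompletion.liftRingHom m _ h.factorPow_comp_symm

theorem evalₐ_completionHom (h : IsAdicIso φ m m') (n : ℕ) (x : AdicCompletion m R) :
    AdicCompletion.evalₐ m' n (h.completionHom x) =
      h.quotientEquiv n (AdicCompletion.evalₐ m n x) :=
  AdicCompletion.evalₐ_liftRingHom m' _ h.factorPow_comp n x

theorem evalₐ_completionInv (h : IsAdicIso φ m m') (n : ℕ) (x : AdicCompletion m' R') :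
    AdicCompletion.evalₐ m n (h.completionInv x) =
      (h.quotientEquiv n).symm (AdicCompletion.evalₐ m' n x) :=
  AdicCompletion.evalₐ_liftRingHom m _ h.factorPow_comp_symm n x

/-- The isomorphism of the completions. -/
def completionEquiv (h : IsAdicIso φ m m') : AdicCompletion m R ≃+* AdicCompletion m' R' :=
  RingEquiv.ofRingHom h.completionHom h.completionInv
    (RingHom.ext fun x => AdicCompletion.ext_evalₐ fun n => by
      rw [RingHom.comp_apply, evalₐ_completionHom, evalₐ_completionInv, RingEquiv.apply_symm_apply,
        RingHom.id_apply])
    (RingHom.ext fun x => AdicCompletion.ext_evalₐ fun n => by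
      rw [RingHom.comp_apply, evalₐ_completionInv, evalₐ_completionHom, RingEquiv.symm_apply_apply,
        RingHom.id_apply])

theorem completionEquiv_algebraMap (h : IsAdicIso φ m m') (a : R) :
    h.completionEquiv (algebraMap R _ a) = algebraMap R' _ (φ a) :=
  AdicCompletion.ext_evalₐ fun n => (h.evalₐ_completionHom n _).trans <|
    (congrArg (h.quotientEquiv n) ((AdicCompletion.evalₐ m n).commutes a)).trans
      ((AdicCompletion.evalₐ m' n).commutes (φ a)).symm

end IsAdicIso

variable {A A' : Type*} [CommRing A] [CommRing A'] {ρ : A →+* A'} {h : A} {J : Ideal A}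
  {J' : Ideal A'} {p : Ideal A} {p' : Ideal A'}

/-- Each factor in p' is approximated by an element of A, which lies in p because N ≠ 0 gives J'^N ≤
p'. -/
theorem IsAdicLocalization.approx_pow (H : IsAdicLocalization ρ h J J') (hJ' : J' ≤ p')
    (hp : p = p'.comap ρ) {N : ℕ} (hN : N ≠ 0) (n : ℕ) (s : A') (hs : s ∈ p' ^ n) :
    ∃ (e : ℕ) (t : A), t ∈ p ^ n ∧ ρ h ^ e * s - ρ t ∈ J' ^ N := by
  induction n generalizing s with
  | zero =>
    obtain ⟨e, t, ht⟩ := H.surj N s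
    exact ⟨e, t, by simp, ht⟩
  | succ n ih =>
    rw [pow_succ] at hs
    induction hs using Submodule.mul_induction_on' with
    | mem_mul_mem s₁ hs₁ s₂ hs₂ =>
      obtain ⟨e₁, t₁, ht₁, h₁⟩ := ih s₁ hs₁
      obtain ⟨e₂, t₂, h₂⟩ := H.surj N s₂
      have ht₂ : t₂ ∈ p := by
        rw [hp, Ideal.mem_comap]
        have h3 := Ideal.sub_mem _ (Ideal.mul_mem_left _ (ρ h ^ e₂) hs₂)
          (hJ' (Ideal.pow_le_self hN h₂))
        rwa [sub_sub_cancel] at h3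
      refine ⟨e₁ + e₂, t₁ * t₂, by rw [pow_succ]; exact Ideal.mul_mem_mul ht₁ ht₂, ?_⟩
      have h5 := Ideal.add_mem _ (Ideal.mul_mem_left _ (ρ h ^ e₂ * s₂) h₁)
        (Ideal.mul_mem_left _ (ρ t₁) h₂)
      convert h5 using 1
      rw [map_mul]
      ring
    | add s₁ _ s₂ _ h₁ h₂ =>
      obtain ⟨e₁, t₁, ht₁, h₁⟩ := h₁
      obtain ⟨e₂, t₂, ht₂, h₂⟩ := h₂
      refine ⟨e₁ + e₂, h ^ e₂ * t₁ + h ^ e₁ * t₂,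
        Ideal.add_mem _ (Ideal.mul_mem_left _ _ ht₁) (Ideal.mul_mem_left _ _ ht₂), ?_⟩
      have h5 := Ideal.add_mem _ (Ideal.mul_mem_left _ (ρ h ^ e₂) h₁)
        (Ideal.mul_mem_left _ (ρ h ^ e₁) h₂)
      convert h5 using 1
      simp only [map_mul, map_add, map_pow]
      ring

-- Modulo p'^n, which contains J'^n, numerators and denominators over A' may be replaced by elements
-- of A divided by powers of h. As h ∉ p, these are legitimate fractions in the local ring of A at
-- p.
open IsLocalRing in
theorem IsAdicLocalization.isAdicIso (H : IsAdicLocalization ρ h J J') (hJ : J ≤ p) (hJ' : J' ≤ p')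
    [p.IsPrime] [p'.IsPrime] (hp : p = p'.comap ρ) (hh : h ∉ p) :
    IsAdicIso (Localization.localRingHom p p' ρ hp) (maximalIdeal (Localization.AtPrime p))
      (maximalIdeal (Localization.AtPrime p')) := by
  have happrox : ∀ {n : ℕ}, n ≠ 0 → ∀ (u : A') (e : ℕ) (w : A), u ∉ p' →
      ρ h ^ e * u - ρ w ∈ J' ^ n → w ∉ p := by
    intro n hn u e w hu hw hwp
    rw [hp, Ideal.mem_comap] at hwp
    have h1 := Ideal.add_mem _ (hJ' (Ideal.pow_le_self hn hw)) hwp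
    rw [sub_add_cancel] at h1
    rcases Ideal.IsPrime.mem_or_mem ‹p'.IsPrime› h1 with h2 | h2
    · have h3 := Ideal.IsPrime.mem_of_pow_mem ‹p'.IsPrime› _ h2
      exact hh (hp ▸ h3)
    · exact hu h2
  constructor
  · have := Localization.isLocalHom_localRingHom p p' ρ hp
    exact ((IsLocalRing.local_hom_TFAE (Localization.localRingHom p p' ρ hp)).out 0 3).1 this
  · intro n b
    rcases eq_or_ne n 0 with rfl | hn
    · exact ⟨0, by simp⟩
    obtain ⟨s, u, rfl⟩ := IsLocalization.exists_mk'_eq p'.primeCompl b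
    obtain ⟨e₁, t, ht⟩ := H.surj n s
    obtain ⟨e₂, w, hw⟩ := H.surj n u.1
    have hwp : w ∉ p := happrox hn _ _ _ u.2 hw
    have hwh : w * h ^ e₁ ∈ p.primeCompl := 
      p.primeCompl.mul_mem hwp (p.primeCompl.pow_mem hh _)
    -- With s ≡ t/h^e₁ and u ≡ w/h^e₂ one has s/u ≡ h^e₂ t/(w h^e₁).
    refine ⟨IsLocalization.mk' _ (h ^ e₂ * t) ⟨w * h ^ e₁, hwh⟩, ?_⟩
    have hwh' : ρ (w * h ^ e₁) ∈ p'.primeCompl := fun h1 => hwh (by rw [hp]; exact h1)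
    rw [Localization.localRingHom_mk', ← IsLocalization.mk'_sub,
      ← Localization.AtPrime.map_eq_maximalIdeal, ← Ideal.map_pow,
      IsLocalization.mk'_mem_map_algebraMap_iff]
    refine ⟨1, one_mem _, Ideal.mul_mem_left _ _ (Ideal.pow_right_mono hJ' n ?_)⟩
    have h5 := Ideal.sub_mem _ (Ideal.mul_mem_left _ (ρ w) ht)
      (Ideal.mul_mem_left _ (ρ t) hw)
    convert h5 using 1
    simp only [map_mul, map_pow]
    ring
  · intro n a ha
    rcases eq_or_ne n 0 with rfl | hn
    · simp
    obtain ⟨t, s, rfl⟩ := IsLocalization.exists_mk'_eq p.primeCompl a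
    rw [Localization.localRingHom_mk', ← Localization.AtPrime.map_eq_maximalIdeal, ← Ideal.map_pow,
      IsLocalization.mk'_mem_map_algebraMap_iff] at ha
    rw [← Localization.AtPrime.map_eq_maximalIdeal, ← Ideal.map_pow,
      IsLocalization.mk'_mem_map_algebraMap_iff]
    obtain ⟨u, hu, hut⟩ := ha
    obtain ⟨e₂, w, hw⟩ := H.surj n u
    have hwp : w ∉ p := happrox hn _ _ _ hu hw
    have h1 : ρ (w * t) ∈ p' ^ n := by
      have h2 := Ideal.sub_mem _ (Ideal.mul_mem_left _ (ρ h ^ e₂) hut)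
        (Ideal.mul_mem_left _ (ρ t) (Ideal.pow_right_mono hJ' n hw))
      convert h2 using 1
      rw [map_mul]
      ring
    obtain ⟨e, t', ht', h3⟩ := H.approx_pow hJ' hp hn n _ h1
    rw [← map_pow, ← map_mul, ← map_sub] at h3
    obtain ⟨e', he'⟩ := H.inj n _ h3
    refine ⟨h ^ (e' + e) * w, p.primeCompl.mul_mem (p.primeCompl.pow_mem hh _) hwp, ?_⟩
    have h4 := Ideal.add_mem _ (Ideal.pow_right_mono hJ n he') (Ideal.mul_mem_left _ (h ^ e') ht')
    convert h4 using 1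
    ring

end AdicIso

namespace AlgebraicGeometry.LocallyRingedSpace

variable {X : LocallyRingedSpace.{u}} {V V' : Opens X.toTopCat}

/-- D is a variable with an equation, so that one open set can be presented as principal in V and,
by another section, as principal in V'. -/
theorem isAdicIso_of_isGood (hX : IsLocallyNoetherianFormalScheme X)
    (hN : ∀ U : Opens X, IsAffineOpenSubspace X.reduction U → IsNoetherianRing (X.Sec U))
    (hV : IsAffineOpenSubspace X.reduction V) {D : Opens X.toTopCat} (g : X.reductionSections V)
    (hg : IsGood D) (hD : D = redNonvanishing g) (hDV : D ≤ V) (x : X) (hx : x ∈ D) :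
    IsAdicIso (Localization.localRingHom (pointIdeal x (hDV hx)) (pointIdeal x hx) (X.res hDV)
      (comap_pointIdeal hDV x hx).symm) (IsLocalRing.maximalIdeal _)
      (IsLocalRing.maximalIdeal _) := by
  subst hD
  obtain ⟨γ, hγ⟩ := exists_section_lift_of_isAffine hX hN hV g
  refine (isAdicLocalization_of_isGood hX hN hV g hg γ hγ).isAdicIso
    (vanishing_le_pointIdeal _ _) (vanishing_le_pointIdeal _ _) _ fun h => ?_
  rw [pointIdeal, RingHom.mem_ker, hγ] at h
  exact ((mem_redNonvanishing g x).1 hx).2 h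

/-- A good open around x inside V' that is principal in V is also principal in V'. Both A_V and A_V'
have the same completed local ring at x as that open, and two out of three gives the claim. -/
theorem isAdicIso_localRingHom_res (hX : IsLocallyNoetherianFormalScheme X)
    (hN : ∀ U : Opens X, IsAffineOpenSubspace X.reduction U → IsNoetherianRing (X.Sec U))
    (hV : IsAffineOpenSubspace X.reduction V) (hV' : IsAffineOpenSubspace X.reduction V')
    (h : V' ≤ V) (x : X) (hx : x ∈ V') :
    IsAdicIso (Localization.localRingHom (pointIdeal x (h hx)) (pointIdeal x hx) (X.res h)
      (comap_pointIdeal h x hx).symm) (IsLocalRing.maximalIdeal _)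
      (IsLocalRing.maximalIdeal _) := by
  obtain ⟨g, hxg, hgV', hg⟩ := exists_isGood hX hN hV V' x (h hx) hx
  have hg' : redNonvanishing g = redNonvanishing (redRes h g) := by
    ext y
    refine (mem_redNonvanishing g y).trans (Iff.trans ?_ (mem_redNonvanishing _ y).symm)
    exact ⟨fun ⟨hy, h0⟩ => ⟨hgV' ((mem_redNonvanishing g y).2 ⟨hy, h0⟩), h0⟩,
      fun ⟨hy, h0⟩ => ⟨h hy, h0⟩⟩
  have h1 := isAdicIso_of_isGood hX hN hV g hg rfl (redNonvanishing_le g) x hxg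
  have h2 := isAdicIso_of_isGood hX hN hV' (redRes h g) hg hg' hgV' x hxg
  refine IsAdicIso.of_comp (ψ := Localization.localRingHom (pointIdeal x hx) (pointIdeal x hxg)
    (X.res hgV') (comap_pointIdeal hgV' x hxg).symm) ?_ h2 ?_
  · rw [← Localization.localRingHom_comp]
    convert h1 using 1
    congr 1
    exact RingHom.ext fun s => X.res_res _ _ s
  · have := Localization.isLocalHom_localRingHom (pointIdeal x (h hx)) (pointIdeal x hx) (X.res h)
      (comap_pointIdeal h x hx).symm
    exact ((IsLocalRing.local_hom_TFAE (Localization.localRingHom (pointIdeal x (h hx))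
      (pointIdeal x hx) (X.res h) (comap_pointIdeal h x hx).symm)).out 0 3).1 this

end AlgebraicGeometry.LocallyRingedSpace

end

/-! ### Projective dimension and change of rings -/

noncomputable section

section ProjectiveDimension

/-- The projective dimension of the module `M` is less than `n`. -/
abbrev PdLT (R : Type u) [CommRing R] (M : Type u) [AddCommGroup M] [Module R M] (n : ℕ) : Prop :=
  HasProjectiveDimensionLT (ModuleCat.of R M) n

variable {R : Type u} [CommRing R] {M N : Type u} [AddCommGroup M] [Module R M] [AddCommGroup N]
  [Module R N]

theorem pdLT_one_iff : PdLT R M 1 ↔ Module.Projective R M := by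
  rw [PdLT, ← projective_iff_hasProjectiveDimensionLT_one, IsProjective.iff_projective]

theorem PdLT.mono {m n : ℕ} (h : PdLT R M m) (hmn : m ≤ n) : PdLT R M n :=
  hasProjectiveDimensionLT_of_ge _ m n hmn

/-- Dimension shift to a first syzygy. The bounds are strict, so n+1 means dimension at most n, and
the base case is projectivity. -/
theorem pdLT_ker_iff (f : N →ₗ[R] M) (hf : Function.Surjective f) [Module.Projective R N] (n : ℕ) :
    PdLT R M (n + 2) ↔ PdLT R (LinearMap.ker f) (n + 1) :=
  (LinearMap.shortExact_shortComplexKer hf).hasProjectiveDimensionLT_X₃_iff n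
    (inferInstanceAs (Projective (ModuleCat.of R N)))

theorem PdLT.of_equiv {n : ℕ} (h : PdLT R M n) (e : M ≃ₗ[R] N) : PdLT R N n :=
  hasProjectiveDimensionLT_of_iso e.toModuleIso n

theorem PdLT.of_retract {n : ℕ} (h : PdLT R M n) (i : N →ₗ[R] M) (r : M →ₗ[R] N)
    (hri : ∀ x, r (i x) = x) : PdLT R N n :=
  Retract.hasProjectiveDimensionLT (Y := ModuleCat.of R M)
    ⟨ModuleCat.ofHom i, ModuleCat.ofHom r, by ext x; exact hri x⟩ n

/-- A change of rings that preserves the projective dimension of the modules of a class `C` -/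
theorem pdLT_baseChange_iff [IsNoetherianRing R] {S : Type u} [CommRing S] [Algebra R S]
    (C : ∀ (M : Type u) [AddCommGroup M] [Module R M], Prop)
    (hC : ∀ (M : Type u) [AddCommGroup M] [Module R M] (k : ℕ) (f : (Fin k → R) →ₗ[R] M),
      C M → C (LinearMap.ker f) ∧
        Function.Injective ((LinearMap.ker f).subtype.baseChange S))
    (hproj : ∀ (M : Type u) [AddCommGroup M] [Module R M] [Module.Finite R M],
      C M → Module.Projective S (S ⊗[R] M) → Module.Projective R M)
    (n : ℕ) (M : Type u) [AddCommGroup M] [Module R M] [Module.Finite R M] (hM : C M) :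
    PdLT R M (n + 1) ↔ PdLT S (S ⊗[R] M) (n + 1) := by
  induction n generalizing M with
  | zero =>
    rw [zero_add, pdLT_one_iff, pdLT_one_iff]
    exact ⟨fun h => inferInstance, hproj M hM⟩
  | succ n ih =>
    obtain ⟨k, f, hf⟩ := Module.Finite.exists_fin' R M
    obtain ⟨hK, hinj⟩ := hC M k f hM
    have hf' : Function.Surjective (f.baseChange S) := LinearMap.lTensor_surjective S hf
    have hex : Function.Exact ((LinearMap.ker f).subtype.baseChange S) (f.baseChange S) :=
      lTensor_exact S (LinearMap.exact_subtype_ker_map f) hf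
    -- Injectivity is all that is needed for the syzygy to commute with the change of rings.
    let e : S ⊗[R] LinearMap.ker f ≃ₗ[S] LinearMap.ker (f.baseChange S) :=
      (LinearEquiv.ofInjective _ hinj).trans (LinearEquiv.ofEq _ _ hex.linearMap_ker_eq.symm)
    rw [pdLT_ker_iff f hf, pdLT_ker_iff (f.baseChange S) hf', ih _ hK]
    exact ⟨fun h => h.of_equiv e, fun h => h.of_equiv e.symm⟩

/-- By associativity, tensoring M ⊗ f with S is tensoring f with S ⊗ M, which is flat over R;
faithful flatness removes S. -/
theorem flat_of_flat_baseChange (S : Type u) [CommRing S] [Algebra R S]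
    [Module.FaithfullyFlat R S] [Module.Flat S (S ⊗[R] M)] : Module.Flat R M := by
  have hflat : Module.Flat R (S ⊗[R] M) := Module.Flat.trans R S (S ⊗[R] M)
  rw [Module.Flat.iff_lTensor_preserves_injective_linearMap]
  intro N N' _ _ _ _ f hf
  rw [← Module.FaithfullyFlat.lTensor_injective_iff_injective R S]
  have h1 := Module.Flat.lTensor_preserves_injective_linearMap (M := S ⊗[R] M) f hf
  have h2 : LinearMap.lTensor S (LinearMap.lTensor M f) =
      (TensorProduct.assoc R S M N').toLinearMap ∘ₗ LinearMap.lTensor (S ⊗[R] M) f ∘ₗ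
        (TensorProduct.assoc R S M N).symm.toLinearMap := by
    ext; simp
  rw [h2]
  exact (TensorProduct.assoc R S M N').injective.comp
    (h1.comp (TensorProduct.assoc R S M N).symm.injective)

theorem pdLT_iff_of_faithfullyFlat [IsNoetherianRing R] {S : Type u} [CommRing S] [Algebra R S]
    [Module.FaithfullyFlat R S] (n : ℕ) (M : Type u) [AddCommGroup M] [Module R M]
    [Module.Finite R M] : PdLT R M (n + 1) ↔ PdLT S (S ⊗[R] M) (n + 1) := by
  refine pdLT_baseChange_iff (fun M _ _ => True) (fun M _ _ k f _ => ⟨trivial, ?_⟩) ?_ n M trivial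
  · exact Module.Flat.lTensor_preserves_injective_linearMap _ (Submodule.injective_subtype _)
  · intro M _ _ _ _ h
    have h1 : Module.Flat R M := flat_of_flat_baseChange S
    have := Module.finitePresentation_of_finite R M
    exact Module.Flat.projective_of_finitePresentation

theorem quotient_tensor_eq_one_tmul (I : Ideal R) (z : (R ⧸ I) ⊗[R] M) :
    ∃ m : M, z = 1 ⊗ₜ m := by
  induction z with
  | zero => exact ⟨0, by simp⟩
  | tmul a m =>
    obtain ⟨a, rfl⟩ := Ideal.Quotient.mk_surjective a
    refine ⟨a • m, ?_⟩
    rw [← TensorProduct.smul_tmul]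
    congr 1
    rw [Algebra.smul_def, mul_one]; rfl
  | add x y hx hy =>
    obtain ⟨m, rfl⟩ := hx
    obtain ⟨n, rfl⟩ := hy
    exact ⟨m + n, by rw [TensorProduct.tmul_add]⟩

theorem one_tmul_quotient_eq_zero_iff (I : Ideal R) (m : M) :
    (1 : R ⧸ I) ⊗ₜ[R] m = 0 ↔ m ∈ (I • ⊤ : Submodule R M) := by
  rw [← (TensorProduct.quotTensorEquivQuotSMul M I).map_eq_zero_iff]
  have : TensorProduct.quotTensorEquivQuotSMul M I ((1 : R ⧸ I) ⊗ₜ[R] m) =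
      Submodule.Quotient.mk m := by
    refine (TensorProduct.quotTensorEquivQuotSMul_mk_tmul I 1 m).trans ?_
    rw [one_smul]
  rw [this, Submodule.Quotient.mk_eq_zero]

/-- This is Tor₁(M, R/x) = 0: if k = x y lies in the kernel, then x f(y) = 0, hence f(y) = 0 and k ∈
x · ker f. -/
theorem injective_baseChange_subtype_ker {x : R} (f : N →ₗ[R] M) (hx : IsSMulRegular M x) :
    Function.Injective ((LinearMap.ker f).subtype.baseChange (R ⧸ Ideal.span {x})) := by
  rw [injective_iff_map_eq_zero]
  intro z hz
  obtain ⟨k, rfl⟩ := quotient_tensor_eq_one_tmul _ z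
  rw [LinearMap.baseChange_tmul, one_tmul_quotient_eq_zero_iff, Submodule.ideal_span_singleton_smul,
    Submodule.mem_smul_pointwise_iff_exists] at hz
  obtain ⟨y, -, hy⟩ := hz
  have hy' : y ∈ LinearMap.ker f := by
    rw [LinearMap.mem_ker]
    apply hx
    simp only [smul_zero]
    rw [← map_smul, hy]
    exact k.2
  rw [one_tmul_quotient_eq_zero_iff, Submodule.ideal_span_singleton_smul,
    Submodule.mem_smul_pointwise_iff_exists]
  exact ⟨⟨y, hy'⟩, trivial, Subtype.ext hy⟩

theorem eq_bot_of_le_smul [IsLocalRing R] {x : R} (hx : x ∈ IsLocalRing.maximalIdeal R)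
    (K : Submodule R M) (hK : K.FG) (h : ∀ k ∈ K, ∃ k' ∈ K, k = x • k') : K = ⊥ := by
  refine Submodule.eq_bot_of_le_smul_of_le_jacobson_bot (Ideal.span {x}) K hK (fun k hk => ?_) ?_
  · obtain ⟨k', hk', rfl⟩ := h k hk
    exact Submodule.smul_mem_smul (Ideal.mem_span_singleton_self x) hk'
  · rw [Ideal.span_singleton_le_iff_mem]
    exact IsLocalRing.maximalIdeal_le_jacobson _ hx

/-- A basis of M/xM lifts to generators of M by Nakayama. A relation among them is divisible by x,
and the quotient is again a relation since x is regular on M, so Nakayama kills the module of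
relations. -/
theorem free_of_projective_quotient_tensor [IsLocalRing R] [IsNoetherianRing R] {x : R}
    (hx : x ∈ IsLocalRing.maximalIdeal R) [Module.Finite R M] (hM : IsSMulRegular M x)
    (h : Module.Projective (R ⧸ Ideal.span {x}) ((R ⧸ Ideal.span {x}) ⊗[R] M)) :
    Module.Free R M := by
  have : Nontrivial (R ⧸ Ideal.span {x}) := Ideal.Quotient.nontrivial_iff.2 fun h => by
    rw [Ideal.span_singleton_eq_top] at h
    exact hx h
  have : IsLocalRing (R ⧸ Ideal.span {x}) :=
    IsLocalRing.of_surjective' _ Ideal.Quotient.mk_surjective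
  have : Module.Free (R ⧸ Ideal.span {x}) ((R ⧸ Ideal.span {x}) ⊗[R] M) :=
    Module.free_of_flat_of_isLocalRing
  let b := Module.Free.chooseBasis (R ⧸ Ideal.span {x}) ((R ⧸ Ideal.span {x}) ⊗[R] M)
  choose v hv using fun i => quotient_tensor_eq_one_tmul (Ideal.span {x}) (b i)
  let f : (Module.Free.ChooseBasisIndex (R ⧸ Ideal.span {x}) ((R ⧸ Ideal.span {x}) ⊗[R] M) →₀ R)
    →ₗ[R] M := Finsupp.linearCombination R v
  have hspan : Submodule.span R (Set.range v) = ⊤ := by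
    have h1 : (⊤ : Submodule R M) ≤ Submodule.span R (Set.range v) ⊔ Ideal.span {x} • ⊤ := by
      intro m _
      have h2 := b.sum_repr ((1 : R ⧸ Ideal.span {x}) ⊗ₜ[R] m)
      choose r hr using fun i => Ideal.Quotient.mk_surjective
        (b.repr ((1 : R ⧸ Ideal.span {x}) ⊗ₜ[R] m) i)
      have h3 : (1 : R ⧸ Ideal.span {x}) ⊗ₜ[R] (m - ∑ i, r i • v i) = 0 := by
        rw [TensorProduct.tmul_sub, TensorProduct.tmul_sum, sub_eq_zero, ← h2]
        refine Finset.sum_congr rfl fun i _ => ?_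
        rw [← hr, hv, TensorProduct.tmul_smul]
        rfl
      rw [one_tmul_quotient_eq_zero_iff] at h3
      rw [← sub_add_cancel m (∑ i, r i • v i), add_comm]
      exact Submodule.add_mem_sup (Submodule.sum_mem _ fun i _ => Submodule.smul_mem _ _
        (Submodule.subset_span ⟨i, rfl⟩)) h3
    refine top_le_iff.1 (Submodule.le_of_le_smul_of_le_jacobson_bot Module.Finite.fg_top ?_ h1)
    rw [Ideal.span_singleton_le_iff_mem]
    exact IsLocalRing.maximalIdeal_le_jacobson _ hx
  have hf : Function.Surjective f := by
    rw [← LinearMap.range_eq_top, Finsupp.range_linearCombination, hspan]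
  have hker : LinearMap.ker f = ⊥ := by
    refine eq_bot_of_le_smul hx _ (IsNoetherian.noetherian _) fun k hk => ?_
    have h1 : ∑ i, (Ideal.Quotient.mk (Ideal.span {x}) (k i)) • b i = 0 := by
      have h2 : (1 : R ⧸ Ideal.span {x}) ⊗ₜ[R] (f k) = 0 := by
        rw [LinearMap.mem_ker.1 hk, TensorProduct.tmul_zero]
      rw [← h2, Finsupp.linearCombination_apply, Finsupp.sum_fintype _ _ (by simp),
        TensorProduct.tmul_sum]
      refine Finset.sum_congr rfl fun i _ => ?_
      rw [hv, TensorProduct.tmul_smul]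
      rfl
    have h2 := Fintype.linearIndependent_iff.1 b.linearIndependent _ h1
    choose y hy using fun i => Ideal.mem_span_singleton'.1 (Ideal.Quotient.eq_zero_iff_mem.1 (h2 i))
    refine ⟨Finsupp.equivFunOnFinite.symm y, ?_, ?_⟩
    · rw [LinearMap.mem_ker]
      apply hM
      simp only [smul_zero]
      rw [← map_smul, ← LinearMap.mem_ker.1 hk]
      congr 1
      ext i
      simp [← hy i, mul_comm]
    · ext i
      simp [← hy i, mul_comm]
  exact Module.Free.of_equiv (LinearEquiv.ofBijective f ⟨LinearMap.ker_eq_bot.1 hker, hf⟩)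

theorem isSMulRegular_pi {x : R} (hR : IsSMulRegular R x) (ι : Type*) :
    IsSMulRegular (ι → R) x := fun a b hab => by
  ext i
  have h2 : (x • a) i = (x • b) i := by
    dsimp only at hab
    rw [hab]
  rw [Pi.smul_apply, Pi.smul_apply] at h2
  exact hR h2

theorem isSMulRegular_ker {x : R} (hR : IsSMulRegular R x) (M : Type u) [AddCommGroup M]
    [Module R M] (k : ℕ) (f : (Fin k → R) →ₗ[R] M) (hM : IsSMulRegular M x) :
    IsSMulRegular (LinearMap.ker f) x ∧
      Function.Injective ((LinearMap.ker f).subtype.baseChange (R ⧸ Ideal.span {x})) :=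
  ⟨IsSMulRegular.submodule _ _ (isSMulRegular_pi hR (Fin k)), injective_baseChange_subtype_ker f hM⟩

theorem projective_of_projective_quotient_tensor [IsLocalRing R] [IsNoetherianRing R] {x : R}
    (hx : x ∈ IsLocalRing.maximalIdeal R) (M : Type u) [AddCommGroup M] [Module R M]
    [Module.Finite R M] (hM : IsSMulRegular M x)
    (h : Module.Projective (R ⧸ Ideal.span {x}) ((R ⧸ Ideal.span {x}) ⊗[R] M)) :
    Module.Projective R M := by
  have := free_of_projective_quotient_tensor hx hM h
  infer_instance

theorem pdLT_iff_of_isSMulRegular [IsLocalRing R] [IsNoetherianRing R] {x : R}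
    (hx : x ∈ IsLocalRing.maximalIdeal R) (hR : IsSMulRegular R x) (n : ℕ) (M : Type u)
    [AddCommGroup M] [Module R M] [Module.Finite R M] (hM : IsSMulRegular M x) :
    PdLT R M (n + 1) ↔
      PdLT (R ⧸ Ideal.span {x}) ((R ⧸ Ideal.span {x}) ⊗[R] M) (n + 1) :=
  pdLT_baseChange_iff (fun M _ _ => IsSMulRegular M x) (isSMulRegular_ker hR)
    (projective_of_projective_quotient_tensor hx) n M hM

end ProjectiveDimension

end

/-! ### Regular local rings: Serre's criterion and flat descent -/

noncomputable section

section RegularLocalRing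

open IsLocalRing

variable {R : Type u} [CommRing R]

theorem isLocalRing_quotient_span_singleton [IsLocalRing R] {x : R} (hx : x ∈ maximalIdeal R) :
    IsLocalRing (R ⧸ Ideal.span {x}) := by
  have : Nontrivial (R ⧸ Ideal.span {x}) := Ideal.Quotient.nontrivial_iff.2 fun h => by
    rw [Ideal.span_singleton_eq_top] at h
    exact hx h
  exact IsLocalRing.of_surjective' _ Ideal.Quotient.mk_surjective

theorem map_maximalIdeal_quotient [IsLocalRing R] (I : Ideal R) [IsLocalRing (R ⧸ I)] :
    (maximalIdeal R).map (Ideal.Quotient.mk I) = maximalIdeal (R ⧸ I) := by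
  refine le_antisymm ?_ fun z hz => ?_
  · exact ((local_hom_TFAE (Ideal.Quotient.mk I)).out 0 2).1
      (IsLocalHom.of_surjective _ Ideal.Quotient.mk_surjective)
  · obtain ⟨a, rfl⟩ := Ideal.Quotient.mk_surjective z
    exact Ideal.mem_map_of_mem _ fun ha => hz (ha.map _)

/-- x is nonzero in m/m². Lifts of a basis of m/m² modulo the line of x, together with x, generate m
by Nakayama, and x dies in the quotient. -/
theorem spanFinrank_maximalIdeal_quotient_add_one_le [IsLocalRing R] [IsNoetherianRing R] {x : R}
    (hx : x ∈ maximalIdeal R) (hx2 : x ∉ maximalIdeal R ^ 2) [IsLocalRing (R ⧸ Ideal.span {x})] :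
    (maximalIdeal (R ⧸ Ideal.span {x})).spanFinrank + 1 ≤ (maximalIdeal R).spanFinrank := by
  let v : CotangentSpace R := (maximalIdeal R).toCotangent ⟨x, hx⟩
  have hv : v ≠ 0 := fun h => hx2 (((maximalIdeal R).toCotangent_eq_zero ⟨x, hx⟩).1 h)
  let q := CotangentSpace R ⧸ Submodule.span (ResidueField R) {v}
  have hq : Module.finrank (ResidueField R) q + 1 = (maximalIdeal R).spanFinrank := by
    rw [spanFinrank_maximalIdeal_eq_finrank_cotangentSpace,
      ← Submodule.finrank_quotient_add_finrank (Submodule.span (ResidueField R) {v}),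
      finrank_span_singleton hv]
  let b := Module.finBasis (ResidueField R) q
  have hsurj : ∀ z : q, ∃ y : maximalIdeal R,
      Submodule.Quotient.mk ((maximalIdeal R).toCotangent y) = z := fun z => by
    obtain ⟨z, rfl⟩ := Submodule.Quotient.mk_surjective _ z
    obtain ⟨y, rfl⟩ := (maximalIdeal R).toCotangent_surjective z
    exact ⟨y, rfl⟩
  choose y hy using fun i => hsurj (b i)
  have hle : maximalIdeal R ≤ Ideal.span (Set.range (fun i => (y i : R)) ∪ {x}) := by
    refine Submodule.le_of_le_smul_of_le_jacobson_bot (I := maximalIdeal R)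
      (IsNoetherian.noetherian _) (maximalIdeal_le_jacobson _) fun a ha => ?_
    have h1 := b.sum_repr (Submodule.Quotient.mk ((maximalIdeal R).toCotangent ⟨a, ha⟩))
    choose r hr using fun i => residue_surjective
      (b.repr (Submodule.Quotient.mk ((maximalIdeal R).toCotangent ⟨a, ha⟩)) i)
    have h2 : (Submodule.Quotient.mk ((maximalIdeal R).toCotangent (⟨a, ha⟩ - ∑ i, r i • y i)) :
        q) = 0 := by
      rw [map_sub, map_sum, Submodule.Quotient.mk_sub, sub_eq_zero, ← h1,
        ← Submodule.mkQ_apply _ (∑ i, _), map_sum]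
      refine Finset.sum_congr rfl fun i _ => ?_
      rw [← hr, ← hy, map_smul]
      rfl
    rw [Submodule.Quotient.mk_eq_zero, Submodule.mem_span_singleton] at h2
    obtain ⟨c, hc⟩ := h2
    obtain ⟨c, rfl⟩ := residue_surjective c
    have h3 : (maximalIdeal R).toCotangent ((⟨a, ha⟩ - ∑ i, r i • y i) - c • ⟨x, hx⟩) = 0 := by
      rw [map_sub, ← hc, map_smul, sub_eq_zero]
      rfl
    rw [Ideal.toCotangent_eq_zero] at h3
    have h4 : a = ((∑ i, r i * y i) + c * x) + (a - (∑ i, r i * y i) - c * x) := by ring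
    rw [h4]
    refine Submodule.add_mem_sup (add_mem (sum_mem fun i _ => Ideal.mul_mem_left _ _
      (Ideal.subset_span (.inl ⟨i, rfl⟩))) (Ideal.mul_mem_left _ _
      (Ideal.subset_span (.inr rfl)))) ?_
    rw [smul_eq_mul, ← pow_two]
    convert h3
    simp
  have h5 : maximalIdeal (R ⧸ Ideal.span {x}) =
      Ideal.span (Set.range fun i => Ideal.Quotient.mk (Ideal.span {x}) (y i)) := by
    refine le_antisymm ?_ ?_
    · rw [← map_maximalIdeal_quotient]
      refine (Ideal.map_mono hle).trans ?_
      rw [Ideal.map_span, Ideal.span_le]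
      rintro _ ⟨z, (⟨i, rfl⟩ | rfl), rfl⟩
      · exact Ideal.subset_span ⟨i, rfl⟩
      · rw [Ideal.Quotient.eq_zero_iff_mem.2 (Ideal.mem_span_singleton_self z)]
        exact zero_mem _
    · rw [Ideal.span_le, ← map_maximalIdeal_quotient]
      rintro _ ⟨i, rfl⟩
      exact Ideal.mem_map_of_mem _ (y i).2
  rw [h5, ← hq]
  refine Nat.add_le_add_right ((Submodule.spanFinrank_span_le_ncard_of_finite
    (Set.finite_range _)).trans ?_) 1
  rw [← Set.image_univ]
  refine (Set.ncard_image_le).trans ?_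
  simp

theorem exists_finset_maximalIdeal_le [IsLocalRing R] {x : R} (hx : x ∈ maximalIdeal R)
    [IsLocalRing (R ⧸ Ideal.span {x})] (s : Finset (R ⧸ Ideal.span {x}))
    (hs : Ideal.span (s : Set (R ⧸ Ideal.span {x})) = maximalIdeal (R ⧸ Ideal.span {x})) :
    ∃ t : Finset R, Ideal.span (t : Set R) = maximalIdeal R ∧ t.card ≤ s.card + 1 := by
  classical
  obtain ⟨g, hg⟩ := (Ideal.Quotient.mk_surjective (I := Ideal.span {x})).hasRightInverse
  refine ⟨insert x (s.image g), le_antisymm ?_ fun a ha => ?_,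
    (Finset.card_insert_le _ _).trans (Nat.add_le_add_right Finset.card_image_le 1)⟩
  · rw [Ideal.span_le]
    intro a ha
    rw [Finset.coe_insert, Finset.coe_image] at ha
    obtain rfl | ⟨z, hz, rfl⟩ := ha
    · exact hx
    · have h2 : z ∈ maximalIdeal (R ⧸ Ideal.span {x}) := hs ▸ Ideal.subset_span hz
      intro hu
      have h3 := hu.map (Ideal.Quotient.mk (Ideal.span {x}))
      rw [hg] at h3
      exact h2 h3
  · have h1 : Ideal.Quotient.mk (Ideal.span {x}) a ∈
        (Ideal.span (insert x (g '' s))).map (Ideal.Quotient.mk (Ideal.span {x})) := by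
      have h2 := Ideal.mem_map_of_mem (Ideal.Quotient.mk (Ideal.span {x})) ha
      rw [map_maximalIdeal_quotient, ← hs] at h2
      refine Ideal.span_le.2 (fun z hz => ?_) h2
      rw [SetLike.mem_coe, ← hg z]
      exact Ideal.mem_map_of_mem _ (Ideal.subset_span (.inr ⟨z, hz, rfl⟩))
    rw [Finset.coe_insert, Finset.coe_image]
    rw [← Ideal.mem_comap, Ideal.comap_map_mk] at h1
    · exact h1
    · rw [Ideal.span_singleton_le_iff_mem]
      exact Ideal.subset_span (.inl rfl)

theorem spanFinrank_maximalIdeal_le_quotient_add_one [IsLocalRing R] [IsNoetherianRing R] {x : R}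
    (hx : x ∈ maximalIdeal R) [IsLocalRing (R ⧸ Ideal.span {x})] :
    (maximalIdeal R).spanFinrank ≤ (maximalIdeal (R ⧸ Ideal.span {x})).spanFinrank + 1 := by
  obtain ⟨s, hs, hs'⟩ := Submodule.FG.exists_span_finset_card_eq_spanFinrank
    (IsNoetherian.noetherian (maximalIdeal (R ⧸ Ideal.span {x})))
  obtain ⟨t, ht, hts⟩ := exists_finset_maximalIdeal_le hx s hs'
  rw [← ht, ← hs]
  refine (Submodule.spanFinrank_span_le_ncard_of_finite (Finset.finite_toSet t)).trans ?_
  rwa [Set.ncard_coe_finset]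

/-- The number of generators of the maximal ideal drops by at least one, the dimension by at most
one. -/
theorem isRegularLocalRing_quotient [IsRegularLocalRing R] {x : R} (hx : x ∈ maximalIdeal R)
    (hx2 : x ∉ maximalIdeal R ^ 2) : IsRegularLocalRing (R ⧸ Ideal.span {x}) := by
  have := isLocalRing_quotient_span_singleton hx
  refine IsRegularLocalRing.of_spanFinrank_maximalIdeal_le (R := R ⧸ Ideal.span {x}) ?_
  have : IsNoetherianRing R := inferInstance
  have h1 := spanFinrank_maximalIdeal_quotient_add_one_le hx hx2
  have h2 := ringKrullDim_le_ringKrullDim_quotient_add_card (R := R) {x} (by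
    rw [Finset.coe_singleton, Set.singleton_subset_iff, SetLike.mem_coe, 
       IsLocalRing.ringJacobson_eq_maximalIdeal]; exact hx)
  rw [Finset.coe_singleton, Finset.card_singleton,
    ← (isRegularLocalRing_iff R).1 inferInstance] at h2
  have h3 : (((maximalIdeal (R ⧸ Ideal.span {x})).spanFinrank : ℕ) : WithBot ℕ∞) + (1 : ℕ) ≤
      ringKrullDim (R ⧸ Ideal.span {x}) + (1 : ℕ) := by
    refine le_trans ?_ h2
    exact_mod_cast h1
  exact ENat.WithBot.add_le_add_natCast_right_iff.1 h3

/-- Passing from the quotient back to R, the number of generators grows by at most one, and the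
dimension by at least one because x is a nonzerodivisor. -/
theorem IsRegularLocalRing.of_quotient [IsLocalRing R] [IsNoetherianRing R] {x : R}
    (hx : x ∈ maximalIdeal R) (hx' : x ∈ nonZeroDivisors R)
    [IsRegularLocalRing (R ⧸ Ideal.span {x})] : IsRegularLocalRing R := by
  refine IsRegularLocalRing.of_spanFinrank_maximalIdeal_le (R := R) ?_
  refine le_trans ?_ (ringKrullDim_quotient_succ_le_of_nonZeroDivisor (R := R) hx')
  rw [← (isRegularLocalRing_iff (R ⧸ Ideal.span {x})).1 inferInstance]
  exact_mod_cast spanFinrank_maximalIdeal_le_quotient_add_one hx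

/-- A domain modulo a prime element that avoids the minimal primes -/
theorem isDomain_of_isDomain_quotient [IsLocalRing R] [IsNoetherianRing R] {x : R}
    (hx : x ∈ maximalIdeal R) (hmin : ∀ p ∈ minimalPrimes R, x ∉ p)
    [IsDomain (R ⧸ Ideal.span {x})] : IsDomain R := by
  have hprime : (Ideal.span {x}).IsPrime := (Ideal.Quotient.isDomain_iff_prime _).1 inferInstance
  obtain ⟨p, hp, hpx⟩ := Ideal.exists_minimalPrimes_le (I := ⊥) (J := Ideal.span {x}) bot_le
  have hp' : p.IsPrime := hp.1.1
  have hbot : p = ⊥ := by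
    refine eq_bot_of_le_smul hx p (IsNoetherian.noetherian _) fun a ha => ?_
    obtain ⟨b, rfl⟩ := Ideal.mem_span_singleton'.1 (hpx ha)
    exact ⟨b, (hp'.mem_or_mem ha).resolve_right (hmin p hp), by rw [smul_eq_mul, mul_comm]⟩
  subst hbot
  exact IsDomain.of_bot_isPrime R

theorem exists_mem_maximalIdeal_notMem_sq [IsLocalRing R] [IsNoetherianRing R]
    (hm : maximalIdeal R ≠ ⊥) (s : Set (Ideal R)) (hs : s.Finite) (hp : ∀ p ∈ s, p.IsPrime)
    (hms : maximalIdeal R ∉ s) :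
    ∃ x ∈ maximalIdeal R, x ∉ maximalIdeal R ^ 2 ∧ ∀ p ∈ s, x ∉ p := by
  classical
  by_contra! hcon
  -- Prime avoidance tolerates two ideals that need not be prime; m² fills both places.
  let t := insert (maximalIdeal R ^ 2) hs.toFinset
  have h1 : (maximalIdeal R : Set R) ⊆ ⋃ i ∈ (t : Set (Ideal R)), (i : Set R) := fun x hx => by
    rw [Set.mem_iUnion₂]
    by_cases h : x ∈ maximalIdeal R ^ 2
    · exact ⟨_, by simp [t], h⟩
    · obtain ⟨p, hp, hxp⟩ := hcon x hx h
      exact ⟨p, by simp [t, hp], hxp⟩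
  rw [Ideal.subset_union_prime (maximalIdeal R ^ 2) (maximalIdeal R ^ 2)] at h1
  · obtain ⟨p, hpt, hle⟩ := h1
    simp only [t, Finset.mem_insert, Set.Finite.mem_toFinset] at hpt
    obtain rfl | hps := hpt
    · refine hm (Submodule.eq_bot_of_le_smul_of_le_jacobson_bot (maximalIdeal R) _
        (IsNoetherian.noetherian _) ?_ (maximalIdeal_le_jacobson _))
      rwa [smul_eq_mul, ← pow_two]
    · have := hp p hps
      exact hms (((maximalIdeal.isMaximal R).eq_of_le this.ne_top hle) ▸ hps)
  · intro i hi h _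
    simp only [t, Finset.mem_insert, Set.Finite.mem_toFinset] at hi
    exact hp i (hi.resolve_left h)


/-- Induction on the number of generators: for x outside m² and the minimal primes, R/x is again
regular, hence a domain. So x is prime, and a minimal prime p inside (x) satisfies p = x p, thus p =
0. -/
theorem isDomain_of_isRegularLocalRing (n : ℕ) : ∀ (R : Type u) [CommRing R]
    [IsRegularLocalRing R], (maximalIdeal R).spanFinrank = n → IsDomain R := by
  induction n with
  | zero =>
    intro R _ _ h
    rw [Submodule.spanFinrank_eq_zero_iff_eq_bot (IsNoetherian.noetherian _)] at h
    have h2 : (⊥ : Ideal R).IsPrime := h ▸ inferInstance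
    exact IsDomain.of_bot_isPrime R
  | succ n ih =>
    intro R _ _ h
    have hne : maximalIdeal R ≠ ⊥ := fun h0 => by
      rw [h0, Submodule.spanFinrank_bot] at h
      exact absurd h (by simp)
    have hmin : maximalIdeal R ∉ minimalPrimes R := fun h0 => by
      have h1 := IsLocalRing.maximalIdeal_height_eq_ringKrullDim (R := R)
      rw [Ideal.height_eq_zero_iff.2 h0, ← (isRegularLocalRing_iff R).1 inferInstance, h] at h1
      exact absurd h1 (by norm_cast)
    obtain ⟨x, hx, hx2, hxp⟩ := exists_mem_maximalIdeal_notMem_sq hne (minimalPrimes R)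
      (minimalPrimes.finite_of_isNoetherianRing R) (fun p hp => hp.1.1) hmin
    have := isRegularLocalRing_quotient hx hx2
    have h1 := spanFinrank_maximalIdeal_quotient_add_one_le hx hx2
    have h2 := spanFinrank_maximalIdeal_le_quotient_add_one hx
    have := ih (R ⧸ Ideal.span {x}) (by omega)
    exact isDomain_of_isDomain_quotient hx hxp

/-- A first syzygy K of M lies in a free module over a domain, so x is regular on it and the
projective dimensions of K over R and K/xK over the regular ring R/x agree. -/
theorem exists_pdLT_of_isRegularLocalRing (n : ℕ) : ∀ (R : Type u) [CommRing R]
    [IsRegularLocalRing R], (maximalIdeal R).spanFinrank = n → ∀ (M : Type u) [AddCommGroup M]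
    [Module R M] [Module.Finite R M], ∃ k, PdLT R M (k + 1) := by
  induction n with
  | zero =>
    intro R _ _ h M _ _ _
    rw [Submodule.spanFinrank_eq_zero_iff_eq_bot (IsNoetherian.noetherian _)] at h
    refine ⟨0, pdLT_one_iff.2 ?_⟩
    let := (IsLocalRing.isField_iff_maximalIdeal_eq.2 h).toField
    infer_instance
  | succ n ih =>
    intro R _ _ h M _ _ _
    have := isDomain_of_isRegularLocalRing _ R h
    have hne : maximalIdeal R ≠ ⊥ := fun h0 => by
      rw [h0, Submodule.spanFinrank_bot] at h
      exact absurd h (by simp)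
    obtain ⟨x, hx, hx2, hx0⟩ := exists_mem_maximalIdeal_notMem_sq hne {⊥}
      (Set.finite_singleton _) (fun p hp => hp ▸ inferInstance) (by simpa using hne)
    replace hx0 : x ≠ 0 := fun h => hx0 ⊥ rfl (by simp [h])
    have := isRegularLocalRing_quotient hx hx2
    have h1 := spanFinrank_maximalIdeal_quotient_add_one_le hx hx2
    have h2 := spanFinrank_maximalIdeal_le_quotient_add_one hx
    obtain ⟨k, f, hf⟩ := Module.Finite.exists_fin' R M
    have hR : IsSMulRegular R x := IsSMulRegular.of_ne_zero hx0
    obtain ⟨l, hl⟩ := ih (R ⧸ Ideal.span {x}) (by omega)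
      ((R ⧸ Ideal.span {x}) ⊗[R] LinearMap.ker f)
    refine ⟨l + 1, (pdLT_ker_iff f hf l).2 ?_⟩
    exact (pdLT_iff_of_isSMulRegular hx hR l (LinearMap.ker f)
      (IsSMulRegular.submodule _ _ (isSMulRegular_pi hR (Fin k)))).2 hl

/-- A minimal cover of a finite module over a local ring -/
theorem exists_minimal_cover [IsLocalRing R] (M : Type u) [AddCommGroup M] [Module R M]
    [Module.Finite R M] : ∃ (k : ℕ) (f : (Fin k → R) →ₗ[R] M), Function.Surjective f ∧
      ∀ a ∈ LinearMap.ker f, ∀ i, a i ∈ maximalIdeal R := by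
  let b := Module.finBasis (ResidueField R) (ResidueField R ⊗[R] M)
  choose v hv using fun i => TensorProduct.mk_surjective R M (ResidueField R) residue_surjective (b i)
  refine ⟨_, Fintype.linearCombination R v, ?_, fun a ha => ?_⟩
  · rw [← LinearMap.range_eq_top, Fintype.range_linearCombination]
    exact span_eq_top_of_tmul_eq_basis v b hv
  · have h1 : ∑ i, residue R (a i) • b i = 0 := by
      have h2 : (1 : ResidueField R) ⊗ₜ[R] (Fintype.linearCombination R v a) = 0 := by
        rw [LinearMap.mem_ker.1 ha, TensorProduct.tmul_zero]
      rw [← h2, Fintype.linearCombination_apply, TensorProduct.tmul_sum]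
      refine Finset.sum_congr rfl fun i _ => ?_
      rw [← hv, TensorProduct.tmul_smul]
      rfl
    intro i
    exact (residue_eq_zero_iff _).1 (Fintype.linearIndependent_iff.1 b.linearIndependent _ h1 i)

/-- The case of depth zero. The first syzygy of a minimal cover has entries in m, hence is killed by
s; by induction it is free, and a free module killed by s ≠ 0 is zero. -/
theorem free_of_pdLT [IsLocalRing R] [IsNoetherianRing R] {s : R} (hs : s ≠ 0)
    (hms : ∀ a ∈ maximalIdeal R, s * a = 0) (n : ℕ) : ∀ (M : Type u) [AddCommGroup M] [Module R M]
    [Module.Finite R M], PdLT R M (n + 1) → Module.Free R M := by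
  induction n with
  | zero =>
    intro M _ _ _ h
    have : Module.Projective R M := pdLT_one_iff.1 h
    exact Module.free_of_flat_of_isLocalRing
  | succ n ih =>
    intro M _ _ _ h
    obtain ⟨k, f, hf, hk⟩ := exists_minimal_cover (R := R) M
    have := ih _ ((pdLT_ker_iff f hf n).1 h)
    have h1 : ∀ a : LinearMap.ker f, s • a = 0 := fun a =>
      Subtype.ext (funext fun i => hms _ (hk a a.2 i))
    have h2 : Subsingleton (LinearMap.ker f) := by
      let b := Module.Free.chooseBasis R (LinearMap.ker f)
      have : IsEmpty (Module.Free.ChooseBasisIndex R (LinearMap.ker f)) := ⟨fun i => hs <| by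
        have h3 := congrArg (fun z => b.repr z i) (h1 (b i))
        simpa using h3⟩
      exact b.repr.toEquiv.subsingleton
    have h3 : Function.Injective f := by
      rw [← LinearMap.ker_eq_bot]
      exact (Submodule.subsingleton_iff_eq_bot).1 h2
    exact Module.Free.of_equiv (LinearEquiv.ofBijective f ⟨h3, hf⟩)

theorem maximalIdeal_eq_bot_of_pdLT_residueField [IsLocalRing R] [IsNoetherianRing R] {s : R}
    (hs : s ≠ 0) (hms : ∀ a ∈ maximalIdeal R, s * a = 0) (n : ℕ)
    (h : PdLT R (ResidueField R) (n + 1)) : maximalIdeal R = ⊥ := by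
  have := free_of_pdLT hs hms n _ h
  rw [eq_bot_iff]
  intro a ha
  let b := Module.Free.chooseBasis R (ResidueField R)
  have : Nonempty (Module.Free.ChooseBasisIndex R (ResidueField R)) := b.index_nonempty
  have i := Classical.arbitrary (Module.Free.ChooseBasisIndex R (ResidueField R))
  have h1 : a • b i = 0 := by
    rw [Algebra.smul_def]
    have : algebraMap R (ResidueField R) a = 0 := (residue_eq_zero_iff a).2 ha
    rw [this, zero_mul]
  have h3 := congrArg (fun z => b.repr z i) h1
  simpa using h3

theorem exists_functional_maximalIdeal [IsLocalRing R] {x : R} (hx : x ∈ maximalIdeal R)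
    (hx2 : x ∉ maximalIdeal R ^ 2) :
    ∃ l : maximalIdeal R →ₗ[R] ResidueField R, l ⟨x, hx⟩ = 1 := by
  have hv : (maximalIdeal R).toCotangent ⟨x, hx⟩ ≠ 0 :=
    fun h => hx2 (((maximalIdeal R).toCotangent_eq_zero ⟨x, hx⟩).1 h)
  obtain ⟨g, hg⟩ := Module.Projective.exists_dual_eq_one (ResidueField R)
    (V := CotangentSpace R) hv
  exact ⟨(g.restrictScalars R) ∘ₗ (maximalIdeal R).toCotangent, hg⟩

/-- The residue field of `R / x` is a direct summand of `m / x m` for `x ∈ m ∖ m²`. -/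
theorem pdLT_residueField_quotient [IsLocalRing R] {x : R} (hx : x ∈ maximalIdeal R)
    (hx2 : x ∉ maximalIdeal R ^ 2) [IsLocalRing (R ⧸ Ideal.span {x})] (n : ℕ)
    (h : PdLT (R ⧸ Ideal.span {x}) ((R ⧸ Ideal.span {x}) ⊗[R] maximalIdeal R) n) :
    PdLT (R ⧸ Ideal.span {x}) (ResidueField (R ⧸ Ideal.span {x})) n := by
  obtain ⟨l, hl⟩ := exists_functional_maximalIdeal hx hx2
  let i₀ : (R ⧸ Ideal.span {x}) →ₗ[R ⧸ Ideal.span {x}]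
      (R ⧸ Ideal.span {x}) ⊗[R] maximalIdeal R :=
    LinearMap.toSpanSingleton _ _ (1 ⊗ₜ ⟨x, hx⟩)
  have hi₀ : maximalIdeal (R ⧸ Ideal.span {x}) ≤ LinearMap.ker i₀ := fun z hz => by
    rw [← map_maximalIdeal_quotient] at hz
    obtain ⟨a, ha, rfl⟩ := (Ideal.mem_map_iff_of_surjective _ Ideal.Quotient.mk_surjective).1 hz
    have h1 : (a • (⟨x, hx⟩ : maximalIdeal R)) = x • ⟨a, ha⟩ := Subtype.ext (mul_comm a x)
    have h2 : (Ideal.Quotient.mk (Ideal.span {x}) a) • ((1 : R ⧸ Ideal.span {x}) ⊗ₜ[R]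
        (⟨x, hx⟩ : maximalIdeal R)) = 1 ⊗ₜ (a • ⟨x, hx⟩) := by
      rw [TensorProduct.tmul_smul]; rfl
    rw [LinearMap.mem_ker, LinearMap.toSpanSingleton_apply, h2, h1, ← TensorProduct.smul_tmul,
      Algebra.smul_def, mul_one]
    have h3 : algebraMap R (R ⧸ Ideal.span {x}) x = 0 :=
      Ideal.Quotient.eq_zero_iff_mem.2 (Ideal.mem_span_singleton_self x)
    rw [h3, TensorProduct.zero_tmul]
  let i : ResidueField (R ⧸ Ideal.span {x}) →ₗ[R ⧸ Ideal.span {x}]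
      (R ⧸ Ideal.span {x}) ⊗[R] maximalIdeal R := Submodule.liftQ _ i₀ hi₀
  have hloc : IsLocalHom (algebraMap R (R ⧸ Ideal.span {x})) :=
    IsLocalHom.of_surjective _ Ideal.Quotient.mk_surjective
  let r₀ : maximalIdeal R →ₗ[R] ResidueField (R ⧸ Ideal.span {x}) :=
    (IsScalarTower.toAlgHom R (ResidueField R) (ResidueField (R ⧸ Ideal.span {x}))).toLinearMap ∘ₗ l
  let r : (R ⧸ Ideal.span {x}) ⊗[R] maximalIdeal R →ₗ[R ⧸ Ideal.span {x}]
      ResidueField (R ⧸ Ideal.span {x}) := LinearMap.liftBaseChange _ r₀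
  refine h.of_retract i r fun z => ?_
  have h1 : r (1 ⊗ₜ ⟨x, hx⟩) = 1 := by
    rw [LinearMap.liftBaseChange_tmul, one_smul]
    refine (congrArg (algebraMap (ResidueField R) (ResidueField (R ⧸ Ideal.span {x}))) hl).trans ?_
    exact map_one _
  obtain ⟨a, rfl⟩ := residue_surjective z
  have h2 : i (residue _ a) = a • (1 ⊗ₜ ⟨x, hx⟩) := rfl
  rw [h2, map_smul, h1, Algebra.smul_def, mul_one]
  rfl

/-- Serre's criterion -/
theorem isRegularLocalRing_of_pdLT_residueField (d : ℕ) : ∀ (R : Type u) [CommRing R]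
    [IsLocalRing R] [IsNoetherianRing R], (maximalIdeal R).spanFinrank = d → ∀ n,
    PdLT R (ResidueField R) (n + 1) → IsRegularLocalRing R := by
  induction d with
  | zero =>
    intro R _ _ _ h n _
    refine IsRegularLocalRing.of_spanFinrank_maximalIdeal_le R ?_
    rw [h]
    exact ringKrullDim_nonneg_of_nontrivial
  | succ d ih =>
    intro R _ _ _ h n hn
    have hne : maximalIdeal R ≠ ⊥ := fun h0 => by
      rw [h0, Submodule.spanFinrank_bot] at h
      exact absurd h (by simp)
    -- If m were the annihilator of some s ≠ 0, a residue field of finite projective dimension would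
    -- be free and m = 0.
    have hass : maximalIdeal R ∉ associatedPrimes R R := fun h0 => by
      obtain ⟨-, s, hs⟩ := isAssociatedPrime_iff.1 h0
      have hs0 : s ≠ 0 := by
        rintro rfl
        have h1 : (1 : R) ∈ maximalIdeal R := by
          rw [hs, Submodule.mem_colon_singleton, smul_zero]
          exact zero_mem _
        exact (Ideal.ne_top_iff_one _).1 (maximalIdeal.isMaximal R).ne_top h1
      refine hne (maximalIdeal_eq_bot_of_pdLT_residueField hs0 (fun a ha => ?_) n hn)
      rw [hs, Submodule.mem_colon_singleton, Submodule.mem_bot, smul_eq_mul] at ha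
      rw [mul_comm, ha]
    obtain ⟨x, hx, hx2, hxp⟩ := exists_mem_maximalIdeal_notMem_sq hne (associatedPrimes R R)
      (associatedPrimes.finite R R) (fun p hp => hp.1) hass
    have hx' : x ∈ nonZeroDivisors R := by
      by_contra hcon
      have h1 : x ∈ ((nonZeroDivisors R : Set R)ᶜ) := hcon
      rw [← biUnion_associatedPrimes_eq_compl_nonZeroDivisors, Set.mem_iUnion₂] at h1
      obtain ⟨p, hp, hp'⟩ := h1
      exact hxp p hp hp'
    have hR : IsSMulRegular R x := Module.Flat.isSMulRegular_of_nonZeroDivisors hx'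
    have := isLocalRing_quotient_span_singleton hx
    have h1 := spanFinrank_maximalIdeal_quotient_add_one_le hx hx2
    have h2 := spanFinrank_maximalIdeal_le_quotient_add_one hx
    -- m is the first syzygy of the residue field; the bound is first weakened by one, so that the
    -- shift returns n+1.
    have h3 : PdLT R (maximalIdeal R) (n + 1) := by
      have h4 := (pdLT_ker_iff ((IsScalarTower.toAlgHom R R (ResidueField R)).toLinearMap)
        residue_surjective n).1 (hn.mono (Nat.le_succ _))
      refine h4.of_equiv (LinearEquiv.ofEq _ _ ?_)
      ext a
      exact residue_eq_zero_iff a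
    -- The bound passes to m/xm over R/x, and thence to its direct summand, the residue field.
    rw [pdLT_iff_of_isSMulRegular hx hR n (maximalIdeal R) (IsSMulRegular.submodule _ _ hR)] at h3
    have := ih (R ⧸ Ideal.span {x}) (by omega) n (pdLT_residueField_quotient hx hx2 _ h3)
    exact IsRegularLocalRing.of_quotient hx hx'

/-- Descent of regularity along flat local homomorphisms -/
theorem IsRegularLocalRing.of_flat (R S : Type u) [CommRing R] [IsLocalRing R] [IsNoetherianRing R]
    [CommRing S] [IsRegularLocalRing S] [Algebra R S] [IsLocalHom (algebraMap R S)]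
    [Module.Flat R S] : IsRegularLocalRing R := by
  have : Module.FaithfullyFlat R S := Module.FaithfullyFlat.of_flat_of_isLocalHom
  obtain ⟨n, hn⟩ := exists_pdLT_of_isRegularLocalRing _ S rfl (S ⊗[R] ResidueField R)
  exact isRegularLocalRing_of_pdLT_residueField _ R rfl n ((pdLT_iff_of_faithfullyFlat n _).2 hn)

/-- Descent of regularity along flat homomorphisms -/
theorem RingHom.Flat.isRegularLocalRing_localization {R S : Type u} [CommRing R] [CommRing S]
    {f : R →+* S} (hf : f.Flat) (p : Ideal R) [p.IsPrime] (q : Ideal S) [q.IsPrime]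
    (h : p = q.comap f) [IsNoetherianRing (Localization.AtPrime p)]
    [IsRegularLocalRing (Localization.AtPrime q)] :
    IsRegularLocalRing (Localization.AtPrime p) := by
  have h1 := hf.localRingHom q p h
  have h2 := Localization.isLocalHom_localRingHom p q f h
  algebraize [Localization.localRingHom p q f h]
  have h3 : IsLocalHom (algebraMap (Localization.AtPrime p) (Localization.AtPrime q)) := h2
  exact IsRegularLocalRing.of_flat (Localization.AtPrime p) (Localization.AtPrime q)

end RegularLocalRing

end

/-! ### Finite extensions of residue fields; descent of flatness and of regular fibres -/

noncomputable section

section FiniteOverFractions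

theorem Module.Finite.of_range_le {k k' K : Type*} [CommRing k] [CommRing k'] [CommRing K]
    [Algebra k K] [Algebra k' K] (h : ∀ a : k, ∃ b : k', algebraMap k' K b = algebraMap k K a)
    [Module.Finite k K] : Module.Finite k' K := by
  obtain ⟨s, hs⟩ := Module.Finite.fg_top (R := k) (M := K)
  refine ⟨⟨s, top_le_iff.1 fun z _ => ?_⟩⟩
  have hz : z ∈ Submodule.span k (s : Set K) := hs ▸ Submodule.mem_top
  induction hz using Submodule.span_induction with
  | mem x hx => exact Submodule.subset_span hx
  | zero => exact zero_mem _
  | add x y _ _ hx hy => exact add_mem (hx trivial) (hy trivial)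
  | smul a x _ hx =>
    obtain ⟨b, hb⟩ := h a
    rw [Algebra.smul_def, ← hb, ← Algebra.smul_def]
    exact Submodule.smul_mem _ _ (hx trivial)

/-- The field `K` is finite over its subfield generated by the image of `A`. -/
def FiniteOverFractions (A K : Type*) [CommRing A] [Field K] [Algebra A K] : Prop :=
  Module.Finite (Subfield.closure (Set.range (algebraMap A K))) K

namespace FiniteOverFractions

variable {A K : Type*} [CommRing A] [Field K] [Algebra A K]

/-- The notion involves only the map A → K. It can therefore be moved between A, its localizations
and the various residue fields without comparing these with each other. -/
theorem moduleFinite (h : FiniteOverFractions A K) (k : Type*) [Field k] [Algebra A k] [Algebra k K]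
    [IsScalarTower A k K] : Module.Finite k K := by
  have h1 : Subfield.closure (Set.range (algebraMap A K)) ≤ (algebraMap k K).fieldRange := by
    rw [Subfield.closure_le]
    rintro _ ⟨a, rfl⟩
    exact ⟨algebraMap A k a, (IsScalarTower.algebraMap_apply A k K a).symm⟩
  have : Module.Finite (Subfield.closure (Set.range (algebraMap A K))) K := h
  exact Module.Finite.of_range_le (k := Subfield.closure (Set.range (algebraMap A K)))
    fun a => h1 a.2

theorem extend (h : FiniteOverFractions A K) (B : Type*) [CommRing B] [Algebra A B] [Algebra B K]
    [IsScalarTower A B K] : FiniteOverFractions B K := by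
  have h1 : Subfield.closure (Set.range (algebraMap A K)) ≤
      Subfield.closure (Set.range (algebraMap B K)) := by
    refine Subfield.closure_mono ?_
    rintro _ ⟨a, rfl⟩
    exact ⟨algebraMap A B a, (IsScalarTower.algebraMap_apply A B K a).symm⟩
  have : Module.Finite (Subfield.closure (Set.range (algebraMap A K))) K := h
  exact Module.Finite.of_range_le (k := Subfield.closure (Set.range (algebraMap A K)))
    fun a => ⟨⟨a, h1 a.2⟩, rfl⟩

theorem of_moduleFinite (k : Type*) [Field k] [Algebra A k] [Algebra k K] [IsScalarTower A k K]
    [Module.Finite k K] (hk : ∀ t : k, ∃ a b : A, algebraMap A k b ≠ 0 ∧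
      t * algebraMap A k b = algebraMap A k a) : FiniteOverFractions A K := by
  refine Module.Finite.of_range_le (k := k) fun t => ?_
  obtain ⟨a, b, hb, hab⟩ := hk t
  have h1 : ∀ a : A, algebraMap A K a ∈ Subfield.closure (Set.range (algebraMap A K)) :=
    fun a => Subfield.subset_closure ⟨a, rfl⟩
  refine ⟨⟨algebraMap k K t, ?_⟩, rfl⟩
  rw [(eq_div_iff hb).2 hab, map_div₀, ← IsScalarTower.algebraMap_apply,
    ← IsScalarTower.algebraMap_apply]
  exact div_mem (h1 a) (h1 b)

/-- K is finite over the residue field of the kernel of A → K, which is essentially of finite type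
over A; this makes the fibre rings noetherian. -/
theorem essFiniteType (h : FiniteOverFractions A K) : Algebra.EssFiniteType A K := by
  let q := RingHom.ker (algebraMap A K)
  have hq : q.IsPrime := RingHom.ker_isPrime _
  let φ : q.ResidueField →+* K := Ideal.ResidueField.lift q (algebraMap A K) le_rfl
    fun a ha => IsUnit.mk0 _ ha
  let : Algebra q.ResidueField K := φ.toAlgebra
  have : IsScalarTower A q.ResidueField K :=
    .of_algebraMap_eq fun a => (Ideal.ResidueField.lift_algebraMap q _ _ _ a).symm
  have : Module.Finite q.ResidueField K := h.moduleFinite q.ResidueField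
  exact Algebra.EssFiniteType.comp A q.ResidueField K

theorem isNoetherianRing_tensorProduct (h : FiniteOverFractions A K) (B : Type*) [CommRing B]
    [Algebra A B] [IsNoetherianRing B] : IsNoetherianRing (B ⊗[A] K) := by
  have := h.essFiniteType
  exact Algebra.EssFiniteType.isNoetherianRing B (B ⊗[A] K)

end FiniteOverFractions

end FiniteOverFractions

section RegularAlgebra

variable {A B C : Type u} [CommRing A] [CommRing B] [Algebra A B] [CommRing C] [Algebra A C]

theorem IsRegularAlgebra.isRegularRing_tensorProduct (h : IsRegularAlgebra A B) (K : Type u)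
    [Field K] [Algebra A K] (hK : FiniteOverFractions A K) : IsRegularRing (B ⊗[A] K) := by
  let q := RingHom.ker (algebraMap A K)
  have hq : q.IsPrime := RingHom.ker_isPrime _
  let φ : q.ResidueField →+* K := Ideal.ResidueField.lift q (algebraMap A K) le_rfl
    fun a ha => IsUnit.mk0 _ ha
  let : Algebra q.ResidueField K := φ.toAlgebra
  have : IsScalarTower A q.ResidueField K :=
    .of_algebraMap_eq fun a => (Ideal.ResidueField.lift_algebraMap q _ _ _ a).symm
  have : Module.Finite q.ResidueField K := hK.moduleFinite q.ResidueField
  have := h.2 q K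
  exact IsRegularRing.of_ringEquiv ((Algebra.TensorProduct.cancelBaseChange A q.ResidueField
    q.ResidueField K B).toRingEquiv.trans (Algebra.TensorProduct.comm A K B).toRingEquiv)

end RegularAlgebra

section Descent

theorem exists_prime_tensorProduct_of_field {A B S L : Type*} [CommRing A] [CommRing B]
    [CommRing S] [Algebra A B] [Algebra A S] [Field L] (φ : B →+* L) (ψ : S →+* L)
    (h : ∀ a : A, φ (algebraMap A B a) = ψ (algebraMap A S a)) :
    ∃ N : Ideal (B ⊗[A] S), N.IsPrime ∧ RingHom.ker ψ =
      N.comap (Algebra.TensorProduct.includeRight : S →ₐ[A] B ⊗[A] S).toRingHom := by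
  let : Algebra A L := (φ.comp (algebraMap A B)).toAlgebra
  let φ' : B →ₐ[A] L := { φ with commutes' := fun a => rfl }
  let ψ' : S →ₐ[A] L := { ψ with commutes' := fun a => (h a).symm }
  let F : B ⊗[A] S →ₐ[A] L := Algebra.TensorProduct.lift φ' ψ' fun _ _ => Commute.all _ _
  refine ⟨RingHom.ker F.toRingHom, RingHom.ker_isPrime _, ?_⟩
  ext s
  have h4 : F (1 ⊗ₜ s) = ψ s := by
    rw [Algebra.TensorProduct.lift_tmul, map_one, one_mul]; rfl
  rw [RingHom.mem_ker, ← h4]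
  rfl

/-- The tensor product of κ(P) and κ(Q) over their common subfield is nonzero; a residue field of it
receives compatible maps from B and S, and the kernel on B ⊗ S is the required prime. -/
theorem exists_prime_tensorProduct {A B S : Type*} [CommRing A] [CommRing B] [CommRing S]
    [Algebra A B] [Algebra A S] (P : Ideal B) [P.IsPrime] (Q : Ideal S) [Q.IsPrime]
    (h : P.comap (algebraMap A B) = Q.comap (algebraMap A S)) :
    ∃ N : Ideal (B ⊗[A] S), N.IsPrime ∧
      Q = N.comap (Algebra.TensorProduct.includeRight : S →ₐ[A] B ⊗[A] S).toRingHom := by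
  let q := Q.comap (algebraMap A S)
  let : Algebra q.ResidueField Q.ResidueField :=
    (Ideal.ResidueField.map q Q (algebraMap A S) rfl).toAlgebra
  let : Algebra q.ResidueField P.ResidueField :=
    (Ideal.ResidueField.map q P (algebraMap A B) h.symm).toAlgebra
  have h1 : ∀ a : A, algebraMap q.ResidueField Q.ResidueField (algebraMap A _ a) =
      algebraMap S _ (algebraMap A S a) := fun a => Ideal.ResidueField.map_algebraMap ..
  have h2 : ∀ a : A, algebraMap q.ResidueField P.ResidueField (algebraMap A _ a) =
      algebraMap B _ (algebraMap A B a) := fun a => Ideal.ResidueField.map_algebraMap ..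
  obtain ⟨M, hM⟩ := Ideal.exists_maximal (P.ResidueField ⊗[q.ResidueField] Q.ResidueField)
  let : Field ((P.ResidueField ⊗[q.ResidueField] Q.ResidueField) ⧸ M) := Ideal.Quotient.field M
  let ρ := (Ideal.Quotient.mk M).comp (Algebra.TensorProduct.includeRight :
    Q.ResidueField →ₐ[q.ResidueField] P.ResidueField ⊗[q.ResidueField] Q.ResidueField).toRingHom
  obtain ⟨N, hN, hQ⟩ := exists_prime_tensorProduct_of_field (A := A) ((Ideal.Quotient.mk M).comp
    (Algebra.TensorProduct.includeLeftRingHom.comp (algebraMap B P.ResidueField)))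
    (ρ.comp (algebraMap S Q.ResidueField)) (fun a => congrArg (Ideal.Quotient.mk M) (by
      have h3 : (algebraMap B P.ResidueField (algebraMap A B a)) ⊗ₜ[q.ResidueField]
          (1 : Q.ResidueField) = 1 ⊗ₜ algebraMap S Q.ResidueField (algebraMap A S a) := by
        rw [← h1, ← h2, Algebra.algebraMap_eq_smul_one,
          Algebra.algebraMap_eq_smul_one (A := Q.ResidueField), TensorProduct.smul_tmul]
      exact h3))
  refine ⟨N, hN, ?_⟩
  rw [← hQ]
  ext s
  rw [RingHom.mem_ker, RingHom.comp_apply, map_eq_zero, Ideal.algebraMap_residueField_eq_zero]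

/-- Regularity descends along a flat base change at the primes that are hit. -/
theorem isRegularLocalRing_localization_tensorProduct {A A' B K : Type u} [CommRing A] [CommRing A']
    [CommRing B] [CommRing K] [Algebra A A'] [Algebra A' B] [Algebra A B] [IsScalarTower A A' B]
    [Algebra A K] [Module.Flat A' B] [IsNoetherianRing (A' ⊗[A] K)] [IsRegularRing (B ⊗[A] K)]
    (Q : Ideal (A' ⊗[A] K)) [Q.IsPrime] (P : Ideal B) [P.IsPrime]
    (h : P.comap (algebraMap A' B) = Q.comap (algebraMap A' (A' ⊗[A] K))) :
    IsRegularLocalRing (Localization.AtPrime Q) := by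
  obtain ⟨N, hN, hNQ⟩ := exists_prime_tensorProduct P Q h
  have : IsRegularRing (B ⊗[A'] (A' ⊗[A] K)) := IsRegularRing.of_ringEquiv
    (Algebra.TensorProduct.cancelBaseChange A A' B B K).symm.toRingEquiv
  have hflat : (Algebra.TensorProduct.includeRight :
      A' ⊗[A] K →ₐ[A'] B ⊗[A'] (A' ⊗[A] K)).toRingHom.Flat := by
    have h1 : (algebraMap (A' ⊗[A] K) ((A' ⊗[A] K) ⊗[A'] B)).Flat :=
      RingHom.flat_algebraMap_iff.2 inferInstance
    have h2 := (RingHom.Flat.of_bijective (Algebra.TensorProduct.comm A' (A' ⊗[A] K) B).bijective :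
      (Algebra.TensorProduct.comm A' (A' ⊗[A] K) B).toRingEquiv.toRingHom.Flat)
    exact h1.comp h2
  exact hflat.isRegularLocalRing_localization Q N hNQ

/-- A flat homomorphism that factors through a faithfully flat one -/
theorem Module.Flat.of_faithfullyFlat_tower (R S T : Type u) [CommRing R] [CommRing S] [CommRing T]
    [Algebra R S] [Algebra S T] [Algebra R T] [IsScalarTower R S T] [Module.FaithfullyFlat S T]
    [Module.Flat R T] : Module.Flat R S := by
  rw [Module.Flat.iff_lTensor_preserves_injective_linearMap]
  intro N N' _ _ _ _ f hf
  have h1 := Module.Flat.lTensor_preserves_injective_linearMap (M := T) f hf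
  let g : T ⊗[R] N →ₗ[S] T ⊗[R] N' :=
    TensorProduct.AlgebraTensorModule.map (LinearMap.id (R := S) (M := T)) f
  let e (N : Type u) [AddCommGroup N] [Module R N] :=
    TensorProduct.AlgebraTensorModule.cancelBaseChange R S S T N
  have h3 : (e N').toLinearMap ∘ₗ LinearMap.lTensor T (f.baseChange S) =
      g ∘ₗ (e N).toLinearMap := by
    ext; simp [e, g]
  have h2 : Function.Injective (LinearMap.lTensor T (f.baseChange S)) := by
    have h4 : Function.Injective ((e N').toLinearMap ∘ₗ LinearMap.lTensor T (f.baseChange S)) := by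
      rw [h3]
      exact Function.Injective.comp (g := g) h1 (e N).injective
    rw [LinearMap.coe_comp] at h4
    exact Function.Injective.of_comp h4
  exact (Module.FaithfullyFlat.lTensor_injective_iff_injective S T _).1 h2

/-- Since Q lies over a prime inside p', elements of A outside the contraction of p' are invertible
in K, so K is an R-algebra and B ⊗[A] K is a regular fibre of R → B. Faithful flatness of R' → B
supplies a prime of B over the same prime of A' as Q, and regularity descends along the flat map A'
→ B. -/
theorem isRegularLocalRing_of_isRegularAlgebra {A A' R R' B K : Type u} [CommRing A] [CommRing A']
    [CommRing R] [CommRing R'] [CommRing B] [Field K] [Algebra A A'] [Algebra A R] [Algebra A' R']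
    [Algebra R B] [Algebra R' B] [Algebra A B] [Algebra A' B] [Algebra A K] [IsScalarTower A R B]
    [IsScalarTower A' R' B] [IsScalarTower A A' B] (p' : Ideal A') [p'.IsPrime]
    [IsLocalization.AtPrime R (p'.comap (algebraMap A A'))] [IsLocalization.AtPrime R' p']
    [Module.FaithfullyFlat R' B] [IsNoetherianRing A'] (hreg : IsRegularAlgebra R B)
    (hK : FiniteOverFractions A K) (Q : Ideal (A' ⊗[A] K)) [Q.IsPrime]
    (hQ : Q.comap (algebraMap A' (A' ⊗[A] K)) ≤ p') :
    IsRegularLocalRing (Localization.AtPrime Q) := by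
  have hp : ∀ a : (p'.comap (algebraMap A A')).primeCompl, IsUnit (algebraMap A K a) := by
    rintro ⟨a, ha⟩
    refine IsUnit.mk0 _ fun h0 => ha (hQ ?_)
    rw [Ideal.mem_comap, ← IsScalarTower.algebraMap_apply,
      ← (Algebra.TensorProduct.includeRight : K →ₐ[A] A' ⊗[A] K).commutes, h0, map_zero]
    exact zero_mem _
  let : Algebra R K := (IsLocalization.lift hp).toAlgebra
  have : IsScalarTower A R K := .of_algebraMap_eq fun a => (IsLocalization.lift_eq hp a).symm
  have h1 := hreg.isRegularRing_tensorProduct K (hK.extend R)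
  have : IsRegularRing (B ⊗[A] K) := IsRegularRing.of_ringEquiv (IsLocalization.algebraTensorEquiv
    (p'.comap (algebraMap A A')).primeCompl R B K).toRingEquiv
  have := hK.isNoetherianRing_tensorProduct A'
  have : Module.Flat A' R' := IsLocalization.flat R' p'.primeCompl
  have : Module.Flat A' B := Module.Flat.trans A' R' B
  let q := Q.comap (algebraMap A' (A' ⊗[A] K))
  have hq : Disjoint (p'.primeCompl : Set A') q := by
    rw [Set.disjoint_left]
    exact fun a ha haq => ha (hQ haq)
  have hq' : (q.map (algebraMap A' R')).IsPrime :=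
    IsLocalization.isPrime_of_isPrime_disjoint p'.primeCompl R' q inferInstance hq
  obtain ⟨P, hP, hPq⟩ := Ideal.exists_isPrime_liesOver_of_faithfullyFlat (B := B)
    (q.map (algebraMap A' R'))
  refine isRegularLocalRing_localization_tensorProduct Q P ?_
  rw [IsScalarTower.algebraMap_eq A' R' B, ← Ideal.comap_comap]
  refine (congrArg _ hPq.over.symm).trans ?_
  exact IsLocalization.under_map_of_isPrime_disjoint p'.primeCompl R' inferInstance hq

/-- Homomorphisms of noetherian rings that are isomorphisms on the completions of the local rings
inherit the regularity of the formal fibres. -/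
theorem IsAdicIso.flat_and_isRegularLocalRing {A A' : Type u} [CommRing A] [CommRing A']
    [Algebra A A'] [IsNoetherianRing A] [IsNoetherianRing A'] (hG : IsGRing A) (p' : Ideal A')
    [p'.IsPrime]
    (h : IsAdicIso (Localization.localRingHom (p'.comap (algebraMap A A')) p' (algebraMap A A') rfl)
      (IsLocalRing.maximalIdeal _) (IsLocalRing.maximalIdeal _)) :
    (Localization.localRingHom (p'.comap (algebraMap A A')) p' (algebraMap A A') rfl).Flat ∧
    ∀ (K : Type u) [Field K] [Algebra A K], FiniteOverFractions A K →
      ∀ (Q : Ideal (A' ⊗[A] K)) [Q.IsPrime], Q.comap (algebraMap A' (A' ⊗[A] K)) ≤ p' →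
        IsRegularLocalRing (Localization.AtPrime Q) := by
  let R := Localization.AtPrime (p'.comap (algebraMap A A'))
  let R' := Localization.AtPrime p'
  let B := AdicCompletion (IsLocalRing.maximalIdeal R) R
  have hB : IsRegularAlgebra R B := hG _
  have hflat : Module.Flat R' (AdicCompletion (IsLocalRing.maximalIdeal R') R') := inferInstance
  have hff : Module.FaithfullyFlat R' (AdicCompletion (IsLocalRing.maximalIdeal R') R') :=
    Module.FaithfullyFlat.of_flat_of_isLocalHom
  -- The completion B of R becomes an R'-algebra through the isomorphism of completions.
  let : Algebra R' B := (h.completionEquiv.symm.toRingHom.comp (algebraMap R' _)).toAlgebra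
  let e : AdicCompletion (IsLocalRing.maximalIdeal R') R' ≃ₐ[R'] B :=
    { h.completionEquiv.symm with commutes' := fun a => rfl }
  have : Module.FaithfullyFlat R' B := Module.FaithfullyFlat.of_linearEquiv _ _ e.symm.toLinearEquiv
  let : Algebra R R' :=
    (Localization.localRingHom (p'.comap (algebraMap A A')) p' (algebraMap A A') rfl).toAlgebra
  have : IsScalarTower R R' B := .of_algebraMap_eq fun a =>
    h.completionEquiv.injective ((h.completionEquiv_algebraMap a).trans
      (h.completionEquiv.apply_symm_apply _).symm)
  have : Module.Flat R B := hB.1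
  refine ⟨Module.Flat.of_faithfullyFlat_tower R R' B, fun K _ _ hK Q _ hQ => ?_⟩
  let : Algebra A' B := ((algebraMap R' B).comp (algebraMap A' R')).toAlgebra
  have : IsScalarTower A' R' B := .of_algebraMap_eq fun a => rfl
  have : IsScalarTower A A' B := .of_algebraMap_eq fun a =>
    (IsScalarTower.algebraMap_apply A R B a).trans ((IsScalarTower.algebraMap_apply R R' B _).trans
      (congrArg (algebraMap R' B) (Localization.localRingHom_to_map _ _ _ rfl a)))
  exact isRegularLocalRing_of_isRegularAlgebra (R := R) (R' := R') (B := B) p' hB hK Q hQ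

theorem flat_of_isAdicIso {A A' : Type u} [CommRing A] [CommRing A']
    [Algebra A A'] [IsNoetherianRing A] [IsNoetherianRing A'] (hG : IsGRing A)
    (h : ∀ (p' : Ideal A') [p'.IsMaximal], IsAdicIso
      (Localization.localRingHom (p'.comap (algebraMap A A')) p' (algebraMap A A') rfl)
      (IsLocalRing.maximalIdeal _) (IsLocalRing.maximalIdeal _)) :
    Module.Flat A A' := by
  refine Module.flat_of_isLocalized_maximal A' A' (fun P => Localization.AtPrime P)
    (fun P => Algebra.linearMap A' _) fun p' _ => ?_
  let p := p'.comap (algebraMap A A')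
  have h1 : (Localization.localRingHom p p' (algebraMap A A') rfl).Flat :=
    ((h p').flat_and_isRegularLocalRing hG p').1
  let : Algebra (Localization.AtPrime p) (Localization.AtPrime p') :=
    (Localization.localRingHom p p' (algebraMap A A') rfl).toAlgebra
  have : IsScalarTower A (Localization.AtPrime p) (Localization.AtPrime p') :=
    .of_algebraMap_eq fun x => (Localization.localRingHom_to_map _ _ _ rfl x).symm
  have : Module.Flat (Localization.AtPrime p) (Localization.AtPrime p') := h1
  exact Module.Flat.trans A (Localization.AtPrime p) (Localization.AtPrime p')

/-- Every prime of A' ⊗ K contracts into some maximal ideal of A', so information at maximal ideals,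
the only place where completions were compared, suffices. -/
theorem isRegularRing_of_isAdicIso {A A' : Type u} [CommRing A] [CommRing A']
    [Algebra A A'] [IsNoetherianRing A] [IsNoetherianRing A'] (hG : IsGRing A)
    (h : ∀ (p' : Ideal A') [p'.IsMaximal], IsAdicIso
      (Localization.localRingHom (p'.comap (algebraMap A A')) p' (algebraMap A A') rfl)
      (IsLocalRing.maximalIdeal _) (IsLocalRing.maximalIdeal _))
    (K : Type u) [Field K] [Algebra A K] (hK : FiniteOverFractions A K) :
    IsRegularRing (A' ⊗[A] K) := by
  have := hK.isNoetherianRing_tensorProduct A'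
  refine isRegularRing_iff.2 fun Q _ => ?_
  obtain ⟨p', hp', hle⟩ := Ideal.exists_le_maximal (Q.comap (algebraMap A' (A' ⊗[A] K)))
    (Ideal.IsPrime.ne_top inferInstance)
  exact ((h p').flat_and_isRegularLocalRing hG p').2 K hK Q hle

end Descent

end

/-! ### Connected components are affine open subschemes -/

noncomputable section

section ConnectedComponents

/-- In a noetherian space each point has a neighbourhood inside its connected component. -/
theorem exists_isOpen_forall_connectedComponent_eq {α : Type*} [TopologicalSpace α]
    [NoetherianSpace α] (x : α) :
    ∃ N : Set α, IsOpen N ∧ x ∈ N ∧ N ⊆ connectedComponent x := by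
  have hfin : {Z ∈ irreducibleComponents α | x ∉ Z}.Finite :=
    NoetherianSpace.finite_irreducibleComponents.subset fun _ h => h.1
  -- The neighbourhood omits the finitely many irreducible components that avoid x; an irreducible
  -- component through a remaining point contains x and is connected.
  refine ⟨(⋃ Z ∈ {Z ∈ irreducibleComponents α | x ∉ Z}, Z)ᶜ, ?_, ?_, fun y hy => ?_⟩
  · rw [isOpen_compl_iff]
    exact hfin.isClosed_biUnion fun Z hZ => isClosed_of_mem_irreducibleComponents Z hZ.1
  · intro h
    obtain ⟨Z, hZ, hx⟩ := Set.mem_iUnion₂.1 h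
    exact hZ.2 hx
  · have hx : x ∈ irreducibleComponent y := by
      by_contra hx
      exact hy (Set.mem_iUnion₂.2 ⟨_, ⟨irreducibleComponent_mem_irreducibleComponents y, hx⟩,
        mem_irreducibleComponent⟩)
    exact (isIrreducible_irreducibleComponent (x := y)).isPreirreducible.isPreconnected.subset_connectedComponent hx
      mem_irreducibleComponent

theorem isOpen_connectedComponent_of_noetherianSpace {α : Type*} [TopologicalSpace α]
    {ι : Type*} (W : ι → Opens α) (hW : ∀ i, NoetherianSpace (W i)) (hcov : ∀ x, ∃ i, x ∈ W i)
    (x : α) : IsOpen (connectedComponent x) := by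
  rw [isOpen_iff_mem_nhds]
  intro y hy
  obtain ⟨i, hi⟩ := hcov y
  obtain ⟨N, hN, hyN, hNy⟩ := exists_isOpen_forall_connectedComponent_eq (⟨y, hi⟩ : W i)
  refine Filter.mem_of_superset (((W i).isOpen.isOpenEmbedding_subtypeVal.isOpenMap N hN).mem_nhds
    ⟨_, hyN, rfl⟩) ?_
  rintro _ ⟨z, hz, rfl⟩
  rw [connectedComponent_eq hy]
  exact continuous_subtype_val.image_connectedComponent_subset ⟨y, hi⟩ ⟨z, hNy hz, rfl⟩

end ConnectedComponents

section AffineClopen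

/-- A clopen subset of a spectrum is the basic open of an idempotent. -/
theorem AlgebraicGeometry.IsAffineOpen.of_isClopen {U : Scheme.{u}} {W C : U.Opens}
    (hW : IsAffineOpen W) (hC : IsClosed (C : Set U)) (hCW : C ≤ W) : IsAffineOpen C := by
  have h1 : IsClopen (hW.fromSpec ⁻¹' (C : Set U)) :=
    ⟨hC.preimage hW.fromSpec.continuous, C.2.preimage hW.fromSpec.continuous⟩
  obtain ⟨e, -, he⟩ := PrimeSpectrum.exists_idempotent_basicOpen_eq_of_isClopen h1
  have h2 : C = U.basicOpen e := by
    rw [← hW.fromSpec_image_basicOpen e]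
    ext x
    constructor
    · intro hx
      obtain ⟨y, rfl⟩ : x ∈ Set.range hW.fromSpec := by
        rw [hW.range_fromSpec]; exact hCW hx
      exact ⟨y, he.le hx, rfl⟩
    · rintro ⟨y, hy, rfl⟩
      exact he.ge hy
  rw [h2]
  exact hW.basicOpen e

end AffineClopen

namespace AlgebraicGeometry.LocallyRingedSpace

theorem specSec_bijective (R : Type u) [CommRing R] {U : Opens (spec R).toTopCat} (hU : U = ⊤) :
    Function.Bijective (specSec R U) := by
  subst hU
  have h1 : ((spec R).res (le_top : (⊤ : Opens (spec R).toTopCat) ≤ ⊤)) = RingHom.id _ :=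
    RingHom.ext fun s => (spec R).res_self le_rfl s
  rw [specSec, h1, RingHom.id_comp]
  exact ConcreteCategory.bijective_of_isIso (Scheme.ΓSpecIso (CommRingCat.of R)).inv

variable {X : LocallyRingedSpace.{u}}

/-- R is the ring of sections of the reduction over the image V, a quotient of the noetherian ring
A_V by the lifting of sections. -/
theorem isNoetherianRing_of_isOpenImmersion (hX : IsLocallyNoetherianFormalScheme X)
    (hN : ∀ U : Opens X, IsAffineOpenSubspace X.reduction U → IsNoetherianRing (X.Sec U))
    {R : Type u} [CommRing R] (j : spec R ⟶ X.reduction) [LocallyRingedSpace.IsOpenImmersion j] :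
    IsNoetherianRing R := by
  let V : Opens X.toTopCat := ⟨Set.range j.base,
    (PresheafedSpace.IsOpenImmersion.base_open (f := j.toShHom.hom)).isOpen_range⟩
  have hV : ∀ x, x ∈ V ↔ ∃ z, j.base z = x := fun x => Iff.rfl
  have hVa : IsAffineOpenSubspace X.reduction V := isAffineOpenSubspace_of_hom j hV
  have := hN V hVa
  have h1 : IsNoetherianRing (X.reductionSections V) :=
    isNoetherianRing_of_surjective (X.Sec V) _ (X.toReduction.app (op V)).hom fun f => by
      obtain ⟨s, hs⟩ := exists_section_lift_of_isAffine hX hN hVa f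
      exact ⟨s, Subtype.ext (funext fun x => hs x.1 x.2)⟩
  let φ : X.reductionSections V →+* (spec R).Sec ((Opens.map j.base).obj V) := pull j V
  have hφ : Function.Bijective φ := IsOpenImmersion.app_bijective j V fun x hx => (hV x).1 hx
  have h2 := isNoetherianRing_of_ringEquiv _ (RingEquiv.ofBijective φ hφ)
  exact isNoetherianRing_of_ringEquiv _ (RingEquiv.ofBijective _ (specSec_bijective R
    (U := (Opens.map j.base).obj V) (top_le_iff.1 fun z _ => (hV _).2 ⟨z, rfl⟩))).symm

end AlgebraicGeometry.LocallyRingedSpace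

section Components

open AlgebraicGeometry.LocallyRingedSpace

variable {X : LocallyRingedSpace.{u}} {U : Scheme.{u}}

theorem noetherianSpace_of_isAffineOpen (hX : IsLocallyNoetherianFormalScheme X)
    (hN : ∀ U : Opens X, IsAffineOpenSubspace X.reduction U → IsNoetherianRing (X.Sec U))
    (a : U.toLocallyRingedSpace ⟶ X.reduction) {W : U.Opens} (hW : IsAffineOpen W)
    (h : LocallyRingedSpace.IsOpenImmersion (W.ι.toLRSHom ≫ a)) : NoetherianSpace W := by
  have h1 : LocallyRingedSpace.IsOpenImmersion hW.isoSpec.inv.toLRSHom :=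
    inferInstanceAs (AlgebraicGeometry.IsOpenImmersion hW.isoSpec.inv)
  let j : spec Γ(U, W) ⟶ X.reduction := hW.isoSpec.inv.toLRSHom ≫ (W.ι.toLRSHom ≫ a)
  have h2 : LocallyRingedSpace.IsOpenImmersion j := LocallyRingedSpace.IsOpenImmersion.comp _ _
  have h3 : IsNoetherianRing Γ(U, W) := isNoetherianRing_of_isOpenImmersion hX hN j
  have h4 : NoetherianSpace (PrimeSpectrum Γ(U, W)) := inferInstance
  exact (hW.isoSpec.hom.homeomorph.isInducing : Topology.IsInducing _).noetherianSpace

theorem setOf_connectedComponents_eq (x : U) :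
    {y : U | (y : _root_.ConnectedComponents U) = x} = connectedComponent x :=
  Set.ext fun _ => ConnectedComponents.coe_eq_coe'

/-- The affine pieces are noetherian spaces, so components are open as well as closed. A component
lies in one piece, because the pieces are disjoint and hence clopen, and is clopen in it. -/
theorem IsDisjointUnionOfAffineOpens.exists_isAffineOpen (hX : IsLocallyNoetherianFormalScheme X)
    (hN : ∀ U : Opens X, IsAffineOpenSubspace X.reduction U → IsNoetherianRing (X.Sec U))
    {a : U.toLocallyRingedSpace ⟶ X.reduction} (ha : IsDisjointUnionOfAffineOpens a)
    (c : _root_.ConnectedComponents U) :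
    ∃ C W : U.Opens, (C : Set U) = {x : U | (x : _root_.ConnectedComponents U) = c} ∧
      IsAffineOpen C ∧ C ≤ W ∧ LocallyRingedSpace.IsOpenImmersion (W.ι.toLRSHom ≫ a) := by
  obtain ⟨ι, W, hW, hd, hcov, hop⟩ := ha
  have hcov' : ∀ x : U, ∃ i, x ∈ W i := fun x => by
    have h1 : x ∈ (⨆ i, W i) := hcov ▸ trivial
    exact Opens.mem_iSup.1 h1
  obtain ⟨x, rfl⟩ := ConnectedComponents.surjective_coe c
  obtain ⟨i, hi⟩ := hcov' x
  have hopen : IsOpen (connectedComponent x) := isOpen_connectedComponent_of_noetherianSpace W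
    (fun i => noetherianSpace_of_isAffineOpen hX hN a (hW i) (hop i)) hcov' x
  have hclosed : IsClosed (W i : Set U) := by
    have h1 : (W i : Set U)ᶜ = ⋃ j : {j // j ≠ i}, (W j.1 : Set U) := by
      ext y
      constructor
      · intro hy
        obtain ⟨j, hj⟩ := hcov' y
        exact Set.mem_iUnion.2 ⟨⟨j, fun h => hy (h ▸ hj)⟩, hj⟩
      · intro hy hyi
        obtain ⟨⟨j, hj⟩, hyj⟩ := Set.mem_iUnion.1 hy
        have h2 := (hd hj).le_bot ⟨hyj, hyi⟩
        exact h2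
    rw [← isOpen_compl_iff, h1]
    exact isOpen_iUnion fun j => (W j.1).isOpen
  have hle : connectedComponent x ⊆ W i := isPreconnected_connectedComponent.subset_isClopen
    ⟨hclosed, (W i).isOpen⟩ ⟨x, mem_connectedComponent, hi⟩
  exact ⟨⟨connectedComponent x, hopen⟩, W i, (setOf_connectedComponents_eq x).symm,
    (hW i).of_isClopen isClosed_connectedComponent hle, hle, hop i⟩

theorem IsDisjointUnionOfAffineOpens.isAffineOpenSubspace (hX : IsLocallyNoetherianFormalScheme X)
    (hN : ∀ U : Opens X, IsAffineOpenSubspace X.reduction U → IsNoetherianRing (X.Sec U))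
    {a : U.toLocallyRingedSpace ⟶ X.reduction} (ha : IsDisjointUnionOfAffineOpens a)
    (c : _root_.ConnectedComponents U) :
    IsAffineOpenSubspace X.reduction (componentOpen (X := X) a c) := by
  obtain ⟨C, W, hCc, hC, hCW, hop⟩ := ha.exists_isAffineOpen hX hN c
  let k : Spec Γ(U, C) ⟶ W := hC.isoSpec.inv ≫ U.homOfLE hCW
  have h1 : LocallyRingedSpace.IsOpenImmersion k.toLRSHom :=
    inferInstanceAs (AlgebraicGeometry.IsOpenImmersion (hC.isoSpec.inv ≫ U.homOfLE hCW))
  let j : spec Γ(U, C) ⟶ X.reduction := k.toLRSHom ≫ (W.ι.toLRSHom ≫ a)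
  have h2 : LocallyRingedSpace.IsOpenImmersion j := LocallyRingedSpace.IsOpenImmersion.comp _ _
  have h3 : k ≫ W.ι = hC.fromSpec := by
    rw [Category.assoc, Scheme.homOfLE_ι]; rfl
  have h4 : Set.range j.base = a.base '' {x : U | (x : _root_.ConnectedComponents U) = c} := by
    rw [← hCc, ← hC.range_fromSpec, ← h3, ← Set.range_comp]
    rfl
  refine isAffineOpenSubspace_of_hom j fun x => ?_
  have h5 : IsOpen (Set.range j.base) :=
    (PresheafedSpace.IsOpenImmersion.base_open (f := j.toShHom.hom)).isOpen_range
  -- The image of the component is already open, so taking the interior changes nothing.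
  have h6 : (componentOpen (X := X) a c : Set X.toTopCat) = Set.range j.base := by
    rw [h4] at h5 ⊢
    exact h5.interior_eq
  exact Set.ext_iff.1 h6 x

end Components

end

/-! ### Regular schemes and regular morphisms between disjoint unions of spectra -/

noncomputable section

section RegularScheme

theorem IsRegularScheme.of_openCover {X : Scheme.{u}} (𝒰 : X.OpenCover)
    (h : ∀ i, IsRegularScheme (𝒰.X i)) : IsRegularScheme X := by
  refine ⟨(isLocallyNoetherian_iff_openCover 𝒰).2 fun i => (h i).1, fun x => ?_⟩
  obtain ⟨y, hy⟩ := 𝒰.covers x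
  have := (h (𝒰.idx x)).2 y
  rw [← hy]
  exact IsRegularLocalRing.of_ringEquiv
    (asIso ((𝒰.f (𝒰.idx x)).stalkMap y)).commRingCatIsoToRingEquiv.symm

theorem IsRegularScheme.of_isEmpty (X : Scheme.{u}) [IsEmpty X] : IsRegularScheme X :=
  ⟨isLocallyNoetherian_of_affine_cover (ι := PEmpty.{1}) (S := fun i => i.elim)
    (by ext x; exact isEmptyElim x) fun i => i.elim, fun x => isEmptyElim x⟩

theorem IsRegularScheme.of_iso {X Y : Scheme.{u}} (e : X ≅ Y) (h : IsRegularScheme Y) :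
    IsRegularScheme X := by
  have := h.1
  refine ⟨isLocallyNoetherian_of_isOpenImmersion e.hom, fun x => ?_⟩
  have := h.2 (e.hom x)
  exact IsRegularLocalRing.of_ringEquiv (asIso (e.hom.stalkMap x)).commRingCatIsoToRingEquiv

theorem isRegularScheme_Spec (R : CommRingCat.{u}) [IsRegularRing R] : IsRegularScheme (Spec R) :=
  ⟨inferInstance, fun x => IsRegularLocalRing.of_ringEquiv
    (Spec.stalkIso R x).symm.commRingCatIsoToRingEquiv⟩

/-- A preimmersion is surjective on local rings; at the point of Spec k this says that k consists of
fractions of elements of A. -/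
theorem exists_of_isPreimmersion {A k : CommRingCat.{u}} (χ : A ⟶ k) [IsPreimmersion (Spec.map χ)]
    (hk : IsField k) (t : k) : ∃ a b : A, χ b ≠ 0 ∧ t * χ b = χ a := by
  let := hk.toField
  have h1 := ((IsPreimmersion.SpecMap_iff χ).1 inferInstance).2 (⊥ : Ideal k) Ideal.isPrime_bot
  rw [RingHom.surjective_localRingHom_iff] at h1
  obtain ⟨a, b, c, hc, hb, h2⟩ := h1 t
  refine ⟨a, b, hb, ?_⟩
  rw [mul_assoc] at h2
  rw [mul_comm]
  exact mul_left_cancel₀ hc h2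

/-- If P is nonempty, y lies in the open Spec A, the morphism from Spec κ(y) factors through it, and
P is the spectrum of A' ⊗[A] K. -/
theorem isRegularScheme_of_isPullback {Y : Scheme.{u}} {A A' : CommRingCat.{u}} (ρ : A ⟶ A')
    (ι : Spec A ⟶ Y) [IsOpenImmersion ι]
    (hreg : ∀ (K : Type u) [Field K] (φ : A →+* K),
      letI := ρ.hom.toAlgebra
      letI := φ.toAlgebra
      FiniteOverFractions A K → IsRegularRing (A' ⊗[A] K))
    (y : Y) (K : Type u) [Field K] [Algebra (Y.residueField y) K]
    [FiniteDimensional (Y.residueField y) K] {P : Scheme.{u}} (p : P ⟶ Spec A')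
    (q : P ⟶ Spec (.of K))
    (h : IsPullback p q (Spec.map ρ ≫ ι)
      (Spec.map (CommRingCat.ofHom (algebraMap (Y.residueField y) K)) ≫
        Y.fromSpecResidueField y)) : IsRegularScheme P := by
  obtain hP | ⟨⟨z⟩⟩ := isEmpty_or_nonempty P
  · exact .of_isEmpty P
  have hy : y ∈ Set.range ι := by
    have h1 := congrArg (fun f : P ⟶ Y => f z) h.w
    have h2 : Y.fromSpecResidueField y (Spec.map (CommRingCat.ofHom
        (algebraMap (Y.residueField y) K)) (q z)) = y :=
      (Scheme.range_fromSpecResidueField y).le ⟨_, rfl⟩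
    exact ⟨_, h1.trans h2⟩
  let ℓ : Spec (Y.residueField y) ⟶ Spec A := IsOpenImmersion.lift ι (Y.fromSpecResidueField y) (by
    rw [Scheme.range_fromSpecResidueField]
    simpa using hy)
  let χ := Spec.preimage ℓ
  have hχ : Spec.map χ ≫ ι = Y.fromSpecResidueField y := by
    rw [show Spec.map χ = ℓ from Spec.map_preimage ℓ, IsOpenImmersion.lift_fac]
  have : IsPreimmersion (Spec.map χ ≫ ι) := hχ ▸ inferInstance
  have : IsPreimmersion (Spec.map χ) := IsPreimmersion.of_comp _ ι
  let ψ : A ⟶ CommRingCat.of K := χ ≫ CommRingCat.ofHom (algebraMap (Y.residueField y) K)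
  let := ρ.hom.toAlgebra
  let := ψ.hom.toAlgebra
  let : Algebra A (Y.residueField y) := χ.hom.toAlgebra
  have : IsScalarTower A (Y.residueField y) K := .of_algebraMap_eq fun _ => rfl
  have hK : FiniteOverFractions A K := .of_moduleFinite (Y.residueField y)
    (exists_of_isPreimmersion χ (Field.toIsField _))
  have := hreg K ψ.hom hK
  have hψ : Spec.map ψ ≫ ι = Spec.map (CommRingCat.ofHom (algebraMap (Y.residueField y) K)) ≫
      Y.fromSpecResidueField y := by
    rw [← hχ, ← Category.assoc, ← Spec.map_comp]; rfl
  have h1 : IsPullback p q (Spec.map ρ) (Spec.map ψ) := by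
    have hw : p ≫ Spec.map ρ = q ≫ Spec.map ψ := by
      rw [← cancel_mono ι, Category.assoc, Category.assoc, hψ]
      exact h.w
    exact ⟨⟨hw⟩, ⟨PullbackCone.isLimitOfFactors _ _ ι _ _ rfl hψ _ h.isLimit⟩⟩
  exact .of_iso (h1.isoPullback ≪≫ pullbackSpecIso A A' K) (isRegularScheme_Spec _)

/-- Regularity of a fibre is checked on the open cover pulled back from the summands of the source;
pasting pullback squares turns each member into a fibre of one Spec A' → Spec A. -/
theorem isRegularMorphism_sigmaDesc {ι ι' : Type u} (A : ι → CommRingCat.{u})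
    (A' : ι' → CommRingCat.{u}) (g : ι' → ι) (ρ : ∀ i, A (g i) ⟶ A' i)
    (hflat : ∀ i, (ρ i).hom.Flat)
    (hreg : ∀ i (K : Type u) [Field K] (φ : A (g i) →+* K),
      letI := (ρ i).hom.toAlgebra
      letI := φ.toAlgebra
      FiniteOverFractions (A (g i)) K → IsRegularRing (A' i ⊗[A (g i)] K)) :
    IsRegularMorphism (Sigma.desc fun i =>
      Spec.map (ρ i) ≫ Sigma.ι (fun i => Spec (A i)) (g i)) := by
  have hflat' : ∀ i, Flat (Spec.map (ρ i) ≫ Sigma.ι (fun i => Spec (A i)) (g i)) := fun i => by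
    have : Flat (Spec.map (ρ i)) := Flat.SpecMap_iff.2 (hflat i)
    infer_instance
  refine ⟨inferInstance, fun y K _ _ _ => ?_⟩
  let f := Sigma.desc fun i => Spec.map (ρ i) ≫ Sigma.ι (fun i => Spec (A i)) (g i)
  let P := pullback (f.fiberToSpecResidueField y)
      (Spec.map (CommRingCat.ofHom (algebraMap ((∐ fun i => Spec (A i)).residueField y) K)))
  let p : P ⟶ ∐ fun i => Spec (A' i) := pullback.fst _ _ ≫ f.fiberι y
  have h1 : IsPullback p (pullback.snd _ _) f (Spec.map (CommRingCat.ofHom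
      (algebraMap ((∐ fun i => Spec (A i)).residueField y) K)) ≫
      (∐ fun i => Spec (A i)).fromSpecResidueField y) :=
    (IsPullback.of_hasPullback (f.fiberToSpecResidueField y) _).paste_horiz
      (IsPullback.of_hasPullback f ((∐ fun i => Spec (A i)).fromSpecResidueField y))
  refine IsRegularScheme.of_openCover ((sigmaOpenCover fun i => Spec (A' i)).pullback₁ p)
    fun i => ?_
  have h2 := ((IsPullback.of_hasPullback p (Sigma.ι (fun i => Spec (A' i)) i)).flip.paste_vert h1)
  have h3 : Sigma.ι (fun i => Spec (A' i)) i ≫ f =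
      Spec.map (ρ i) ≫ Sigma.ι (fun i => Spec (A i)) (g i) := Sigma.ι_desc _ _
  rw [h3] at h2
  exact isRegularScheme_of_isPullback (ρ i) _ (hreg i) y K _ _ h2

end RegularScheme

end

/-! ### Regularity of restriction maps and the main theorem -/

noncomputable section

theorem isAdicIso_localRingHom_comap {A A' : Type*} [CommRing A] [CommRing A'] {f : A →+* A'}
    {p : Ideal A} [p.IsPrime] {p' : Ideal A'} [p'.IsPrime] {hp : p = p'.comap f}
    (h : IsAdicIso (Localization.localRingHom p p' f hp)
      (IsLocalRing.maximalIdeal _) (IsLocalRing.maximalIdeal _)) :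
    IsAdicIso (Localization.localRingHom (p'.comap f) p' f rfl)
      (IsLocalRing.maximalIdeal _) (IsLocalRing.maximalIdeal _) := by
  subst hp
  exact h

namespace AlgebraicGeometry.LocallyRingedSpace

variable {X : LocallyRingedSpace.{u}} {V V' : Opens X.toTopCat}

/-- A maximal ideal lies in the ideal of some point, hence equals it, and the comparison of
completions at points applies. -/
theorem isAdicIso_localRingHom_of_isMaximal (hX : IsLocallyNoetherianFormalScheme X)
    (hN : ∀ U : Opens X, IsAffineOpenSubspace X.reduction U → IsNoetherianRing (X.Sec U))
    (hV : IsAffineOpenSubspace X.reduction V) (hV' : IsAffineOpenSubspace X.reduction V')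
    (h : V' ≤ V) (p' : Ideal (X.Sec V')) [hp' : p'.IsMaximal] :
    IsAdicIso (Localization.localRingHom (p'.comap (X.res h)) p' (X.res h) rfl)
      (IsLocalRing.maximalIdeal _) (IsLocalRing.maximalIdeal _) := by
  obtain ⟨x, hx, hle⟩ := exists_le_pointIdeal hX hN hV' p' hp'
  obtain rfl : p' = pointIdeal x hx := hp'.eq_of_le (Ideal.IsPrime.ne_top inferInstance) hle
  exact isAdicIso_localRingHom_comap (isAdicIso_localRingHom_res hX hN hV hV' h x hx)

theorem flat_res (hX : IsLocallyNoetherianFormalScheme X) (hexc : IsExcellentFormalScheme X)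
    (hV : IsAffineOpenSubspace X.reduction V) (hV' : IsAffineOpenSubspace X.reduction V')
    (h : V' ≤ V) : (X.res h).Flat := by
  have hN : ∀ U : Opens X, IsAffineOpenSubspace X.reduction U → IsNoetherianRing (X.Sec U) :=
    fun U hU => (hexc U hU).isNoetherianRing
  have := hN V hV
  have := hN V' hV'
  let := (X.res h).toAlgebra
  exact flat_of_isAdicIso (hexc V hV).isGRing
    fun p' _ => isAdicIso_localRingHom_of_isMaximal hX hN hV hV' h p'

theorem isRegularRing_tensorProduct_res (hX : IsLocallyNoetherianFormalScheme X)
    (hexc : IsExcellentFormalScheme X) (hV : IsAffineOpenSubspace X.reduction V)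
    (hV' : IsAffineOpenSubspace X.reduction V') (h : V' ≤ V) (K : Type u) [Field K]
    (φ : X.Sec V →+* K) :
    letI := (X.res h).toAlgebra
    letI := φ.toAlgebra
    FiniteOverFractions (X.Sec V) K → IsRegularRing (X.Sec V' ⊗[X.Sec V] K) := by
  intro hK
  let := (X.res h).toAlgebra
  let := φ.toAlgebra
  have hN : ∀ U : Opens X, IsAffineOpenSubspace X.reduction U → IsNoetherianRing (X.Sec U) :=
    fun U hU => (hexc U hU).isNoetherianRing
  have := hN V hV
  have := hN V' hV'
  exact isRegularRing_of_isAdicIso (hexc V hV).isGRing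
    (fun p' _ => isAdicIso_localRingHom_of_isMaximal hX hN hV hV' h p') K hK

end AlgebraicGeometry.LocallyRingedSpace

section Hat

variable {X : LocallyRingedSpace.{u}} {U U' : Scheme.{u}}

theorem isRegularMorphism_hatMap (a : U.toLocallyRingedSpace ⟶ X.reduction)
    (a' : U'.toLocallyRingedSpace ⟶ X.reduction) (f : U' ⟶ U) (hf : f.toLRSHom ≫ a = a')
    (hflat : ∀ c, (X.res (componentOpen_le a a' f hf c)).Flat)
    (hreg : ∀ c (K : Type u) [Field K]
      (φ : X.Sec (componentOpen a (f.continuous.connectedComponentsMap c)) →+* K),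
      letI := (X.res (componentOpen_le a a' f hf c)).toAlgebra
      letI := φ.toAlgebra
      FiniteOverFractions (X.Sec (componentOpen a (f.continuous.connectedComponentsMap c))) K →
        IsRegularRing (X.Sec (componentOpen a' c) ⊗[
          X.Sec (componentOpen a (f.continuous.connectedComponentsMap c))] K)) :
    IsRegularMorphism (hatMap a a' f hf) :=
  isRegularMorphism_sigmaDesc (fun c => X.presheaf.obj (op (componentOpen a c)))
    (fun c => X.presheaf.obj (op (componentOpen a' c))) f.continuous.connectedComponentsMap
    (fun c => X.presheaf.map (homOfLE (componentOpen_le a a' f hf c)).op) hflat hreg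

end Hat

end

theorem proposition2 (𝒳 : LocallyRingedSpace.{u}) (h𝒳 : IsLocallyNoetherianFormalScheme 𝒳)
    (hexc : IsExcellentFormalScheme 𝒳) (U U' : Scheme.{u})
    (a : U.toLocallyRingedSpace ⟶ 𝒳.reduction) (a' : U'.toLocallyRingedSpace ⟶ 𝒳.reduction)
    (ha : IsDisjointUnionOfAffineOpens a) (ha' : IsDisjointUnionOfAffineOpens a')
    (f : U' ⟶ U) (hf : f.toLRSHom ≫ a = a') :
    IsRegularMorphism (hatMap a a' f hf) := by
  have hN : ∀ U : Opens 𝒳, IsAffineOpenSubspace 𝒳.reduction U → IsNoetherianRing (𝒳.Sec U) :=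
    fun U hU => (hexc U hU).isNoetherianRing
  have h := ha.isAffineOpenSubspace h𝒳 hN
  have h' := ha'.isAffineOpenSubspace h𝒳 hN
  refine isRegularMorphism_hatMap a a' f hf (fun c => ?_) (fun c K _ φ => ?_)
  · exact LocallyRingedSpace.flat_res h𝒳 hexc (h _) (h' c) (componentOpen_le a a' f hf c)
  · exact LocallyRingedSpace.isRegularRing_tensorProduct_res h𝒳 hexc (h _) (h' c)
      (componentOpen_le a a' f hf c) K φ
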